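/- **Setting.** For an absolutely summable autocovariance function $\gamma$ on $\mathbb Z$ write $f(\lambda)=\frac1{2\pi}\sum_{k\in\mathbb Z}\gamma(k)e^{-ik\lambda}$ for its spectral density and $\Sigma_n(\gamma)=(\gamma(s-t))_{1\le s,t\le n}$. *Working model and data.* The working model is a mean-zero stationary Gaussian series with autocovariance function $\gamma_{\rm param}$ and spectral density $f_{\rm param}$; $p_{\rm param}$ denotes the density of $N(0,\Sigma_n(\gamma_{\rm param}))$. The data $\mathbf Z_n=(Z_1,\dots,Z_n)^T$ come from a mean-zero stationary Gaussian series with autocovariance function $\gamma_0$ and spectral density $f_0$; their law is $P_{n,f_0}$. Assume, for both $(\gamma,f)=(\gamma_{\rm param},f_{\rm param})$ and $(\gamma,f)=(\gamma_0,f_0)$, that $\sum_{h\in\mathbb Z}|h|^{\alpha}|\gamma(h)|<\infty$ for some $\alpha>1$, and that there is $\beta>0$ with $f(\lambda)\ge\beta$ for all $\lambda\in[-\pi,\pi]$. *Corrected likelihood.* Fix $\eta\in[0,1]$. Let $\lambda_j=2\pi j/n$, $N=\lfloor (n-1)/2\rfloor$ and $\mathbf e_j=n^{-1/2}(e^{-2\pi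 ij t/n})_{t=1,\dots,n}$, and let $F_n$ be the orthogonal $n\times n$ matrix with rows $\mathbf e_0,\sqrt2\,\Re\mathbf e_1,\sqrt2\,\Im\mathbf e_1,\dots,\sqrt2\,\Re\mathbf e_N,\sqrt2\,\Im\mathbf e_N$, followed by $\mathbf e_{n/2}$ if $n$ is even. For $c:[0,\pi]\to(0,\infty)$ let $C_n$ be the diagonal matrix with the values of $c\,f_{\rm param}^{\eta-1}$ at $\lambda_0,\lambda_1,\lambda_1,\dots,\lambda_N,\lambda_N$ (and $\lambda_{n/2}$ if $n$ is even) on its diagonal, and put $$p_n(\mathbf z\mid c)=\det(C_n)^{-1/2}\,p_{\rm param}\bigl(F_n^TC_n^{-1/2}F_n\mathbf z\bigr).$$ *Prior.* The prior $\Pi$ is the law of the random function $$c(\pi\omega)=\tau\sum_{j=1}^kG\bigl(\tfrac{j-1}k,\tfrac jk\bigr]\,\frac{\Gamma(k+1)}{\Gamma(j)\Gamma(k-j+1)}\,\omega^{j-1}(1-\omega)^{k-j},\qquad 0\le\omega\le1,$$ where $k$ has a probability function $p_k$ on $\{1,2,\dots\}$, and $G$, independent of $k$, is a Dirichlet process with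 base measure $MG_0$, with $M>0$ and $G_0$ a probability measure on $[0,1]$ with Lebesgue density $g_0$. Assume: - (P1) $0<p_k(k)\le B e^{-b\,k\log k}$ for all $k\ge1$, for some constants $B,b>0$; - (P2) $g_0$ is bounded, continuous and bounded away from $0$; - (P3) $\tau$ is fixed and known, that is, $\tau=\int_0^1c_{0,\eta}(\pi\omega)\,d\omega$, where $c_{0,\eta}(\lambda)=f_0(\lambda)/f_{\rm param}(\lambda)^{\eta}$. Let $\Pi_n(A\mid\mathbf Z_n)=\int_Ap_n(\mathbf Z_n\mid c)\,d\Pi(c)\big/\int p_n(\mathbf Z_n\mid c)\,d\Pi(c)$ be the pseudo-posterior. **Theorem.** For every $\epsilon>0$, $$\Pi_n\Bigl(c:\int_0^\pi|c(\lambda)-c_{0,\eta}(\lambda)|\,d\lambda>\epsilon\ \Big|\ \mathbf Z_n\Bigr)\longrightarrow0\qquad(n\to\infty)$$ in $P_{n,f_0}$-probability. -/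

import Mathlib

open MeasureTheory ProbabilityTheory Filter Topology
open scoped ENNReal Matrix

noncomputable section

namespace CorrectedLikelihood

/-! ### Stationary time series -/

/-- The covariance matrix `(γ(s - t))_{s,t}` of `n` consecutive observations. -/
def autocovMatrix (γ : ℤ → ℝ) (n : ℕ) : Matrix (Fin n) (Fin n) ℝ :=
  Matrix.of fun s t => γ ((s : ℤ) - (t : ℤ))

/-- `γ` is the autocovariance function of some real stationary series: it is even and all its
Toeplitz matrices are positive semidefinite. -/
def IsAutocovariance (γ : ℤ → ℝ) : Prop :=
  (∀ h, γ (-h) = γ h) ∧ ∀ n, (autocovMatrix γ n).PosSemidef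

/-- `Z` is a real stationary mean-zero Gaussian time series with autocovariance function `γ`. -/
structure IsStationaryGaussian {Ω : Type*} [MeasurableSpace Ω] (Z : ℕ → Ω → ℝ) (P : Measure Ω)
    (γ : ℤ → ℝ) : Prop where
  gaussian : IsGaussianProcess Z P
  mean_zero : ∀ t, P[Z t] = 0
  autocov : ∀ s t : ℕ, cov[Z s, Z t; P] = γ ((s : ℤ) - (t : ℤ))

/-- The spectral density `f(λ) = (2π)⁻¹ ∑ₖ γ(k) exp(-ikλ)`; the series is real for even `γ`. -/
def spectralDensity (γ : ℤ → ℝ) (l : ℝ) : ℝ :=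
  (2 * Real.pi)⁻¹ * (∑' k : ℤ, (γ k : ℂ) * Complex.exp (-Complex.I * k * l)).re

/-! ### The orthonormal discrete Fourier transform and the corrected likelihood -/

/-- Entry `t` (`t = 1, …, n`) of `e_j = n^{-1/2} (exp(-2πij/n), …, exp(-2πijn/n))`. -/
def fourierVec (n j t : ℕ) : ℂ :=
  ((Real.sqrt n)⁻¹ : ℝ) * Complex.exp (-2 * Real.pi * Complex.I * j * t / n)

/-- The matrix `F_n` with rows `e_0, c_1, s_1, …, c_N, s_N`, and also `e_{n/2}` if `n` is even,
where `c_j = √2 Re e_j` and `s_j = √2 Im e_j`. Column `t : Fin n` belongs to time `t + 1`. -/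
def fourierMatrix (n : ℕ) : Matrix (Fin n) (Fin n) ℝ :=
  Matrix.of fun i t =>
    if (i : ℕ) = 0 then (fourierVec n 0 ((t : ℕ) + 1)).re
    else if Even n ∧ (i : ℕ) + 1 = n then (fourierVec n (n / 2) ((t : ℕ) + 1)).re
    else if Odd (i : ℕ) then Real.sqrt 2 * (fourierVec n (((i : ℕ) + 1) / 2) ((t : ℕ) + 1)).re
    else Real.sqrt 2 * (fourierVec n ((i : ℕ) / 2) ((t : ℕ) + 1)).im

/-- The Fourier frequency `λ_j = 2πj/n` that belongs to row `i` of `F_n`: `j = ⌊(i+1)/2⌋`, so the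
rows belong to `λ_0, λ_1, λ_1, …, λ_N, λ_N`, and also `λ_{n/2}` if `n` is even. -/
def rowFreq (n : ℕ) (i : Fin n) : ℝ :=
  2 * Real.pi * (((i : ℕ) + 1) / 2 : ℕ) / n

/-- Lebesgue density of the centred Gaussian law on `ℝⁿ` with (invertible) covariance `S`. -/
def gaussianDensity {n : ℕ} (S : Matrix (Fin n) (Fin n) ℝ) (z : Fin n → ℝ) : ℝ :=
  (Real.sqrt ((2 * Real.pi) ^ n * S.det))⁻¹ * Real.exp (-(1 / 2) * (z ⬝ᵥ (S⁻¹ *ᵥ z)))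

/-- Diagonal of the correction matrix `C_n = C_n(c · f_param^{η-1})`. -/
def correctionDiag (γp : ℤ → ℝ) (η : ℝ) (n : ℕ) (c : ℝ → ℝ) (i : Fin n) : ℝ :=
  c (rowFreq n i) * spectralDensity γp (rowFreq n i) ^ (η - 1)

/-- The corrected likelihood `det(C_n)^{-1/2} p_param(F_nᵀ C_n^{-1/2} F_n z)` of the correction
function `c`, where the working model is centred, stationary and Gaussian with autocovariance
function `γp`. -/
def correctedLikelihood (γp : ℤ → ℝ) (η : ℝ) (n : ℕ) (c : ℝ → ℝ) (z : Fin n → ℝ) : ℝ :=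
  (Matrix.diagonal (correctionDiag γp η n c)).det ^ (-(1 / 2) : ℝ) *
    gaussianDensity (autocovMatrix γp n)
      (((fourierMatrix n)ᵀ *
        Matrix.diagonal (fun i => correctionDiag γp η n c i ^ (-(1 / 2) : ℝ)) *
        fourierMatrix n) *ᵥ z)

/-! ### The Dirichlet process -/

/-- The Gamma law with shape `a ≥ 0` and rate `1`, a point mass at `0` for shape `0`. -/
def gammaLaw (a : ℝ) : Measure ℝ :=
  if a = 0 then Measure.dirac 0 else gammaMeasure a 1

/-- The Dirichlet distribution with parameters `a_i ≥ 0`, not all zero: the law of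
`(X_i / ∑ⱼ X_j)_i` for independent `X_i ∼ Gamma(a_i, 1)`. -/
def dirichletLaw {m : ℕ} (a : Fin m → ℝ) : Measure (Fin m → ℝ) :=
  (Measure.pi fun i => gammaLaw (a i)).map fun x i => x i / ∑ j, x j

/-- `D` is the law of a Dirichlet process with finite base measure `α`: for every finite measurable
partition `A` of the line, `(G(A_i))_i` is Dirichlet distributed with parameters `(α(A_i))_i`. -/
def IsDirichletProcess (D : Measure (Measure ℝ)) (α : Measure ℝ) : Prop :=
  IsProbabilityMeasure D ∧
  ∀ (m : ℕ) (A : Fin m → Set ℝ), (∀ i, MeasurableSet (A i)) →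
    Pairwise (Function.onFun Disjoint A) → (⋃ i, A i) = Set.univ →
    D.map (fun G i => (G (A i)).toReal) = dirichletLaw fun i => (α (A i)).toReal

/-- The measure on `[0,1]` with Lebesgue density `g₀`. -/
def baseMeasure (g₀ : ℝ → ℝ) : Measure ℝ :=
  (volume.restrict (Set.Icc 0 1)).withDensity fun x => ENNReal.ofReal (g₀ x)

/-! ### The Bernstein–Dirichlet prior and the pseudo-posterior -/

/-- The beta density with integer parameters `l, m ≥ 1`, as a polynomial on the closed interval
`[0,1]` (so that it has its continuous values at the end points). -/
def betaDensity (l m : ℕ) (x : ℝ) : ℝ :=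
  Real.Gamma (l + m) / (Real.Gamma l * Real.Gamma m) * x ^ (l - 1) * (1 - x) ^ (m - 1)

/-- `q(x | k, G) = ∑_{j=1}^k G((j-1)/k, j/k] β(x | j, k-j+1)`. -/
def bernsteinDensity (k : ℕ) (G : Measure ℝ) (x : ℝ) : ℝ :=
  ∑ j ∈ Finset.Icc 1 k,
    (G (Set.Ioc (((j : ℝ) - 1) / k) ((j : ℝ) / k))).toReal * betaDensity j (k - j + 1) x

/-- The correction function `c(λ) = τ q(λ/π | k, G)`, `0 ≤ λ ≤ π`, with parameter `θ = (k, G)`. -/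
def correctionFun (τ : ℝ) (θ : ℕ × Measure ℝ) (l : ℝ) : ℝ :=
  τ * bernsteinDensity θ.1 θ.2 (l / Real.pi)

/-- The prior: `k ∼ p` and `G ∼ D` are independent. -/
def prior (p : PMF ℕ) (D : Measure (Measure ℝ)) : Measure (ℕ × Measure ℝ) :=
  p.toMeasure.prod D

/-- The pseudo-posterior given `z`: prior times corrected likelihood, normalized. -/
def pseudoPosterior (γp : ℤ → ℝ) (η τ : ℝ) (Pr : Measure (ℕ × Measure ℝ)) (n : ℕ)
    (z : Fin n → ℝ) : Measure (ℕ × Measure ℝ) :=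
  (∫⁻ θ, ENNReal.ofReal (correctedLikelihood γp η n (correctionFun τ θ) z) ∂Pr)⁻¹ •
    Pr.withDensity fun θ =>
      ENNReal.ofReal (correctedLikelihood γp η n (correctionFun τ θ) z)

/-- The true correction function `c_{0,η} = f_0 / f_param^η`. -/
def trueCorrection (γ₀ γp : ℤ → ℝ) (η : ℝ) (l : ℝ) : ℝ :=
  spectralDensity γ₀ l / spectralDensity γp l ^ η

/-- The `L¹` distance on `[0,π]`. -/
def l1Dist (c d : ℝ → ℝ) : ℝ :=
  ∫ l in (0 : ℝ)..Real.pi, |c l - d l|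

end CorrectedLikelihood

end

namespace CorrectedLikelihood

/-! ### Positive definite real matrices -/

section LinearAlgebra

open scoped MatrixOrder

variable {ι : Type*} [Fintype ι] [DecidableEq ι]

set_option linter.unusedSectionVars false

/-! The proof is a Schwartz-type consistency argument: prior mass near the truth bounds the
denominator of the posterior from below, and exponentially powerful tests on a sieve, with an
exponentially small prior tail off it, bound the numerator (`tendsto_posterior_zero`).

The corrected likelihood is not merely a pseudo-likelihood. If `c` is positive at the Fourier
frequencies it is the density of a centred Gaussian law (`correctedLikelihood_eq_gaussianDensity`);
otherwise it vanishes identically. Everything therefore reduces to comparing centred Gaussian laws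
with the law of the data. In Fourier coordinates a Toeplitz covariance is `2π f` on the diagonal up
to entries of order `1/n` (`abs_fourier_autocov_sub_le`). The corrected model thus has variances
close to `2π c f_param^η` and the data have variances close to `2π f₀`; they match at `c = c_{0,η}`.

Near the truth: if `c` is within relative error `ρ` of `c_{0,η}`, the symmetrized Gaussian
divergence is at most `4ρn + O(√n)` (`exists_divergence_bound`), and a Markov bound that uses no
variance turns this into a lower bound `exp(-δn)` for the likelihood ratio with high probability
(`measure_gaussianDensity_lt_le`). Bernstein approximation and the full support of Dirichlet laws
give positive prior mass to such `c` (`exists_prior_neighbourhood`).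

Far from the truth: because `τ` is the true mass, `c` has at most the mass of `c_{0,η}`. Being
`L¹`-far then forces `c` to lie well below `c_{0,η}` on a set of positive measure, and even on a
fixed fraction of the Fourier frequencies when the polynomial order is a small enough multiple of
`n`, since the total variation of `c` is linear in its order (`card_far_ge`). On this set `J` of
frequencies the statistic `∑_{i ∈ J} (Fz)_i² / (2π f₀(λ_i))` is about `|J|` under the truth but at
most about `(1-e)|J|` under `c`; Chernoff bounds separate the two exponentially
(`testStat_lower_tail`, `testStat_upper_tail`). Only variances that are too small are tested for, so
no upper or lower truncation of `c` is needed.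

One test per set `J` suffices. The possible `J` are sublevel patterns of polynomials of degree less
than `k`, and by the Sauer–Shelah lemma there are at most `(n+1)^k` of them
(`exists_sublevel_patterns`). With `k` of order `n / log n` this number is `exp(κn)` for a small
`κ`, while the prior tail `exp(-b k log k)` is still exponentially small in `n`. Both facts enter
`exists_tests`. -/

lemma posDef_of_quad {A : Matrix ι ι ℝ} (hA : Aᵀ = A)
    (h : ∀ x : ι → ℝ, x ≠ 0 → 0 < x ⬝ᵥ (A *ᵥ x)) : A.PosDef :=
  Matrix.PosDef.of_dotProduct_mulVec_pos (by simpa [Matrix.IsHermitian] using hA)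
    fun {x} hx => by simpa using h x hx

lemma quad_nonneg {A : Matrix ι ι ℝ} (hA : A.PosSemidef) (x : ι → ℝ) :
    0 ≤ x ⬝ᵥ (A *ᵥ x) := by
  simpa using hA.dotProduct_mulVec_nonneg x

lemma quad_pos {A : Matrix ι ι ℝ} (hA : A.PosDef) {x : ι → ℝ} (hx : x ≠ 0) :
    0 < x ⬝ᵥ (A *ᵥ x) := by
  simpa using hA.dotProduct_mulVec_pos hx

lemma transpose_eq_of_posDef {A : Matrix ι ι ℝ} (hA : A.PosDef) : Aᵀ = A := by
  simpa [Matrix.IsHermitian] using hA.isHermitian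

lemma mul_inv_of_posDef {A : Matrix ι ι ℝ} (hA : A.PosDef) : A * A⁻¹ = 1 :=
  Matrix.mul_nonsing_inv _ hA.det_pos.ne'.isUnit

lemma inv_mul_of_posDef {A : Matrix ι ι ℝ} (hA : A.PosDef) : A⁻¹ * A = 1 :=
  Matrix.nonsing_inv_mul _ hA.det_pos.ne'.isUnit

/-- A positive definite matrix factors as `Bᵀ B` with `B` invertible. -/
lemma exists_factor {A : Matrix ι ι ℝ} (hA : A.PosDef) :
    ∃ B : Matrix ι ι ℝ, A = Bᵀ * B ∧ B.det ≠ 0 := by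
  obtain ⟨B, hB⟩ := CStarAlgebra.nonneg_iff_eq_star_mul_self.mp hA.posSemidef.nonneg
  have hB' : A = Bᵀ * B := by simpa [Matrix.star_eq_conjTranspose] using hB
  refine ⟨B, hB', fun h => hA.det_pos.ne' ?_⟩
  rw [hB', Matrix.det_mul, h, mul_zero]

/-- Every eigenvalue satisfies `x ≤ exp (x - 1)`; multiply over the spectrum. -/
lemma det_le_exp_trace {A : Matrix ι ι ℝ} (hA : A.PosDef) :
    A.det ≤ Real.exp (A.trace - Fintype.card ι) := by
  rw [hA.isHermitian.det_eq_prod_eigenvalues, hA.isHermitian.trace_eq_sum_eigenvalues]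
  have : (∑ i, ((hA.isHermitian.eigenvalues i : ℝ) : ℝ)) - (Fintype.card ι : ℝ)
      = ∑ i, (hA.isHermitian.eigenvalues i - 1) := by
    simp [Finset.sum_sub_distrib]
  simp only [RCLike.ofReal_real_eq_id, id_eq]
  rw [this, Real.exp_sum]
  refine Finset.prod_le_prod (fun i _ => (hA.eigenvalues_pos i).le) fun i _ => ?_
  have := Real.add_one_le_exp (hA.isHermitian.eigenvalues i - 1)
  linarith

/-- Cauchy–Schwarz for a positive definite matrix and its inverse. -/
lemma dotProduct_sq_le {A : Matrix ι ι ℝ} (hA : A.PosDef) (x y : ι → ℝ) :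
    (x ⬝ᵥ y) ^ 2 ≤ (x ⬝ᵥ (A *ᵥ x)) * (y ⬝ᵥ (A⁻¹ *ᵥ y)) := by
  obtain ⟨B, rfl, hB⟩ := exists_factor hA
  have hu : IsUnit B.det := hB.isUnit
  have hut : IsUnit (Bᵀ).det := by rwa [Matrix.det_transpose]
  have h1 : x ⬝ᵥ ((Bᵀ * B) *ᵥ x) = (B *ᵥ x) ⬝ᵥ (B *ᵥ x) := by
    rw [← Matrix.mulVec_mulVec, Matrix.dotProduct_mulVec, Matrix.vecMul_transpose]
  have h2 : y ⬝ᵥ ((Bᵀ * B)⁻¹ *ᵥ y) = (Bᵀ⁻¹ *ᵥ y) ⬝ᵥ (Bᵀ⁻¹ *ᵥ y) := by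
    rw [Matrix.mul_inv_rev, ← Matrix.mulVec_mulVec, Matrix.dotProduct_mulVec,
      ← Matrix.mulVec_transpose, Matrix.transpose_nonsing_inv]
  have h3 : x ⬝ᵥ y = (B *ᵥ x) ⬝ᵥ (Bᵀ⁻¹ *ᵥ y) := by
    rw [Matrix.dotProduct_mulVec, ← Matrix.mulVec_transpose, Matrix.mulVec_mulVec,
      Matrix.transpose_nonsing_inv, Matrix.transpose_transpose, Matrix.nonsing_inv_mul _ hu,
      Matrix.one_mulVec]
  rw [h1, h2, h3]
  simp only [dotProduct, ← sq]
  exact Finset.sum_mul_sq_le_sq_mul_sq _ _ _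

/-- Inversion reverses the order of quadratic forms. -/
lemma inv_quad_anti {A B : Matrix ι ι ℝ} (hA : A.PosDef) (hB : B.PosDef)
    (h : ∀ x : ι → ℝ, x ⬝ᵥ (A *ᵥ x) ≤ x ⬝ᵥ (B *ᵥ x)) (x : ι → ℝ) :
    x ⬝ᵥ (B⁻¹ *ᵥ x) ≤ x ⬝ᵥ (A⁻¹ *ᵥ x) := by
  -- With `q = x · B⁻¹x`, Cauchy–Schwarz at the vector `B⁻¹x` gives `q² ≤ q (x · A⁻¹x)`, from which
  -- a factor `q` cancels.
  have h1 := dotProduct_sq_le hA (B⁻¹ *ᵥ x) x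
  have h2 := h (B⁻¹ *ᵥ x)
  have h3 : (B⁻¹ *ᵥ x) ⬝ᵥ (B *ᵥ (B⁻¹ *ᵥ x)) = x ⬝ᵥ (B⁻¹ *ᵥ x) := by
    rw [Matrix.mulVec_mulVec, mul_inv_of_posDef hB, Matrix.one_mulVec, dotProduct_comm]
  rw [h3] at h2
  rw [dotProduct_comm (B⁻¹ *ᵥ x) x] at h1
  have h4 := quad_nonneg hA.inv.posSemidef x
  have h5 := quad_nonneg hB.inv.posSemidef x
  have h6 := mul_le_mul_of_nonneg_right h2 h4
  rcases h5.eq_or_lt with h | h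
  · rw [← h]; exact h4
  · nlinarith

/-- If `A ≤ B` as quadratic forms and `V` is positive semidefinite then
`tr (B⁻¹ V) ≤ tr (A⁻¹ V)`. -/
lemma trace_inv_mul_anti {A B V : Matrix ι ι ℝ} (hA : A.PosDef) (hB : B.PosDef)
    (hV : V.PosSemidef) (h : ∀ x : ι → ℝ, x ⬝ᵥ (A *ᵥ x) ≤ x ⬝ᵥ (B *ᵥ x)) :
    (B⁻¹ * V).trace ≤ (A⁻¹ * V).trace := by
  -- Writing `V = Wᵀ W` turns the trace into a sum of quadratic forms at the rows of `W`.
  obtain ⟨W, hW⟩ := CStarAlgebra.nonneg_iff_eq_star_mul_self.mp hV.nonneg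
  have hW' : V = Wᵀ * W := by simpa [Matrix.star_eq_conjTranspose] using hW
  have key : ∀ M : Matrix ι ι ℝ, (M * V).trace = ∑ i, (W i) ⬝ᵥ (M *ᵥ (W i)) := by
    intro M
    rw [hW', ← Matrix.mul_assoc, Matrix.trace_mul_comm, Matrix.trace]
    refine Finset.sum_congr rfl fun i _ => ?_
    rw [Matrix.diag_apply, Matrix.mul_apply]
    simp only [dotProduct, Matrix.mulVec, Matrix.mul_apply, Matrix.transpose_apply]
  rw [key, key]
  exact Finset.sum_le_sum fun i _ => inv_quad_anti hA hB h _

/-- Apply `det_le_exp_trace` after the congruence that carries `A` to the identity. In probabilistic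
terms this is the nonnegativity of the Kullback–Leibler divergence between centred Gaussian laws. -/
lemma det_le_det_mul_exp {A B : Matrix ι ι ℝ} (hA : A.PosDef) (hB : B.PosDef) :
    B.det ≤ A.det * Real.exp ((A⁻¹ * B).trace - Fintype.card ι) := by
  obtain ⟨W, hW, hd⟩ := exists_factor hA
  have hu : IsUnit W.det := hd.isUnit
  have hX : ((W⁻¹)ᵀ * B * W⁻¹).PosDef := by
    have := hB.conjTranspose_mul_mul_same (B := W⁻¹) (by
      refine Function.LeftInverse.injective (g := fun v => W *ᵥ v) fun v => ?_
      simp [Matrix.mulVec_mulVec, Matrix.mul_nonsing_inv _ hu])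
    simpa using this
  have h1 := det_le_exp_trace hX
  have h2 : ((W⁻¹)ᵀ * B * W⁻¹).trace = (A⁻¹ * B).trace := by
    rw [Matrix.trace_mul_comm, ← Matrix.mul_assoc, hW, Matrix.mul_inv_rev,
      Matrix.transpose_nonsing_inv]
  have h3 : ((W⁻¹)ᵀ * B * W⁻¹).det * A.det = B.det := by
    rw [hW]
    simp only [Matrix.det_mul, Matrix.det_transpose, Matrix.det_nonsing_inv,
      Ring.inverse_eq_inv']
    field_simp
  rw [h2] at h1
  rw [← h3, mul_comm]
  exact mul_le_mul_of_nonneg_left h1 hA.det_pos.le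

/-- `|tr (A E)| ≤ b K √n` when `‖A x‖ ≤ b ‖x‖` and the entries of `E` are at most `K / n`. -/
lemma abs_trace_mul_le {A E : Matrix ι ι ℝ} {b K : ℝ} (hb : 0 ≤ b) (hK : 0 ≤ K)
    (hA : ∀ x : ι → ℝ, (A *ᵥ x) ⬝ᵥ (A *ᵥ x) ≤ b ^ 2 * (x ⬝ᵥ x))
    (hE : ∀ i j, |E i j| ≤ K / Fintype.card ι) :
    |(A * E).trace| ≤ b * K * Real.sqrt (Fintype.card ι) := by
  -- Cauchy–Schwarz for the Frobenius inner product: `‖A‖² ≤ b² n`, column by column, while `‖E‖² ≤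
  -- K²`.
  have hA2 : ∑ i, ∑ j, A i j ^ 2 ≤ b ^ 2 * Fintype.card ι := by
    rw [Finset.sum_comm]
    have : ∀ j, ∑ i, A i j ^ 2 ≤ b ^ 2 := by
      intro j
      have := hA (Pi.single j 1)
      simpa [dotProduct, sq, Pi.single_apply] using this
    calc _ ≤ ∑ _j : ι, b ^ 2 := Finset.sum_le_sum fun j _ => this j
      _ = _ := by simp [mul_comm]
  have hE2 : ∑ i, ∑ j, E j i ^ 2 ≤ K ^ 2 := by
    have : ∀ i j, E j i ^ 2 ≤ (K / Fintype.card ι) ^ 2 := fun i j =>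
      sq_le_sq' (by have := hE j i; exact neg_le_of_abs_le this) (le_of_abs_le (hE j i))
    calc _ ≤ ∑ _i : ι, ∑ _j : ι, (K / Fintype.card ι) ^ 2 :=
        Finset.sum_le_sum fun i _ => Finset.sum_le_sum fun j _ => this i j
      _ = (Fintype.card ι * (K / Fintype.card ι)) ^ 2 := by simp; ring
      _ ≤ _ := by
        rcases eq_or_ne (Fintype.card ι : ℝ) 0 with h | h
        · rw [h]; simp; positivity
        · rw [mul_div_cancel₀ _ h]
  have hcs : (A * E).trace ^ 2 ≤ (∑ i, ∑ j, A i j ^ 2) * ∑ i, ∑ j, E j i ^ 2 := by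
    simp only [Matrix.trace, Matrix.diag_apply, Matrix.mul_apply, ← Finset.sum_product']
    exact Finset.sum_mul_sq_le_sq_mul_sq _ (fun p : ι × ι => A p.1 p.2) fun p => E p.2 p.1
  apply abs_le_of_sq_le_sq _ (by positivity)
  calc _ ≤ _ := hcs
    _ ≤ (b ^ 2 * Fintype.card ι) * K ^ 2 := by gcongr
    _ = _ := by
      rw [mul_pow, mul_pow, Real.sq_sqrt (by positivity)]; ring

end LinearAlgebra

/-! ### Centred Gaussian densities -/

section GaussianDensity

variable {n : ℕ}

lemma pi_gaussianReal_eq_withDensity (n : ℕ) :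
    Measure.pi (fun _ : Fin n => gaussianReal 0 1) =
      volume.withDensity fun w : Fin n → ℝ =>
        ENNReal.ofReal (∏ i, gaussianPDFReal 0 1 (w i)) := by
  refine (Measure.pi_eq fun s hs => ?_)
  have hint : Integrable (fun w : Fin n → ℝ => ∏ i, gaussianPDFReal 0 1 (w i))
      (Measure.pi fun i => volume.restrict (s i)) :=
    Integrable.fintype_prod fun i => (integrable_gaussianPDFReal 0 1).restrict
  rw [withDensity_apply _ (MeasurableSet.univ_pi hs), volume_pi, Measure.restrict_pi_pi,
    ← ofReal_integral_eq_lintegral_ofReal hint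
      (ae_of_all _ fun w => Finset.prod_nonneg fun i _ => gaussianPDFReal_nonneg 0 1 _),
    integral_fintype_prod_eq_prod (f := fun _ x => gaussianPDFReal 0 1 x),
    ENNReal.ofReal_prod_of_nonneg]
  · refine Finset.prod_congr rfl fun i _ => ?_
    rw [gaussianReal_apply_eq_integral 0 one_ne_zero]
  · exact fun i _ => integral_nonneg fun x => gaussianPDFReal_nonneg 0 1 _

lemma gaussianDensity_one (w : Fin n → ℝ) :
    gaussianDensity 1 w = ∏ i, gaussianPDFReal 0 1 (w i) := by
  simp only [gaussianDensity, gaussianPDFReal, Finset.prod_mul_distrib, ← Real.exp_sum]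
  congr 1
  · simp only [Matrix.det_one, mul_one, NNReal.coe_one, Finset.prod_const, Finset.card_univ,
      Fintype.card_fin]
    rw [inv_pow, inv_inj]
    refine (Real.sqrt_eq_iff_eq_sq (by positivity) (by positivity)).mpr ?_
    rw [← pow_mul, mul_comm n 2, pow_mul, Real.sq_sqrt (by positivity)]
  · congr 1
    simp only [inv_one, Matrix.one_mulVec, dotProduct, Finset.mul_sum]
    refine Finset.sum_congr rfl fun i _ => ?_
    simp; ring

lemma gaussianDensity_pos {S : Matrix (Fin n) (Fin n) ℝ} (hS : S.PosDef) (z : Fin n → ℝ) :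
    0 < gaussianDensity S z := by
  have := hS.det_pos
  unfold gaussianDensity
  positivity

lemma continuous_quad (A : Matrix (Fin n) (Fin n) ℝ) :
    Continuous fun z : Fin n → ℝ => z ⬝ᵥ (A *ᵥ z) := by
  simp only [dotProduct, Matrix.mulVec]
  fun_prop

lemma measurable_gaussianDensity (S : Matrix (Fin n) (Fin n) ℝ) :
    Measurable (gaussianDensity S) := by
  unfold gaussianDensity
  have := (continuous_quad S⁻¹).measurable
  fun_prop

lemma measurable_mulVec {m : ℕ} (A : Matrix (Fin m) (Fin n) ℝ) :
    Measurable fun z : Fin n → ℝ => A *ᵥ z :=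
  (Continuous.matrix_mulVec continuous_const continuous_id).measurable

lemma lintegral_comp_mulVec {A : Matrix (Fin n) (Fin n) ℝ} (hA : A.det ≠ 0)
    {g : (Fin n → ℝ) → ℝ≥0∞} (hg : Measurable g) :
    ∫⁻ w, g (A *ᵥ w) = ENNReal.ofReal |A.det|⁻¹ * ∫⁻ z, g z := by
  have h := Real.map_matrix_volume_pi_eq_smul_volume_pi hA
  have h2 : ∫⁻ w, g (A *ᵥ w) = ∫⁻ z, g z ∂(Measure.map (Matrix.toLin' A) volume) := by
    rw [lintegral_map hg (by exact measurable_mulVec A)]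
    rfl
  rw [h2, h, lintegral_smul_measure, abs_inv, smul_eq_mul]

lemma gaussianDensity_comp_mulVec {S A : Matrix (Fin n) (Fin n) ℝ} (hA : A.det ≠ 0)
    (hS : S = A * Aᵀ) (w : Fin n → ℝ) :
    gaussianDensity 1 w = |A.det| * gaussianDensity S (A *ᵥ w) := by
  have hu : IsUnit A.det := hA.isUnit
  have hut : IsUnit (Aᵀ).det := by rwa [Matrix.det_transpose]
  have h1 : (A *ᵥ w) ⬝ᵥ (S⁻¹ *ᵥ (A *ᵥ w)) = w ⬝ᵥ w := by
    rw [hS, Matrix.mul_inv_rev, Matrix.mulVec_mulVec, Matrix.mul_assoc,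
      Matrix.nonsing_inv_mul _ hu, Matrix.mul_one, Matrix.dotProduct_mulVec,
      ← Matrix.mulVec_transpose, Matrix.transpose_nonsing_inv, Matrix.transpose_transpose,
      Matrix.mulVec_mulVec, Matrix.nonsing_inv_mul _ hu, Matrix.one_mulVec]
  have h2 : S.det = |A.det| ^ 2 := by rw [hS, Matrix.det_mul, Matrix.det_transpose, sq_abs, sq]
  have h3 : 0 < |A.det| := abs_pos.mpr hA
  unfold gaussianDensity
  rw [h1, h2, Real.sqrt_mul (by positivity) (|A.det| ^ 2), Real.sqrt_sq h3.le]
  simp only [Matrix.det_one, mul_one, inv_one, Matrix.one_mulVec]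
  field_simp

lemma exists_factor_mul_transpose {S : Matrix (Fin n) (Fin n) ℝ} (hS : S.PosDef) :
    ∃ A : Matrix (Fin n) (Fin n) ℝ, S = A * Aᵀ ∧ A.det ≠ 0 := by
  obtain ⟨B, hB, hd⟩ := exists_factor hS
  exact ⟨Bᵀ, by simpa using hB, by simpa using hd⟩

/-- Centred Gaussian integrals as integrals against white noise. -/
lemma lintegral_gaussianDensity_mul {S A : Matrix (Fin n) (Fin n) ℝ} (hA : A.det ≠ 0)
    (hS : S = A * Aᵀ) {g : (Fin n → ℝ) → ℝ≥0∞} (hg : Measurable g) :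
    ∫⁻ z, ENNReal.ofReal (gaussianDensity S z) * g z =
      ∫⁻ w, g (A *ᵥ w) ∂(Measure.pi fun _ : Fin n => gaussianReal 0 1) := by
  have h3 : 0 < |A.det| := abs_pos.mpr hA
  have hm : Measurable fun w : Fin n → ℝ => ENNReal.ofReal (∏ i, gaussianPDFReal 0 1 (w i)) := by
    have := measurable_gaussianPDFReal 0 1
    fun_prop
  rw [pi_gaussianReal_eq_withDensity, lintegral_withDensity_eq_lintegral_mul _ hm
    (by exact hg.comp (measurable_mulVec A))]
  have : ∀ w : Fin n → ℝ, (fun w : Fin n → ℝ =>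
      ENNReal.ofReal (∏ i, gaussianPDFReal 0 1 (w i))) w * g (A *ᵥ w) =
      ENNReal.ofReal |A.det| *
        (fun z => ENNReal.ofReal (gaussianDensity S z) * g z) (A *ᵥ w) := by
    intro w
    simp only
    rw [← gaussianDensity_one, gaussianDensity_comp_mulVec hA hS,
      ENNReal.ofReal_mul h3.le, mul_assoc]
  simp only [Pi.mul_apply]
  have hm2 : Measurable fun z => ENNReal.ofReal (gaussianDensity S z) * g z :=
    (measurable_gaussianDensity S).ennreal_ofReal.mul hg
  rw [lintegral_congr this, lintegral_const_mul _ (by exact hm2.comp (measurable_mulVec A)),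
    lintegral_comp_mulVec hA hm2, ← mul_assoc, ← ENNReal.ofReal_mul h3.le,
    mul_inv_cancel₀ h3.ne', ENNReal.ofReal_one, one_mul]

lemma lintegral_gaussianDensity {S : Matrix (Fin n) (Fin n) ℝ} (hS : S.PosDef) :
    ∫⁻ z, ENNReal.ofReal (gaussianDensity S z) = 1 := by
  obtain ⟨A, hA, hd⟩ := exists_factor_mul_transpose hS
  have := lintegral_gaussianDensity_mul hd hA (g := fun _ => 1) measurable_const
  simpa using this

/-- Exponential tilting of a Gaussian density by a quadratic form. -/
lemma lintegral_gaussianDensity_mul_exp_le {S X : Matrix (Fin n) (Fin n) ℝ} (hS : S.PosDef)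
    (hM : (S⁻¹ + X).PosDef) :
    ∫⁻ z, ENNReal.ofReal (gaussianDensity S z * Real.exp (-(1 / 2) * (z ⬝ᵥ (X *ᵥ z)))) ≤
      ENNReal.ofReal (Real.exp (-(1 / 2) * ((S⁻¹ + X)⁻¹ * X).trace)) := by
  set M := S⁻¹ + X with hMdef
  have hdS := hS.det_pos
  have hdM := hM.det_pos
  set r := Real.sqrt ((2 * Real.pi) ^ n * (M⁻¹).det) / Real.sqrt ((2 * Real.pi) ^ n * S.det)
    with hr
  have hdMi : 0 < (M⁻¹).det := hM.inv.det_pos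
  -- The tilted density is `r` times the density of the centred Gaussian law with precision `M`.
  have h1 : ∀ z, gaussianDensity S z * Real.exp (-(1 / 2) * (z ⬝ᵥ (X *ᵥ z))) =
      r * gaussianDensity M⁻¹ z := by
    intro z
    unfold gaussianDensity
    rw [Matrix.nonsing_inv_nonsing_inv _ hdM.ne'.isUnit, mul_assoc, ← Real.exp_add, ← mul_add,
      hMdef, Matrix.add_mulVec, dotProduct_add, hr]
    have : 0 < Real.sqrt ((2 * Real.pi) ^ n * (M⁻¹).det) := by positivity
    rw [← hMdef]
    field_simp
  have hr0 : 0 ≤ r := by positivity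
  have h2 : r ≤ Real.exp (-(1 / 2) * (M⁻¹ * X).trace) := by
    -- Since `S⁻¹ = M - X`, the determinant ratio `r² = det S⁻¹ / det M` is bounded by `exp (-tr
    -- (M⁻¹ X))`.
    have h3 := det_le_det_mul_exp hM hS.inv
    have h4 : (M⁻¹ * S⁻¹).trace - Fintype.card (Fin n) = - (M⁻¹ * X).trace := by
      have : S⁻¹ = M - X := by rw [hMdef]; abel
      rw [this, Matrix.mul_sub, inv_mul_of_posDef hM, Matrix.trace_sub, Matrix.trace_one]
      ring
    rw [h4] at h3
    have h5 : r ^ 2 = (S⁻¹).det / M.det := by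
      rw [hr, div_pow, Real.sq_sqrt (by positivity), Real.sq_sqrt (by positivity),
        Matrix.det_nonsing_inv, Matrix.det_nonsing_inv, Ring.inverse_eq_inv']
      field_simp
    refine le_of_sq_le_sq ?_ (by positivity)
    rw [h5, div_le_iff₀ hdM, ← Real.exp_nat_mul, mul_comm]
    refine h3.trans (le_of_eq ?_)
    congr 2
    push_cast
    ring
  simp_rw [h1, ENNReal.ofReal_mul hr0]
  rw [lintegral_const_mul _ (measurable_gaussianDensity _).ennreal_ofReal,
    lintegral_gaussianDensity hM.inv, mul_one]
  exact ENNReal.ofReal_le_ofReal h2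

lemma inv_smul_of_posDef {S : Matrix (Fin n) (Fin n) ℝ} (hS : S.PosDef) {a : ℝ} (ha : a ≠ 0) :
    (a • S⁻¹)⁻¹ = a⁻¹ • S := by
  refine Matrix.inv_eq_left_inv ?_
  rw [Matrix.smul_mul, Matrix.mul_smul, smul_smul, mul_inv_of_posDef hS, inv_mul_cancel₀ ha,
    one_smul]

/-- The tilted precision `S⁻¹ + 2tB` is at most `(1 + θ) S⁻¹`, so its inverse is at least `S / (1 +
θ)`. This replaces the tilted inverse by the explicit trace of `S B`, which is the mean of the
quadratic form. -/
lemma lintegral_gaussianDensity_mul_exp_neg_le {S B : Matrix (Fin n) (Fin n) ℝ} (hS : S.PosDef)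
    (hB : B.PosSemidef) {t θ : ℝ} (ht : 0 ≤ t) (hθ : 0 ≤ θ)
    (h : ∀ z : Fin n → ℝ, 2 * t * (z ⬝ᵥ (B *ᵥ z)) ≤ θ * (z ⬝ᵥ (S⁻¹ *ᵥ z))) :
    ∫⁻ z, ENNReal.ofReal (gaussianDensity S z * Real.exp (-t * (z ⬝ᵥ (B *ᵥ z)))) ≤
      ENNReal.ofReal (Real.exp (-t * ((S * B).trace / (1 + θ)))) := by
  have hM : (S⁻¹ + (2 * t) • B).PosDef := hS.inv.add_posSemidef (hB.smul (by positivity))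
  have h1 := lintegral_gaussianDensity_mul_exp_le hS hM
  have hθ' : (0 : ℝ) < 1 + θ := by positivity
  have h2 := trace_inv_mul_anti hM (hS.inv.smul hθ') hB fun x => by
    rw [Matrix.add_mulVec, dotProduct_add, Matrix.smul_mulVec, Matrix.smul_mulVec,
      dotProduct_smul, dotProduct_smul, smul_eq_mul, smul_eq_mul]
    linarith [h x]
  rw [inv_smul_of_posDef hS hθ'.ne', Matrix.smul_mul, Matrix.trace_smul, smul_eq_mul] at h2
  refine le_trans (le_of_eq ?_) (h1.trans (ENNReal.ofReal_le_ofReal (Real.exp_le_exp.mpr ?_)))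
  · refine lintegral_congr fun z => ?_
    rw [Matrix.smul_mulVec, dotProduct_smul, smul_eq_mul]
    congr 3; ring
  · rw [Matrix.mul_smul, Matrix.trace_smul, smul_eq_mul, div_eq_inv_mul (S * B).trace]
    linarith [mul_le_mul_of_nonneg_left h2 ht]

/-- The same comparison with the opposite sign; here `θ < 1` keeps the tilted precision above `(1 -
θ) S⁻¹`, hence positive definite. -/
lemma lintegral_gaussianDensity_mul_exp_pos_le {S B : Matrix (Fin n) (Fin n) ℝ} (hS : S.PosDef)
    (hB : B.PosSemidef) {t θ : ℝ} (ht : 0 ≤ t) (hθ : θ < 1)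
    (h : ∀ z : Fin n → ℝ, 2 * t * (z ⬝ᵥ (B *ᵥ z)) ≤ θ * (z ⬝ᵥ (S⁻¹ *ᵥ z))) :
    ∫⁻ z, ENNReal.ofReal (gaussianDensity S z * Real.exp (t * (z ⬝ᵥ (B *ᵥ z)))) ≤
      ENNReal.ofReal (Real.exp (t * ((S * B).trace / (1 - θ)))) := by
  have hθ' : (0 : ℝ) < 1 - θ := by linarith
  have hle : ∀ x : Fin n → ℝ, x ⬝ᵥ (((1 - θ) • S⁻¹) *ᵥ x) ≤
      x ⬝ᵥ ((S⁻¹ + (-(2 * t)) • B) *ᵥ x) := fun x => by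
    rw [Matrix.add_mulVec, dotProduct_add, Matrix.smul_mulVec, Matrix.smul_mulVec,
      dotProduct_smul, dotProduct_smul, smul_eq_mul, smul_eq_mul]
    linarith [h x]
  have hM : (S⁻¹ + (-(2 * t)) • B).PosDef := by
    refine posDef_of_quad ?_ fun x hx =>
      (quad_pos (hS.inv.smul hθ') hx).trans_le (hle x)
    have hBt : Bᵀ = B := by simpa [Matrix.IsHermitian] using hB.isHermitian
    rw [Matrix.transpose_add, Matrix.transpose_smul, hBt, transpose_eq_of_posDef hS.inv]
  have h1 := lintegral_gaussianDensity_mul_exp_le hS hM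
  have h2 := trace_inv_mul_anti (hS.inv.smul hθ') hM hB hle
  rw [inv_smul_of_posDef hS hθ'.ne', Matrix.smul_mul, Matrix.trace_smul, smul_eq_mul] at h2
  refine le_trans (le_of_eq ?_) (h1.trans (ENNReal.ofReal_le_ofReal (Real.exp_le_exp.mpr ?_)))
  · refine lintegral_congr fun z => ?_
    rw [Matrix.smul_mulVec, dotProduct_smul, smul_eq_mul]
    congr 3; ring
  · rw [Matrix.mul_smul, Matrix.trace_smul, smul_eq_mul, div_eq_inv_mul (S * B).trace]
    linarith [mul_le_mul_of_nonneg_left h2 ht]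

/-- A centred Gaussian vector with positive definite covariance `S` has density
`gaussianDensity S`. -/
lemma map_eq_withDensity_gaussianDensity {Ω : Type*} [MeasurableSpace Ω] {P : Measure Ω}
    [IsProbabilityMeasure P] {X : Fin n → Ω → ℝ} (hX : HasGaussianLaw (fun ω i => X i ω) P)
    (hmean : ∀ i, P[X i] = 0) {S : Matrix (Fin n) (Fin n) ℝ} (hS : S.PosDef)
    (hcov : ∀ i j, cov[X i, X j; P] = S i j) :
    P.map (fun ω i => X i ω) =
      volume.withDensity fun z => ENNReal.ofReal (gaussianDensity S z) := by
  obtain ⟨A, hA, hd⟩ := exists_factor_mul_transpose hS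
  have hu : IsUnit A.det := hd.isUnit
  have hut : IsUnit (Aᵀ).det := by rwa [Matrix.det_transpose]
  -- Whitening: the coordinates of `A⁻¹ X` are jointly Gaussian and uncorrelated with unit variance,
  -- hence independent standard normal.
  set W : Fin n → Ω → ℝ := fun i ω => (A⁻¹ *ᵥ fun j => X j ω) i with hW
  have hL2 : ∀ i, MemLp (X i) 2 P := fun i => (hX.eval i).memLp_two
  have hWl : HasGaussianLaw (fun ω i => W i ω) P :=
    hX.map_fun (LinearMap.toContinuousLinearMap (Matrix.toLin' A⁻¹))
  have hWcov : ∀ i j, cov[W i, W j; P] = (1 : Matrix (Fin n) (Fin n) ℝ) i j := by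
    intro i j
    have e : ∀ i, W i = fun ω => ∑ k, A⁻¹ i k * X k ω := fun i => rfl
    rw [e i, e j, covariance_fun_sum_fun_sum (fun k => (hL2 k).const_mul _)
      (fun k => (hL2 k).const_mul _)]
    simp_rw [covariance_const_mul_left, covariance_const_mul_right, hcov]
    have : (A⁻¹ * S * (A⁻¹)ᵀ) = 1 := by
      rw [hA, Matrix.transpose_nonsing_inv, ← Matrix.mul_assoc, Matrix.nonsing_inv_mul _ hu,
        Matrix.one_mul, Matrix.mul_nonsing_inv _ hut]
    rw [← this]
    simp only [Matrix.mul_apply, Matrix.transpose_apply, Finset.sum_mul]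
    rw [Finset.sum_comm]
    refine Finset.sum_congr rfl fun k _ => Finset.sum_congr rfl fun l _ => by ring
  have hind : iIndepFun W P := hWl.iIndepFun_of_covariance_eq_zero fun i j hij => by
    rw [hWcov, Matrix.one_apply_ne hij]
  have hWm : ∀ i, AEMeasurable (W i) P := fun i => (hWl.eval i).aemeasurable
  have hWlaw : ∀ i, P.map (W i) = gaussianReal 0 1 := by
    intro i
    rw [(hWl.eval i).map_eq_gaussianReal, ← covariance_self (hWm i), hWcov, Matrix.one_apply_eq,
      Real.toNNReal_one]
    congr 1
    have e : W i = fun ω => ∑ k, A⁻¹ i k * X k ω := rfl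
    rw [e, integral_finsetSum _ fun k _ => ((hL2 k).integrable one_le_two).const_mul _]
    simp_rw [integral_const_mul, hmean]
    simp
  have hWpi := (iIndepFun_iff_map_fun_eq_pi_map hWm).mp hind
  simp_rw [hWlaw] at hWpi
  have hXW : (fun ω i => X i ω) = (fun w => A *ᵥ w) ∘ fun ω i => W i ω := by
    funext ω
    simp only [hW, Function.comp]
    rw [show (fun i => (A⁻¹ *ᵥ fun j => X j ω) i) = A⁻¹ *ᵥ fun j => X j ω from rfl,
      Matrix.mulVec_mulVec, Matrix.mul_nonsing_inv _ hu, Matrix.one_mulVec]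
  rw [hXW, ← AEMeasurable.map_map_of_aemeasurable (measurable_mulVec A).aemeasurable
    hWl.aemeasurable, hWpi]
  ext s hs
  rw [withDensity_apply _ hs, Measure.map_apply (measurable_mulVec A) hs,
    ← lintegral_indicator_one ((measurable_mulVec A) hs), ← lintegral_indicator hs]
  have := lintegral_gaussianDensity_mul hd hA (g := s.indicator 1) (measurable_one.indicator hs)
  rw [show (∫⁻ a, ((fun w => A *ᵥ w) ⁻¹' s).indicator 1 a ∂Measure.pi fun _ => gaussianReal 0 1)
    = ∫⁻ w, s.indicator 1 (A *ᵥ w) ∂(Measure.pi fun _ : Fin n => gaussianReal 0 1) from rfl,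
    ← this]
  refine lintegral_congr fun z => ?_
  by_cases hz : z ∈ s <;> simp [hz]

end GaussianDensity

/-! ### The discrete Fourier transform -/

section Fourier

/-- Either all phases agree modulo `2π`, or the sum is the real part of a geometric sum of an `n`-th
root of unity other than `1`. The free phase `ψ` covers sines as well. -/
lemma sum_cos_fourier {n : ℕ} (hn : n ≠ 0) (m : ℤ) (ψ : ℝ) :
    ∑ t ∈ Finset.range n, Real.cos (2 * Real.pi * m / n * ((t : ℝ) + 1) + ψ) =
      if (n : ℤ) ∣ m then n * Real.cos ψ else 0 := by
  have hn' : (n : ℂ) ≠ 0 := by exact_mod_cast hn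
  have hnr : (n : ℝ) ≠ 0 := by exact_mod_cast hn
  split_ifs with h
  · obtain ⟨q, rfl⟩ := h
    have : ∀ t ∈ Finset.range n,
        Real.cos (2 * Real.pi * ((n * q : ℤ) : ℝ) / n * ((t : ℝ) + 1) + ψ) = Real.cos ψ := by
      intro t _
      rw [← Real.cos_add_int_mul_two_pi ψ (q * (t + 1))]
      congr 1
      push_cast
      field_simp
      ring
    rw [Finset.sum_congr rfl this]
    simp
  · set ζ : ℂ := Complex.exp (2 * Real.pi * Complex.I * (m / n)) with hζ
    have hζn : ζ ^ n = 1 := by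
      rw [hζ, ← Complex.exp_nat_mul, Complex.exp_eq_one_iff]
      exact ⟨m, by field_simp⟩
    have hζ1 : ζ ≠ 1 := by
      intro h1
      rw [hζ, Complex.exp_eq_one_iff] at h1
      obtain ⟨q, hq⟩ := h1
      apply h
      refine ⟨q, ?_⟩
      have h2 : (2 * Real.pi * Complex.I : ℂ) ≠ 0 := Complex.two_pi_I_ne_zero
      have h3 : (m : ℂ) / n = q := by
        apply mul_left_cancel₀ h2
        rw [hq]; ring
      rw [div_eq_iff hn'] at h3
      have : m = q * n := by exact_mod_cast h3
      rw [this, mul_comm]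
    have hsum : ∑ t ∈ Finset.range n, ζ ^ t = 0 := by
      have := mul_geom_sum ζ n
      rw [hζn, sub_self] at this
      exact (mul_eq_zero.mp this).resolve_left (sub_ne_zero.mpr hζ1)
    have hre : ∀ t : ℕ, Real.cos (2 * Real.pi * m / n * ((t : ℝ) + 1) + ψ) =
        (Complex.exp (ψ * Complex.I) * ζ * ζ ^ t).re := by
      intro t
      rw [hζ, ← Complex.exp_nat_mul, ← Complex.exp_add, ← Complex.exp_add,
        ← Complex.exp_ofReal_mul_I_re]
      congr 2
      push_cast
      ring
    simp_rw [hre]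
    rw [← Complex.re_sum, ← Finset.mul_sum, hsum, mul_zero, Complex.zero_re]

/-- Amplitude of row `i` of the Fourier matrix. -/
noncomputable def rowAmp (n : ℕ) (i : Fin n) : ℝ :=
  (Real.sqrt n)⁻¹ * if (i : ℕ) = 0 ∨ (Even n ∧ (i : ℕ) + 1 = n) then 1 else Real.sqrt 2

/-- Phase of row `i` of the Fourier matrix. -/
noncomputable def rowPhase (n : ℕ) (i : Fin n) : ℝ :=
  if (i : ℕ) = 0 ∨ Odd (i : ℕ) then 0 else Real.pi / 2

/-- The periodic extension of row `i` of the Fourier matrix. -/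
noncomputable def rowFun (n : ℕ) (i : Fin n) (t : ℤ) : ℝ :=
  rowAmp n i * Real.cos (rowFreq n i * ((t : ℝ) + 1) + rowPhase n i)

lemma fourierVec_re (n j t : ℕ) :
    (fourierVec n j t).re = (Real.sqrt n)⁻¹ * Real.cos (2 * Real.pi * j / n * t) := by
  have : (-2 * Real.pi * Complex.I * j * t / n : ℂ) =
      ((-(2 * Real.pi * j / n * t) : ℝ) : ℂ) * Complex.I := by push_cast; ring
  rw [fourierVec, this, Complex.re_ofReal_mul, Complex.exp_ofReal_mul_I_re, Real.cos_neg]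

lemma fourierVec_im (n j t : ℕ) :
    (fourierVec n j t).im = (Real.sqrt n)⁻¹ * -Real.sin (2 * Real.pi * j / n * t) := by
  have : (-2 * Real.pi * Complex.I * j * t / n : ℂ) =
      ((-(2 * Real.pi * j / n * t) : ℝ) : ℂ) * Complex.I := by push_cast; ring
  rw [fourierVec, this, Complex.im_ofReal_mul, Complex.exp_ofReal_mul_I_im, Real.sin_neg]

/-- Every row is a sampled cosine: the imaginary parts carry `-sin x = cos (x + π/2)`. For even `n`
the last row has odd index and so gets phase `0`, as it should. -/
lemma fourierMatrix_apply (n : ℕ) (i t : Fin n) :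
    fourierMatrix n i t = rowFun n i ((t : ℕ) : ℤ) := by
  have hcast : ((((t : ℕ) + 1 : ℕ)) : ℝ) = (((t : ℕ) : ℤ) : ℝ) + 1 := by push_cast; ring
  simp only [fourierMatrix, Matrix.of_apply, rowFun, rowAmp, rowPhase, fourierVec_re,
    fourierVec_im, rowFreq, hcast]
  by_cases h0 : (i : ℕ) = 0
  · simp [h0]
  by_cases h1 : Even n ∧ (i : ℕ) + 1 = n
  · have hodd : Odd (i : ℕ) := by
      obtain ⟨k, hk⟩ := h1.1
      exact ⟨k - 1, by omega⟩
    rw [if_neg h0, if_pos h1, if_pos (Or.inr h1), if_pos (Or.inr hodd), h1.2]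
    simp
  by_cases h2 : Odd (i : ℕ)
  · rw [if_neg h0, if_neg h1, if_pos h2, if_neg (by tauto), if_pos (Or.inr h2)]
    rw [add_zero]; ring
  · have he : ((i : ℕ) + 1) / 2 = (i : ℕ) / 2 := by
      have := Nat.not_odd_iff_even.mp h2
      obtain ⟨k, hk⟩ := this
      omega
    rw [if_neg h0, if_neg h1, if_neg h2, if_neg (by tauto), if_neg (by tauto), he,
      Real.cos_add_pi_div_two]
    ring

lemma abs_rowFun_le {n : ℕ} (i : Fin n) (t : ℤ) :
    |rowFun n i t| ≤ (Real.sqrt n)⁻¹ * Real.sqrt 2 := by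
  have h2 : (1 : ℝ) ≤ Real.sqrt 2 := Real.one_le_sqrt.mpr (by norm_num)
  rw [rowFun, abs_mul, rowAmp, abs_mul, abs_of_nonneg (by positivity : 0 ≤ (Real.sqrt n)⁻¹)]
  have h3 : |if (i : ℕ) = 0 ∨ (Even n ∧ (i : ℕ) + 1 = n) then 1 else Real.sqrt 2|
      ≤ Real.sqrt 2 := by
    split_ifs
    · simp
    · rw [abs_of_nonneg (by positivity)]
  calc _ ≤ ((Real.sqrt n)⁻¹ * Real.sqrt 2) * 1 := by
        gcongr
        exact Real.abs_cos_le_one _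
    _ = _ := mul_one _

lemma abs_rowFun_mul_rowFun_le {n : ℕ} (i j : Fin n) (s t : ℤ) :
    |rowFun n i s * rowFun n j t| ≤ 2 / n := by
  rw [abs_mul]
  calc _ ≤ ((Real.sqrt n)⁻¹ * Real.sqrt 2) * ((Real.sqrt n)⁻¹ * Real.sqrt 2) := by
        gcongr <;> exact abs_rowFun_le _ _
    _ = (Real.sqrt 2) ^ 2 / (Real.sqrt n) ^ 2 := by field_simp
    _ = _ := by rw [Real.sq_sqrt (by norm_num), Real.sq_sqrt (by positivity)]

/-- The product-to-sum formula reduces each inner product of rows to `sum_cos_fourier` at the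
difference and at the sum of the two frequency indices. -/
lemma fourierMatrix_mul_transpose (n : ℕ) :
    fourierMatrix n * (fourierMatrix n)ᵀ = 1 := by
  ext i j
  have hn : n ≠ 0 := by have := i.isLt; omega
  have hnr : (0 : ℝ) < n := by positivity
  rw [Matrix.mul_apply]
  simp only [Matrix.transpose_apply, fourierMatrix_apply]
  set ki : ℕ := ((i : ℕ) + 1) / 2 with hki
  set kj : ℕ := ((j : ℕ) + 1) / 2 with hkj
  have hprod : ∀ t : ℕ, rowFun n i t * rowFun n j t =
      rowAmp n i * rowAmp n j / 2 *
        (Real.cos (2 * Real.pi * ((ki : ℤ) - (kj : ℤ) : ℤ) / n * ((t : ℝ) + 1) +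
            (rowPhase n i - rowPhase n j)) +
          Real.cos (2 * Real.pi * ((ki : ℤ) + (kj : ℤ) : ℤ) / n * ((t : ℝ) + 1) +
            (rowPhase n i + rowPhase n j))) := by
    intro t
    have := Real.two_mul_cos_mul_cos (rowFreq n i * ((t : ℝ) + 1) + rowPhase n i)
      (rowFreq n j * ((t : ℝ) + 1) + rowPhase n j)
    have e1 : rowFreq n i * ((t : ℝ) + 1) + rowPhase n i -
        (rowFreq n j * ((t : ℝ) + 1) + rowPhase n j) =
        2 * Real.pi * ((ki : ℤ) - (kj : ℤ) : ℤ) / n * ((t : ℝ) + 1) +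
            (rowPhase n i - rowPhase n j) := by
      simp only [rowFreq, ← hki, ← hkj]; push_cast; ring
    have e2 : rowFreq n i * ((t : ℝ) + 1) + rowPhase n i +
        (rowFreq n j * ((t : ℝ) + 1) + rowPhase n j) =
        2 * Real.pi * ((ki : ℤ) + (kj : ℤ) : ℤ) / n * ((t : ℝ) + 1) +
            (rowPhase n i + rowPhase n j) := by
      simp only [rowFreq, ← hki, ← hkj]; push_cast; ring
    rw [e1, e2] at this
    rw [← this, rowFun, rowFun]
    push_cast
    ring
  rw [Fin.sum_univ_eq_sum_range (fun t : ℕ => rowFun n i t * rowFun n j t)]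
  simp_rw [hprod]
  rw [← Finset.mul_sum, Finset.sum_add_distrib, sum_cos_fourier hn, sum_cos_fourier hn]
  have hi := i.isLt
  have hj := j.isLt
  have hsq : (Real.sqrt n)⁻¹ * (Real.sqrt n)⁻¹ = (n : ℝ)⁻¹ := by
    rw [← mul_inv, Real.mul_self_sqrt hnr.le]
  have hsq2 : Real.sqrt 2 * Real.sqrt 2 = 2 := Real.mul_self_sqrt (by norm_num)
  have hdiff : ((n : ℤ) ∣ (ki : ℤ) - (kj : ℤ)) ↔ ki = kj := by
    constructor
    · intro h
      by_contra hne
      have := Int.eq_zero_of_abs_lt_dvd h (by rw [abs_lt]; omega)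
      omega
    · rintro h; simp [h]
  -- Frequency indices are at most `n/2`, so the sum is divisible by `n` only at frequency `0` or at
  -- the Nyquist frequency; these are the rows without the factor `√2`.
  have hsum : ((n : ℤ) ∣ (ki : ℤ) + (kj : ℤ)) ↔
      ((i : ℕ) = 0 ∧ (j : ℕ) = 0) ∨ (Even n ∧ (i : ℕ) + 1 = n ∧ (j : ℕ) + 1 = n) := by
    constructor
    · rintro ⟨q, hq⟩
      rcases lt_trichotomy q 0 with h | h | h
      · nlinarith [(by omega : (0 : ℤ) ≤ (ki : ℤ) + kj), (by omega : (0 : ℤ) < n)]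
      · subst h; left; omega
      · right
        have h1 : q ≤ 1 := by
          by_contra h2
          nlinarith [(by omega : (ki : ℤ) + kj ≤ n), (by omega : (0 : ℤ) < n)]
        have h3 : q = 1 := by omega
        subst h3
        rw [Nat.even_iff]
        omega
    · rintro (⟨h1, h2⟩ | ⟨h1, h2, h3⟩)
      · have : ki = 0 := by omega
        have : kj = 0 := by omega
        simp [*]
      · refine ⟨1, ?_⟩
        rw [Nat.even_iff] at h1
        omega
  by_cases hij : i = j
  · subst hij
    rw [Matrix.one_apply_eq, if_pos (hdiff.mpr rfl), sub_self, Real.cos_zero]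
    by_cases hs : (n : ℤ) ∣ (ki : ℤ) + (ki : ℤ)
    · rw [if_pos hs]
      have hs' := hsum.mp hs
      have h0 : (i : ℕ) = 0 ∨ (Even n ∧ (i : ℕ) + 1 = n) := by tauto
      have hph : rowPhase n i = 0 := by
        rw [rowPhase, if_pos]
        rcases h0 with h | ⟨h, h'⟩
        · exact Or.inl h
        · right
          rw [Nat.even_iff] at h
          rw [Nat.odd_iff]
          omega
      rw [hph, rowAmp, if_pos h0]
      simp only [mul_one, add_zero, Real.cos_zero, hsq]
      field_simp
      norm_num
    · rw [if_neg hs]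
      have h0 : ¬ ((i : ℕ) = 0 ∨ (Even n ∧ (i : ℕ) + 1 = n)) := by
        intro h; apply hs; rw [hsum]; tauto
      rw [rowAmp, if_neg h0]
      have : (Real.sqrt n)⁻¹ * Real.sqrt 2 * ((Real.sqrt n)⁻¹ * Real.sqrt 2) = 2 / n := by
        rw [mul_mul_mul_comm, hsq, hsq2]; ring
      rw [this]
      field_simp
      norm_num
  · rw [Matrix.one_apply_ne hij]
    have hne : (i : ℕ) ≠ (j : ℕ) := fun h => hij (Fin.ext h)
    have hs : ¬ ((n : ℤ) ∣ (ki : ℤ) + (kj : ℤ)) := by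
      rw [hsum]; omega
    rw [if_neg hs, add_zero]
    by_cases hd : (n : ℤ) ∣ (ki : ℤ) - (kj : ℤ)
    · rw [if_pos hd]
      have hk := hdiff.mp hd
      -- Distinct rows with the same frequency are a cosine and a sine, a quarter period apart.
      have : Real.cos (rowPhase n i - rowPhase n j) = 0 := by
        simp only [rowPhase]
        by_cases hodd : Odd (i : ℕ)
        · have h1 : ¬ ((j : ℕ) = 0 ∨ Odd (j : ℕ)) := by
            rw [Nat.odd_iff] at *; omega
          rw [if_pos (Or.inr hodd), if_neg h1, zero_sub, Real.cos_neg, Real.cos_pi_div_two]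
        · have h1 : ¬ ((i : ℕ) = 0 ∨ Odd (i : ℕ)) := by
            rw [Nat.odd_iff] at *; omega
          have h2 : Odd (j : ℕ) := by
            rw [Nat.odd_iff] at *; omega
          rw [if_pos (Or.inr h2), if_neg h1, sub_zero, Real.cos_pi_div_two]
      rw [this]; simp
    · rw [if_neg hd]; simp

lemma transpose_mul_fourierMatrix (n : ℕ) :
    (fourierMatrix n)ᵀ * fourierMatrix n = 1 :=
  mul_eq_one_comm.mp (fourierMatrix_mul_transpose n)

end Fourier

/-! ### The spectral density -/

section Spectral

variable {γ : ℤ → ℝ}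

lemma summable_mul_cos (hs : Summable fun h => |γ h|) (l : ℝ) :
    Summable fun k : ℤ => γ k * Real.cos (k * l) := by
  refine Summable.of_norm_bounded hs fun k => ?_
  rw [Real.norm_eq_abs, abs_mul]
  exact mul_le_of_le_one_right (abs_nonneg _) (Real.abs_cos_le_one _)

lemma spectralDensity_eq (hs : Summable fun h => |γ h|) (l : ℝ) :
    spectralDensity γ l = (2 * Real.pi)⁻¹ * ∑' k : ℤ, γ k * Real.cos (k * l) := by
  have hexp : ∀ k : ℤ, Complex.exp (-Complex.I * k * l) =
      Complex.exp (((-(k * l) : ℝ) : ℂ) * Complex.I) := by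
    intro k; congr 1; push_cast; ring
  have hsum : Summable fun k : ℤ => (γ k : ℂ) * Complex.exp (-Complex.I * k * l) := by
    refine Summable.of_norm_bounded hs fun k => ?_
    rw [norm_mul, hexp, Complex.norm_exp_ofReal_mul_I, mul_one, Complex.norm_real,
      Real.norm_eq_abs]
  rw [spectralDensity, Complex.re_tsum hsum]
  congr 1
  refine tsum_congr fun k => ?_
  rw [hexp, Complex.re_ofReal_mul, Complex.exp_ofReal_mul_I_re, Real.cos_neg]

/-- Sinusoids are eigenfunctions of convolution with an even sequence. -/
lemma tsum_mul_cos_sub (hs : Summable fun h => |γ h|) (heven : ∀ h, γ (-h) = γ h) (l x : ℝ) :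
    ∑' h : ℤ, γ h * Real.cos (x - h * l) = 2 * Real.pi * spectralDensity γ l * Real.cos x := by
  have hsin : Summable fun k : ℤ => γ k * Real.sin (k * l) := by
    refine Summable.of_norm_bounded hs fun k => ?_
    rw [Real.norm_eq_abs, abs_mul]
    exact mul_le_of_le_one_right (abs_nonneg _) (Real.abs_sin_le_one _)
  have h0 : ∑' k : ℤ, γ k * Real.sin (k * l) = 0 := by
    have h1 := (Equiv.neg ℤ).tsum_eq fun k : ℤ => γ k * Real.sin (k * l)
    have h2 : ∀ k : ℤ, γ ((Equiv.neg ℤ) k) * Real.sin (((Equiv.neg ℤ) k : ℤ) * l) =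
        -(γ k * Real.sin (k * l)) := by
      intro k
      simp [heven]
    simp_rw [h2, tsum_neg] at h1
    linarith
  have h3 : ∀ h : ℤ, γ h * Real.cos (x - h * l) =
      Real.cos x * (γ h * Real.cos (h * l)) + Real.sin x * (γ h * Real.sin (h * l)) := by
    intro h; rw [Real.cos_sub]; ring
  simp_rw [h3]
  rw [Summable.tsum_add ((summable_mul_cos hs l).mul_left _) (hsin.mul_left _), tsum_mul_left,
    tsum_mul_left, h0, spectralDensity_eq hs]
  have := Real.pi_pos
  rw [mul_zero, add_zero, mul_inv_cancel_left₀ (by positivity), mul_comm]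

lemma sum_fin_eq_tsum_ite (n : ℕ) (u : ℤ → ℝ) :
    ∑ t : Fin n, u ((t : ℕ) : ℤ) = ∑' t : ℤ, if 0 ≤ t ∧ t < n then u t else 0 := by
  rw [tsum_eq_sum (s := Finset.Ico 0 (n : ℤ)) (fun t ht => by
    rw [if_neg]; simpa [Finset.mem_Ico] using ht)]
  rw [Fin.sum_univ_eq_sum_range (fun t : ℕ => u t)]
  refine Finset.sum_bij (fun t _ => (t : ℤ)) ?_ ?_ ?_ ?_
  · intro t ht; simp at ht ⊢; exact ht
  · intro a _ b _ h; exact_mod_cast h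
  · intro b hb
    rw [Finset.mem_Ico] at hb
    exact ⟨b.toNat, by simp; omega, by simp; omega⟩
  · intro t ht
    rw [if_pos]
    simp at ht ⊢; exact ht

/-- This edge effect is the source of the factor `|h|` in the error bound for the diagonalization,
and hence of the first-moment condition on `γ`. -/
lemma card_filter_shift_le (n : ℕ) (h : ℤ) :
    ((Finset.univ.filter fun s : Fin n => ¬ (0 ≤ ((s : ℕ) : ℤ) - h ∧ ((s : ℕ) : ℤ) - h < n)).card
      : ℝ) ≤ |(h : ℝ)| := by
  have h1 : (Finset.univ.filter fun s : Fin n =>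
      ¬ (0 ≤ ((s : ℕ) : ℤ) - h ∧ ((s : ℕ) : ℤ) - h < n)).card ≤ h.natAbs := by
    rcases le_total 0 h with hh | hh
    · calc _ ≤ (Finset.range h.natAbs).card := by
            refine Finset.card_le_card_of_injOn (fun s => (s : ℕ)) ?_ ?_
            · intro s hs
              simp at hs ⊢
              have := s.isLt
              omega
            · intro a _ b _ hab; exact Fin.ext hab
        _ = _ := by simp
    · calc _ ≤ (Finset.range h.natAbs).card := by
            refine Finset.card_le_card_of_injOn (fun s => n - 1 - (s : ℕ)) ?_ ?_
            · intro s hs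
              simp at hs ⊢
              have := s.isLt
              omega
            · intro a _ b _ hab
              have := a.isLt
              have := b.isLt
              simp at hab
              exact Fin.ext (by omega)
        _ = _ := by simp
  calc _ ≤ (h.natAbs : ℝ) := by exact_mod_cast h1
    _ = |(h : ℝ)| := by rw [Nat.cast_natAbs]; simp

/-- The Fourier transform nearly diagonalizes the covariance matrix: the error is `O(1/n)` in
every entry. -/
lemma abs_fourier_autocov_sub_le (hs : Summable fun h => |γ h|)
    (hs1 : Summable fun h : ℤ => |(h : ℝ)| * |γ h|) (heven : ∀ h, γ (-h) = γ h) {n : ℕ}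
    (i j : Fin n) :
    |(fourierMatrix n * autocovMatrix γ n * (fourierMatrix n)ᵀ) i j -
        Matrix.diagonal (fun i => 2 * Real.pi * spectralDensity γ (rowFreq n i)) i j| ≤
      (2 * ∑' h : ℤ, |(h : ℝ)| * |γ h|) / n := by
  set D := fun i : Fin n => 2 * Real.pi * spectralDensity γ (rowFreq n i) with hD
  -- `r s` collects the terms of the convolution over all of `ℤ` that the finite window misses. Over
  -- `ℤ` the row would be an exact eigenvector.
  set r : Fin n → ℤ → ℝ := fun s h =>
    if 0 ≤ ((s : ℕ) : ℤ) - h ∧ ((s : ℕ) : ℤ) - h < n then 0 else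
      γ h * rowFun n j (((s : ℕ) : ℤ) - h) with hr
  have hgs : ∀ s : Fin n, Summable fun h : ℤ => γ h * rowFun n j (((s : ℕ) : ℤ) - h) := by
    intro s
    refine Summable.of_norm_bounded (hs.mul_right ((Real.sqrt n)⁻¹ * Real.sqrt 2)) fun h => ?_
    rw [Real.norm_eq_abs, abs_mul]
    exact mul_le_mul_of_nonneg_left (abs_rowFun_le _ _) (abs_nonneg _)
  have hrs : ∀ s : Fin n, Summable (r s) := by
    intro s
    refine Summable.of_norm_bounded (hgs s).norm fun h => ?_
    simp only [hr]
    split_ifs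
    · simpa using mul_nonneg (abs_nonneg _) (abs_nonneg _)
    · rfl
  have hconv : ∀ s : Fin n, ∑ t : Fin n, γ (((s : ℕ) : ℤ) - ((t : ℕ) : ℤ)) *
      rowFun n j ((t : ℕ) : ℤ) = D j * rowFun n j ((s : ℕ) : ℤ) - ∑' h, r s h := by
    intro s
    rw [sum_fin_eq_tsum_ite n fun t => γ (((s : ℕ) : ℤ) - t) * rowFun n j t,
      ← (Equiv.subLeft ((s : ℕ) : ℤ)).tsum_eq]
    have h1 : D j * rowFun n j ((s : ℕ) : ℤ) =
        ∑' h : ℤ, γ h * rowFun n j (((s : ℕ) : ℤ) - h) := by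
      have h2 := tsum_mul_cos_sub hs heven (rowFreq n j)
        (rowFreq n j * ((((s : ℕ) : ℤ) : ℝ) + 1) + rowPhase n j)
      rw [hD, rowFun, mul_left_comm, ← h2, ← tsum_mul_left]
      refine tsum_congr fun h => ?_
      rw [rowFun, mul_left_comm]
      congr 3
      push_cast
      ring
    rw [h1, ← Summable.tsum_sub (hgs s) (hrs s)]
    refine tsum_congr fun h => ?_
    simp only [hr, Equiv.subLeft_apply, sub_sub_cancel]
    split_ifs <;> simp
  have hentry : (fourierMatrix n * autocovMatrix γ n * (fourierMatrix n)ᵀ) i j =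
      ∑ s : Fin n, rowFun n i ((s : ℕ) : ℤ) * (D j * rowFun n j ((s : ℕ) : ℤ) - ∑' h, r s h) := by
    simp_rw [← hconv]
    rw [Matrix.mul_assoc, Matrix.mul_apply]
    refine Finset.sum_congr rfl fun s _ => ?_
    rw [fourierMatrix_apply, Matrix.mul_apply]
    congr 1
    refine Finset.sum_congr rfl fun t _ => ?_
    rw [Matrix.transpose_apply, fourierMatrix_apply, autocovMatrix, Matrix.of_apply]
  have horth : ∑ s : Fin n, rowFun n i ((s : ℕ) : ℤ) * rowFun n j ((s : ℕ) : ℤ) =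
      (1 : Matrix (Fin n) (Fin n) ℝ) i j := by
    rw [← fourierMatrix_mul_transpose, Matrix.mul_apply]
    refine Finset.sum_congr rfl fun s _ => ?_
    rw [Matrix.transpose_apply, fourierMatrix_apply, fourierMatrix_apply]
  have hdiag : Matrix.diagonal D i j = D j * (1 : Matrix (Fin n) (Fin n) ℝ) i j := by
    by_cases hij : i = j
    · subst hij; simp
    · simp [Matrix.diagonal_apply_ne _ hij, Matrix.one_apply_ne hij]
  have hE : (fourierMatrix n * autocovMatrix γ n * (fourierMatrix n)ᵀ) i j -
      Matrix.diagonal D i j = -∑' h, ∑ s : Fin n, rowFun n i ((s : ℕ) : ℤ) * r s h := by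
    rw [hentry, hdiag, ← horth, Summable.tsum_finsetSum fun s _ => (hrs s).mul_left _,
      Finset.mul_sum, ← Finset.sum_sub_distrib, ← Finset.sum_neg_distrib]
    refine Finset.sum_congr rfl fun s _ => ?_
    rw [tsum_mul_left]; ring
  -- At lag `h` at most `|h|` times are missed, and each costs `(2/n) |γ h|` because the entries of
  -- the Fourier matrix are of order `n^{-1/2}`.
  have hbound : ∀ h : ℤ, ‖∑ s : Fin n, rowFun n i ((s : ℕ) : ℤ) * r s h‖ ≤
      2 / n * (|(h : ℝ)| * |γ h|) := by
    intro h
    calc _ ≤ ∑ s : Fin n, (if ¬ (0 ≤ ((s : ℕ) : ℤ) - h ∧ ((s : ℕ) : ℤ) - h < n) then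
          2 / n * |γ h| else 0) := by
          refine norm_sum_le_of_le _ fun s _ => ?_
          simp only [hr, Real.norm_eq_abs]
          split_ifs with hc
          · simp
          · rw [mul_left_comm, abs_mul, mul_comm]
            gcongr
            exact abs_rowFun_mul_rowFun_le _ _ _ _
      _ = (Finset.univ.filter fun s : Fin n =>
            ¬ (0 ≤ ((s : ℕ) : ℤ) - h ∧ ((s : ℕ) : ℤ) - h < n)).card * (2 / n * |γ h|) := by
          rw [← Finset.sum_filter, Finset.sum_const, nsmul_eq_mul]
      _ ≤ |(h : ℝ)| * (2 / n * |γ h|) := by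
          gcongr
          exact card_filter_shift_le n h
      _ = _ := by ring
  rw [hE, abs_neg, ← Real.norm_eq_abs]
  refine (tsum_of_norm_bounded (hs1.mul_left (2 / (n : ℝ))).hasSum hbound).trans (le_of_eq ?_)
  rw [tsum_mul_left]; ring

end Spectral

/-! ### Fourier inversion and eigenvalue bounds for Toeplitz matrices -/

section SpectralBounds

variable {γ : ℤ → ℝ}

lemma continuous_spectralDensity (hs : Summable fun h => |γ h|) :
    Continuous (spectralDensity γ) := by
  have h : spectralDensity γ = fun l => (2 * Real.pi)⁻¹ * ∑' k : ℤ, γ k * Real.cos (k * l) :=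
    funext fun l => spectralDensity_eq hs l
  rw [h]
  refine continuous_const.mul (continuous_tsum (fun k => by fun_prop) hs fun k l => ?_)
  rw [Real.norm_eq_abs, abs_mul]
  exact mul_le_of_le_one_right (abs_nonneg _) (Real.abs_cos_le_one _)

lemma spectralDensity_le (hs : Summable fun h => |γ h|) (l : ℝ) :
    2 * Real.pi * spectralDensity γ l ≤ ∑' h, |γ h| := by
  have := Real.pi_pos
  rw [spectralDensity_eq hs, mul_inv_cancel_left₀ (by positivity)]
  refine (summable_mul_cos hs l).tsum_le_tsum (fun k => ?_) hs
  refine (le_abs_self _).trans ?_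
  rw [abs_mul]
  exact mul_le_of_le_one_right (abs_nonneg _) (Real.abs_cos_le_one _)

lemma integral_cos_int_mul (k : ℤ) :
    ∫ l in (-Real.pi)..Real.pi, Real.cos (k * l) = if k = 0 then 2 * Real.pi else 0 := by
  split_ifs with h
  · simp [h]; ring
  · have hk : (k : ℝ) ≠ 0 := by exact_mod_cast h
    rw [intervalIntegral.integral_comp_mul_left (fun x => Real.cos x) hk, integral_cos]
    simp

lemma integral_spectralDensity_mul_cos (hs : Summable fun h => |γ h|)
    (heven : ∀ h, γ (-h) = γ h) (k : ℤ) :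
    ∫ l in (-Real.pi)..Real.pi, spectralDensity γ l * Real.cos (k * l) = γ k := by
  have hpi := Real.pi_pos
  -- For `k = 0` both indicators are active at `m = 0`, which gives the required `2π γ 0`.
  have hI : ∀ m : ℤ, ∫ l in (-Real.pi)..Real.pi, γ m * Real.cos (m * l) * Real.cos (k * l) =
      (if m = k then Real.pi * γ m else 0) + (if m = -k then Real.pi * γ m else 0) := by
    intro m
    have h1 : ∀ l : ℝ, γ m * Real.cos (m * l) * Real.cos (k * l) =
        γ m / 2 * (Real.cos ((m - k : ℤ) * l) + Real.cos ((m + k : ℤ) * l)) := by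
      intro l
      have := Real.two_mul_cos_mul_cos (m * l) (k * l)
      push_cast
      rw [sub_mul, add_mul, ← this]; ring
    simp_rw [h1]
    rw [intervalIntegral.integral_const_mul, intervalIntegral.integral_add
      (Continuous.intervalIntegrable (by fun_prop) _ _)
      (Continuous.intervalIntegrable (by fun_prop) _ _), integral_cos_int_mul,
      integral_cos_int_mul]
    simp only [sub_eq_zero, add_eq_zero_iff_eq_neg, mul_add, mul_ite, mul_zero]
    congr 1 <;> (congr 1; ring)
  have hsw := intervalIntegral.hasSum_integral_of_dominated_convergence
    (μ := volume) (a := -Real.pi) (b := Real.pi)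
    (F := fun (m : ℤ) l => γ m * Real.cos (m * l) * Real.cos (k * l))
    (f := fun l => (∑' m : ℤ, γ m * Real.cos (m * l)) * Real.cos (k * l))
    (fun m _ => |γ m|)
    (fun m => (Continuous.aestronglyMeasurable (by fun_prop)))
    (fun m => ae_of_all _ fun l _ => by
      rw [Real.norm_eq_abs, abs_mul, abs_mul]
      refine (mul_le_of_le_one_right (by positivity) (Real.abs_cos_le_one _)).trans
        (mul_le_of_le_one_right (by positivity) (Real.abs_cos_le_one _)))
    (ae_of_all _ fun l _ => hs) (by simp)
    (ae_of_all _ fun l _ => ((summable_mul_cos hs l).hasSum.mul_right _))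
  simp_rw [hI] at hsw
  have h2 : HasSum (fun m : ℤ => (if m = k then Real.pi * γ m else 0) +
      (if m = -k then Real.pi * γ m else 0)) (Real.pi * γ k + Real.pi * γ (-k)) := by
    refine HasSum.add ?_ ?_
    · simpa using hasSum_single (f := fun m : ℤ => if m = k then Real.pi * γ m else 0) k
        fun m hm => if_neg hm
    · simpa using hasSum_single (f := fun m : ℤ => if m = -k then Real.pi * γ m else 0) (-k)
        fun m hm => if_neg hm
  have h3 := hsw.unique h2
  simp_rw [spectralDensity_eq hs, mul_assoc]
  rw [intervalIntegral.integral_const_mul, h3, heven]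
  field_simp
  ring

/-- The factor after `f` is `|∑ v_s exp(isl)|²`. Pointwise bounds on `f` thus become bounds on the
spectrum of the Toeplitz matrix, uniformly in `n`, with `integral_trig_sq` (Parseval) for the
normalization. -/
lemma quad_autocov_eq_integral (hs : Summable fun h => |γ h|)
    (heven : ∀ h, γ (-h) = γ h) {n : ℕ} (v : Fin n → ℝ) :
    v ⬝ᵥ (autocovMatrix γ n *ᵥ v) = ∫ l in (-Real.pi)..Real.pi, spectralDensity γ l *
      ((∑ s, v s * Real.cos ((s : ℕ) * l)) ^ 2 + (∑ s, v s * Real.sin ((s : ℕ) * l)) ^ 2) := by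
  have hf := continuous_spectralDensity hs
  have h1 : ∀ l : ℝ, spectralDensity γ l *
      ((∑ s, v s * Real.cos ((s : ℕ) * l)) ^ 2 + (∑ s, v s * Real.sin ((s : ℕ) * l)) ^ 2) =
      ∑ s : Fin n, ∑ t : Fin n, v s * v t *
        (spectralDensity γ l * Real.cos ((((s : ℕ) : ℤ) - ((t : ℕ) : ℤ) : ℤ) * l)) := by
    intro l
    rw [sq, sq, Finset.sum_mul_sum, Finset.sum_mul_sum, ← Finset.sum_add_distrib,
      Finset.mul_sum]
    refine Finset.sum_congr rfl fun s _ => ?_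
    rw [← Finset.sum_add_distrib, Finset.mul_sum]
    refine Finset.sum_congr rfl fun t _ => ?_
    push_cast
    rw [sub_mul, Real.cos_sub]; ring
  simp_rw [h1]
  rw [intervalIntegral.integral_finsetSum fun s _ =>
    Continuous.intervalIntegrable (by fun_prop) _ _]
  simp only [dotProduct, Matrix.mulVec, Finset.mul_sum]
  refine Finset.sum_congr rfl fun s _ => ?_
  rw [intervalIntegral.integral_finsetSum fun t _ =>
    Continuous.intervalIntegrable (by fun_prop) _ _]
  refine Finset.sum_congr rfl fun t _ => ?_
  rw [intervalIntegral.integral_const_mul, integral_spectralDensity_mul_cos hs heven,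
    autocovMatrix, Matrix.of_apply]
  ring

lemma integral_trig_sq {n : ℕ} (v : Fin n → ℝ) :
    ∫ l in (-Real.pi)..Real.pi,
      ((∑ s, v s * Real.cos ((s : ℕ) * l)) ^ 2 + (∑ s, v s * Real.sin ((s : ℕ) * l)) ^ 2) =
      2 * Real.pi * (v ⬝ᵥ v) := by
  have h1 : ∀ l : ℝ,
      ((∑ s, v s * Real.cos ((s : ℕ) * l)) ^ 2 + (∑ s, v s * Real.sin ((s : ℕ) * l)) ^ 2) =
      ∑ s : Fin n, ∑ t : Fin n, v s * v t *
        (Real.cos ((((s : ℕ) : ℤ) - ((t : ℕ) : ℤ) : ℤ) * l)) := by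
    intro l
    rw [sq, sq, Finset.sum_mul_sum, Finset.sum_mul_sum, ← Finset.sum_add_distrib]
    refine Finset.sum_congr rfl fun s _ => ?_
    rw [← Finset.sum_add_distrib]
    refine Finset.sum_congr rfl fun t _ => ?_
    push_cast
    rw [sub_mul, Real.cos_sub]; ring
  simp_rw [h1]
  rw [intervalIntegral.integral_finsetSum fun s _ =>
    Continuous.intervalIntegrable (by fun_prop) _ _]
  simp only [dotProduct, Finset.mul_sum]
  refine Finset.sum_congr rfl fun s _ => ?_
  rw [intervalIntegral.integral_finsetSum fun t _ =>
    Continuous.intervalIntegrable (by fun_prop) _ _]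
  rw [Finset.sum_eq_single s]
  · rw [intervalIntegral.integral_const_mul, integral_cos_int_mul]; simp; ring
  · intro t _ hts
    rw [intervalIntegral.integral_const_mul, integral_cos_int_mul, if_neg, mul_zero]
    intro h
    exact hts (Fin.ext (by omega))
  · simp

lemma le_quad_autocov (hs : Summable fun h => |γ h|) (heven : ∀ h, γ (-h) = γ h) {β : ℝ}
    (hβ : ∀ l ∈ Set.Icc (-Real.pi) Real.pi, β ≤ spectralDensity γ l) {n : ℕ} (v : Fin n → ℝ) :
    2 * Real.pi * β * (v ⬝ᵥ v) ≤ v ⬝ᵥ (autocovMatrix γ n *ᵥ v) := by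
  have hf := continuous_spectralDensity hs
  have hpi := Real.pi_pos
  rw [quad_autocov_eq_integral hs heven, mul_right_comm, ← integral_trig_sq, mul_comm,
    ← intervalIntegral.integral_const_mul]
  refine intervalIntegral.integral_mono_on (by linarith)
    (Continuous.intervalIntegrable (by fun_prop) _ _)
    (Continuous.intervalIntegrable (by fun_prop) _ _) fun l hl => ?_
  exact mul_le_mul_of_nonneg_right (hβ l hl) (by positivity)

lemma quad_autocov_le (hs : Summable fun h => |γ h|) (heven : ∀ h, γ (-h) = γ h) {n : ℕ}
    (v : Fin n → ℝ) :
    v ⬝ᵥ (autocovMatrix γ n *ᵥ v) ≤ (∑' h, |γ h|) * (v ⬝ᵥ v) := by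
  have hf := continuous_spectralDensity hs
  have hpi := Real.pi_pos
  have h1 : (∑' h, |γ h|) * (v ⬝ᵥ v) = (∑' h, |γ h|) / (2 * Real.pi) *
      (2 * Real.pi * (v ⬝ᵥ v)) := by field_simp
  rw [quad_autocov_eq_integral hs heven, h1, ← integral_trig_sq,
    ← intervalIntegral.integral_const_mul]
  refine intervalIntegral.integral_mono_on (by linarith)
    (Continuous.intervalIntegrable (by fun_prop) _ _)
    (Continuous.intervalIntegrable (by fun_prop) _ _) fun l hl => ?_
  refine mul_le_mul_of_nonneg_right ?_ (by positivity)
  rw [le_div_iff₀ (by positivity), mul_comm]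
  exact spectralDensity_le hs l

lemma autocovMatrix_posDef (hs : Summable fun h => |γ h|) (heven : ∀ h, γ (-h) = γ h) {β : ℝ}
    (hβ0 : 0 < β) (hβ : ∀ l ∈ Set.Icc (-Real.pi) Real.pi, β ≤ spectralDensity γ l) (n : ℕ) :
    (autocovMatrix γ n).PosDef := by
  refine posDef_of_quad ?_ fun x hx => lt_of_lt_of_le ?_ (le_quad_autocov hs heven hβ x)
  · ext s t
    simp only [autocovMatrix, Matrix.transpose_apply, Matrix.of_apply]
    rw [← heven]
    congr 1; ring
  · have : 0 < x ⬝ᵥ x := by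
      obtain ⟨i, hi⟩ := Function.ne_iff.mp hx
      exact Finset.sum_pos' (fun i _ => mul_self_nonneg _)
        ⟨i, Finset.mem_univ _, mul_self_pos.mpr hi⟩
    have := Real.pi_pos
    positivity

/-- Integers other than `0` have `1 ≤ |h| ≤ |h| ^ α`. The lag `0` has weight zero in the hypothesis,
so `|γ 0|` is added separately. -/
lemma summable_abs_of_moment {α : ℝ} (hα : 1 < α)
    (h : Summable fun h : ℤ => |(h : ℝ)| ^ α * |γ h|) :
    (Summable fun h => |γ h|) ∧ Summable fun h : ℤ => |(h : ℝ)| * |γ h| := by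
  have h1 : ∀ k : ℤ, k ≠ 0 → (1 : ℝ) ≤ |(k : ℝ)| := by
    intro k hk
    have := Int.one_le_abs hk
    exact_mod_cast this
  have hb : Summable fun h : ℤ => |(h : ℝ)| * |γ h| := by
    refine Summable.of_nonneg_of_le (fun k => by positivity) (fun k => ?_) h
    rcases eq_or_ne k 0 with rfl | hk
    · simp [Real.zero_rpow (by linarith : α ≠ 0)]
    · refine mul_le_mul_of_nonneg_right ?_ (abs_nonneg _)
      exact Real.self_le_rpow_of_one_le (h1 k hk) hα.le
  refine ⟨?_, hb⟩
  refine Summable.of_nonneg_of_le (g := fun k : ℤ => |γ k|) (fun k => abs_nonneg _) (fun k => ?_)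
    (hb.add (hasSum_ite_eq (0 : ℤ) |γ 0|).summable)
  rcases eq_or_ne k 0 with rfl | hk
  · simp
  · rw [if_neg hk, add_zero]
    exact le_mul_of_one_le_left (abs_nonneg _) (h1 k hk)

end SpectralBounds

/-! ### Bernstein polynomials -/

section Bernstein

/-- Index shift `j = i + 1`, `k = m + 1`: beta densities are Bernstein polynomials normalized to
integral one. -/
lemma betaDensity_eq_bernstein (m i : ℕ) (hi : i ≤ m) (x : ℝ) :
    betaDensity (i + 1) (m + 1 - (i + 1) + 1) x =
      (m + 1) * (bernsteinPolynomial ℝ m i).eval x := by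
  have h1 : m + 1 - (i + 1) + 1 = m - i + 1 := by omega
  have h2 : (((i + 1 : ℕ) : ℝ) + ((m - i + 1 : ℕ) : ℝ)) = ((m + 1 : ℕ) : ℝ) + 1 := by
    rw [Nat.cast_add, Nat.cast_add, Nat.cast_sub hi]; push_cast; ring
  rw [betaDensity, h1, h2, Real.Gamma_nat_eq_factorial]
  rw [Nat.cast_add_one, Real.Gamma_nat_eq_factorial, Nat.cast_add_one,
    Real.Gamma_nat_eq_factorial, bernsteinPolynomial]
  simp only [Nat.add_sub_cancel, Polynomial.eval_mul, Polynomial.eval_natCast,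
    Polynomial.eval_pow, Polynomial.eval_X, Polynomial.eval_sub, Polynomial.eval_one]
  rw [Nat.cast_choose ℝ hi, Nat.factorial_succ]
  push_cast
  ring

lemma bernstein_eval_nonneg (m i : ℕ) {x : ℝ} (hx : x ∈ Set.Icc (0 : ℝ) 1) :
    0 ≤ (bernsteinPolynomial ℝ m i).eval x := by
  have h1 : 0 ≤ 1 - x := by linarith [hx.2]
  have h0 := hx.1
  simp only [bernsteinPolynomial, Polynomial.eval_mul, Polynomial.eval_natCast,
    Polynomial.eval_pow, Polynomial.eval_X, Polynomial.eval_sub, Polynomial.eval_one]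
  positivity

lemma integral_derivative_eval (p : Polynomial ℝ) (a b : ℝ) :
    ∫ x in a..b, p.derivative.eval x = p.eval b - p.eval a :=
  intervalIntegral.integral_eq_sub_of_hasDerivAt (fun x _ => p.hasDerivAt x)
    (p.derivative.continuous.intervalIntegrable _ _)

lemma integral_bernstein (m i : ℕ) (hi : i ≤ m) :
    ∫ x in (0 : ℝ)..1, (bernsteinPolynomial ℝ m i).eval x = 1 / (m + 1) := by
  -- Integrate `B'_{m+1,i+1} = (m+1)(B_{m,i} - B_{m,i+1})` over `[0,1]`: the boundary term vanishes
  -- unless `i = m`. So consecutive integrals agree, and a backward induction from `i = m` evaluates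
  -- them.
  have step : ∀ i, (m + 1 : ℝ) * ((∫ x in (0 : ℝ)..1, (bernsteinPolynomial ℝ m i).eval x) -
      ∫ x in (0 : ℝ)..1, (bernsteinPolynomial ℝ m (i + 1)).eval x) =
      if i = m then 1 else 0 := by
    intro i
    have h1 := integral_derivative_eval (bernsteinPolynomial ℝ (m + 1) (i + 1)) 0 1
    rw [bernsteinPolynomial.derivative_succ, bernsteinPolynomial.eval_at_0,
      bernsteinPolynomial.eval_at_1] at h1
    simp only [Nat.add_sub_cancel, Polynomial.eval_mul, Polynomial.eval_natCast,
      Polynomial.eval_sub, add_left_inj, Nat.succ_ne_zero, if_false, sub_zero] at h1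
    rw [intervalIntegral.integral_const_mul, intervalIntegral.integral_sub
      ((Polynomial.continuous _).intervalIntegrable _ _)
      ((Polynomial.continuous _).intervalIntegrable _ _)] at h1
    push_cast at h1
    exact h1
  have hm : (m + 1 : ℝ) ≠ 0 := by positivity
  induction h : m - i generalizing i with
  | zero =>
    have him : i = m := by omega
    have := step i
    rw [if_pos him, bernsteinPolynomial.eq_zero_of_lt ℝ (by omega : m < i + 1)] at this
    simp only [Polynomial.eval_zero, intervalIntegral.integral_zero, sub_zero] at this
    rw [eq_div_iff hm, mul_comm]; exact this
  | succ d ih =>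
    have := step i
    rw [if_neg (by omega), ih (i + 1) (by omega) (by omega)] at this
    have h2 := (mul_eq_zero.mp this).resolve_left hm
    linarith

lemma integral_bernstein_le (m i : ℕ) :
    ∫ x in (0 : ℝ)..1, (bernsteinPolynomial ℝ m i).eval x ≤ 1 / (m + 1) := by
  by_cases hi : i ≤ m
  · exact (integral_bernstein m i hi).le
  · rw [bernsteinPolynomial.eq_zero_of_lt ℝ (by omega : m < i)]
    simp; positivity

/-- The derivative is `m` times a difference of two basis polynomials of order `m - 1`, each of
integral at most `1/m`. -/
lemma integral_abs_derivative_bernstein_le (m i : ℕ) :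
    ∫ x in (0 : ℝ)..1, |(bernsteinPolynomial ℝ m i).derivative.eval x| ≤ 2 := by
  have hc : ∀ p : Polynomial ℝ, IntervalIntegrable (fun x => p.eval x) volume 0 1 :=
    fun p => p.continuous.intervalIntegrable _ _
  have hca : ∀ p : Polynomial ℝ, IntervalIntegrable (fun x => |p.eval x|) volume 0 1 :=
    fun p => p.continuous.abs.intervalIntegrable _ _
  -- For `m = 0` the truncated subtraction gives `m - 1 = 0`, but the factor `m` annihilates the
  -- term.
  have hm1 : (m : ℝ) * (1 / ((m - 1 : ℕ) + 1)) ≤ 1 := by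
    rcases m with _ | m
    · simp
    · simp; field_simp; rfl
  have hm0 : (0 : ℝ) ≤ m := by positivity
  rcases i with _ | i
  · have h1 : ∀ x ∈ Set.Icc (0 : ℝ) 1, |(bernsteinPolynomial ℝ m 0).derivative.eval x| ≤
        m * (bernsteinPolynomial ℝ (m - 1) 0).eval x := by
      intro x hx
      rw [bernsteinPolynomial.derivative_zero]
      simp only [Polynomial.eval_mul, Polynomial.eval_neg, Polynomial.eval_natCast]
      rw [abs_mul, abs_neg, abs_of_nonneg hm0, abs_of_nonneg (bernstein_eval_nonneg _ _ hx)]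
    refine (intervalIntegral.integral_mono_on zero_le_one (hca _) ((hc _).const_mul _) h1).trans ?_
    rw [intervalIntegral.integral_const_mul]
    have := mul_le_mul_of_nonneg_left (integral_bernstein_le (m - 1) 0) hm0
    linarith
  · have h1 : ∀ x ∈ Set.Icc (0 : ℝ) 1, |(bernsteinPolynomial ℝ m (i + 1)).derivative.eval x| ≤
        m * ((bernsteinPolynomial ℝ (m - 1) i).eval x +
          (bernsteinPolynomial ℝ (m - 1) (i + 1)).eval x) := by
      intro x hx
      rw [bernsteinPolynomial.derivative_succ]
      simp only [Polynomial.eval_mul, Polynomial.eval_sub, Polynomial.eval_natCast]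
      rw [abs_mul, abs_of_nonneg hm0]
      refine mul_le_mul_of_nonneg_left ?_ hm0
      have h2 := bernstein_eval_nonneg (m - 1) i hx
      have h3 := bernstein_eval_nonneg (m - 1) (i + 1) hx
      rw [abs_le]; constructor <;> linarith
    refine (intervalIntegral.integral_mono_on zero_le_one (hca _)
      (((hc _).add (hc _)).const_mul _) h1).trans ?_
    rw [intervalIntegral.integral_const_mul, intervalIntegral.integral_add (hc _) (hc _)]
    have h4 := mul_le_mul_of_nonneg_left (integral_bernstein_le (m - 1) i) hm0
    have h5 := mul_le_mul_of_nonneg_left (integral_bernstein_le (m - 1) (i + 1)) hm0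
    linarith

/-- The weight `G(i/(m+1), (i+1)/(m+1)]`. -/
noncomputable def cellMass (m : ℕ) (G : Measure ℝ) (i : ℕ) : ℝ :=
  (G (Set.Ioc ((i : ℝ) / ((m + 1 : ℕ) : ℝ)) (((i : ℝ) + 1) / ((m + 1 : ℕ) : ℝ)))).toReal

/-- The polynomial `q(· | m + 1, G)`. -/
noncomputable def bernsteinPoly (m : ℕ) (G : Measure ℝ) : Polynomial ℝ :=
  ∑ i ∈ Finset.range (m + 1),
    Polynomial.C (cellMass m G i * (m + 1)) * bernsteinPolynomial ℝ m i

lemma cellMass_nonneg (m : ℕ) (G : Measure ℝ) (i : ℕ) : 0 ≤ cellMass m G i :=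
  ENNReal.toReal_nonneg

/-- Mass of `G` outside `(0,1]` may be lost. An inequality is enough, because only an upper bound
for the mass of `c` is used later. -/
lemma sum_cellMass_le_one (m : ℕ) {G : Measure ℝ} (hG : G Set.univ ≤ 1) :
    ∑ i ∈ Finset.range (m + 1), cellMass m G i ≤ 1 := by
  have hfin : ∀ i : ℕ, G (Set.Ioc ((i : ℝ) / ((m + 1 : ℕ) : ℝ))
      (((i : ℝ) + 1) / ((m + 1 : ℕ) : ℝ))) ≠ ⊤ := fun i =>
    ((measure_mono (Set.subset_univ _)).trans hG).trans_lt ENNReal.one_lt_top |>.ne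
  have hm : (0 : ℝ) < ((m + 1 : ℕ) : ℝ) := by positivity
  simp only [cellMass]
  rw [← ENNReal.toReal_sum fun i _ => hfin i, ← measure_biUnion_finset]
  · exact ENNReal.toReal_le_of_le_ofReal zero_le_one
      (by simpa using (measure_mono (Set.subset_univ _)).trans hG)
  · intro i _ j _ hij
    simp only [Function.onFun]
    rw [Set.disjoint_left]
    rintro x ⟨h1, h2⟩ ⟨h3, h4⟩
    rw [div_lt_iff₀ hm] at h1 h3
    rw [le_div_iff₀ hm] at h2 h4
    have ha : (i : ℝ) < (j : ℝ) + 1 := by linarith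
    have hb : (j : ℝ) < (i : ℝ) + 1 := by linarith
    have ha' : i < j + 1 := by exact_mod_cast ha
    have hb' : j < i + 1 := by exact_mod_cast hb
    omega
  · exact fun i _ => measurableSet_Ioc

lemma bernsteinPoly_eval (m : ℕ) (G : Measure ℝ) (x : ℝ) :
    (bernsteinPoly m G).eval x = ∑ i ∈ Finset.range (m + 1),
      cellMass m G i * (m + 1) * (bernsteinPolynomial ℝ m i).eval x := by
  simp [bernsteinPoly, Polynomial.eval_finsetSum]

lemma bernsteinDensity_eq (m : ℕ) (G : Measure ℝ) (x : ℝ) :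
    bernsteinDensity (m + 1) G x = (bernsteinPoly m G).eval x := by
  rw [bernsteinPoly_eval, bernsteinDensity]
  refine (Finset.sum_bij (fun i _ => i + 1) ?_ ?_ ?_ ?_).symm
  · intro i hi
    simp only [Finset.mem_range, Finset.mem_Icc] at hi ⊢
    omega
  · intro a _ b _ h
    omega
  · intro b hb
    rw [Finset.mem_Icc] at hb
    exact ⟨b - 1, by simp; omega, by omega⟩
  · intro i hi
    rw [Finset.mem_range] at hi
    rw [betaDensity_eq_bernstein m i (by omega), cellMass]
    push_cast
    rw [add_sub_cancel_right, mul_assoc]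

lemma bernsteinPoly_eval_nonneg (m : ℕ) (G : Measure ℝ) {x : ℝ} (hx : x ∈ Set.Icc (0 : ℝ) 1) :
    0 ≤ (bernsteinPoly m G).eval x := by
  rw [bernsteinPoly_eval]
  refine Finset.sum_nonneg fun i _ => mul_nonneg (mul_nonneg (cellMass_nonneg _ _ _)
    (by positivity)) (bernstein_eval_nonneg _ _ hx)

lemma integral_bernsteinPoly (m : ℕ) (G : Measure ℝ) :
    ∫ x in (0 : ℝ)..1, (bernsteinPoly m G).eval x =
      ∑ i ∈ Finset.range (m + 1), cellMass m G i := by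
  simp_rw [bernsteinPoly_eval]
  rw [intervalIntegral.integral_finsetSum fun i _ =>
    ((Polynomial.continuous _).intervalIntegrable _ _).const_mul _]
  refine Finset.sum_congr rfl fun i hi => ?_
  rw [intervalIntegral.integral_const_mul, integral_bernstein m i (by simp at hi; omega)]
  field_simp

/-- The total variation grows only linearly with the order, so polynomials of order `o(n)` vary
little, on average, over cells of length `π/n`. -/
lemma integral_abs_derivative_bernsteinPoly_le (m : ℕ) {G : Measure ℝ} (hG : G Set.univ ≤ 1) :
    ∫ x in (0 : ℝ)..1, |(bernsteinPoly m G).derivative.eval x| ≤ 2 * (m + 1) := by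
  have h1 : ∀ x ∈ Set.Icc (0 : ℝ) 1, |(bernsteinPoly m G).derivative.eval x| ≤
      ∑ i ∈ Finset.range (m + 1), cellMass m G i * (m + 1) *
        |(bernsteinPolynomial ℝ m i).derivative.eval x| := by
    intro x _
    have : (bernsteinPoly m G).derivative.eval x = ∑ i ∈ Finset.range (m + 1),
        cellMass m G i * (m + 1) * (bernsteinPolynomial ℝ m i).derivative.eval x := by
      simp [bernsteinPoly, Polynomial.eval_finsetSum]
    rw [this]
    refine (Finset.abs_sum_le_sum_abs _ _).trans (Finset.sum_le_sum fun i _ => ?_)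
    rw [abs_mul, abs_of_nonneg (mul_nonneg (cellMass_nonneg _ _ _) (by positivity))]
  have hca : ∀ p : Polynomial ℝ, IntervalIntegrable (fun x => |p.eval x|) volume 0 1 :=
    fun p => p.continuous.abs.intervalIntegrable _ _
  refine (intervalIntegral.integral_mono_on zero_le_one (hca _)
    (Continuous.intervalIntegrable (by fun_prop) _ _) h1).trans ?_
  rw [intervalIntegral.integral_finsetSum fun i _ => (hca _).const_mul _]
  calc _ ≤ ∑ i ∈ Finset.range (m + 1), cellMass m G i * (m + 1) * 2 := by
        refine Finset.sum_le_sum fun i _ => ?_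
        rw [intervalIntegral.integral_const_mul]
        exact mul_le_mul_of_nonneg_left (integral_abs_derivative_bernstein_le m i)
          (mul_nonneg (cellMass_nonneg _ _ _) (by positivity))
    _ = (∑ i ∈ Finset.range (m + 1), cellMass m G i) * (2 * (m + 1)) := by
        rw [Finset.sum_mul]
        exact Finset.sum_congr rfl fun i _ => by ring
    _ ≤ 1 * (2 * (m + 1)) := by
        gcongr
        exact sum_cellMass_le_one m hG
    _ = _ := one_mul _

end Bernstein

/-! ### Riemann sums at the Fourier frequencies -/

section Riemann

/-- Although interior Fourier frequencies occur twice, row `i` can be assigned to cell `i` of the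
partition of `[0,π]` into `n` equal cells. Sums over rows are therefore Riemann sums. -/
lemma rowFreq_mem_Icc {n : ℕ} (i : Fin n) :
    rowFreq n i ∈ Set.Icc (Real.pi * ((i : ℕ) : ℝ) / n) (Real.pi * ((((i : ℕ) + 1 : ℕ)) : ℝ) / n) := by
  have hpi := Real.pi_pos
  have hn : (0 : ℝ) < n := by
    have := i.isLt
    exact_mod_cast (by omega : 0 < n)
  have h1 : ((i : ℕ) : ℝ) ≤ 2 * ((((i : ℕ) + 1) / 2 : ℕ) : ℝ) := by
    exact_mod_cast (by omega : (i : ℕ) ≤ 2 * (((i : ℕ) + 1) / 2))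
  have h2 : 2 * ((((i : ℕ) + 1) / 2 : ℕ) : ℝ) ≤ (((i : ℕ) + 1 : ℕ) : ℝ) := by
    exact_mod_cast (by omega : 2 * (((i : ℕ) + 1) / 2) ≤ (i : ℕ) + 1)
  have h3 : rowFreq n i = Real.pi * (2 * ((((i : ℕ) + 1) / 2 : ℕ) : ℝ)) / n := by
    rw [rowFreq]; ring
  rw [h3]
  constructor <;> gcongr

lemma rowFreq_mem {n : ℕ} (i : Fin n) : rowFreq n i ∈ Set.Icc 0 Real.pi := by
  have hpi := Real.pi_pos
  have hn : (0 : ℝ) < n := by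
    have := i.isLt
    exact_mod_cast (by omega : 0 < n)
  have h := rowFreq_mem_Icc i
  refine ⟨le_trans (by positivity) h.1, h.2.trans ?_⟩
  rw [div_le_iff₀ hn]
  have : (((i : ℕ) + 1 : ℕ) : ℝ) ≤ n := by exact_mod_cast i.isLt
  gcongr

/-- If `c` has mass at most that of `c₀` and is `L¹`-far from it, then `c` is well below `c₀` at a
positive fraction of the Fourier frequencies, provided that `c` oscillates little at scale
`1/n`. -/
lemma card_below_ge {n : ℕ} (hn : n ≠ 0) {c c₀ c' : ℝ → ℝ} {ε B₀ w V : ℝ} (hε : 0 < ε)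
    (hB₀ : 0 < B₀) (hc₀ : ContinuousOn c₀ (Set.Icc 0 Real.pi))
    (hc₀B : ∀ l ∈ Set.Icc 0 Real.pi, c₀ l ≤ B₀) (hc₀0 : ∀ l ∈ Set.Icc 0 Real.pi, 0 ≤ c₀ l)
    (hc : ∀ l, HasDerivAt c (c' l) l) (hc'c : Continuous c')
    (hcnn : ∀ l ∈ Set.Icc 0 Real.pi, 0 ≤ c l)
    (hmass : ∫ l in (0 : ℝ)..Real.pi, c l ≤ ∫ l in (0 : ℝ)..Real.pi, c₀ l)
    (hfar : ε < l1Dist c c₀)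
    (hw : ∀ x ∈ Set.Icc 0 Real.pi, ∀ y ∈ Set.Icc 0 Real.pi, |x - y| ≤ Real.pi / n →
      |c₀ x - c₀ y| ≤ w) (hw' : Real.pi * w ≤ ε / 8)
    (hV : ∫ l in (0 : ℝ)..Real.pi, |c' l| ≤ V) (hV' : Real.pi / n * V ≤ ε / 8) :
    ε / (8 * Real.pi * B₀) * n ≤ ((Finset.univ.filter fun i : Fin n =>
      c (rowFreq n i) ≤ (1 - ε / (8 * Real.pi * B₀)) * c₀ (rowFreq n i)).card : ℝ) := by
  have hpi := Real.pi_pos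
  have hnr : (0 : ℝ) < n := by positivity
  have hcc : Continuous c := continuous_iff_continuousAt.mpr fun l => (hc l).continuousAt
  set g : ℝ → ℝ := fun l => max (c₀ l - c l) 0 with hg
  have hgc : ContinuousOn g (Set.Icc 0 Real.pi) := by
    refine ContinuousOn.sup (hc₀.sub hcc.continuousOn) continuousOn_const
  have hii : ∀ {u : ℝ → ℝ}, ContinuousOn u (Set.Icc 0 Real.pi) →
      IntervalIntegrable u volume 0 Real.pi := fun hu =>
    ContinuousOn.intervalIntegrable (by rwa [Set.uIcc_of_le hpi.le])
  -- The positive part is `(|c - c₀| + (c₀ - c)) / 2`, and the mass condition makes the second term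
  -- contribute nonnegatively.
  have hgint : ε / 2 ≤ ∫ l in (0 : ℝ)..Real.pi, g l := by
    have h1 : ∀ l, g l = (|c l - c₀ l| + (c₀ l - c l)) / 2 := by
      intro l
      simp only [hg]
      rcases le_total (c₀ l) (c l) with h | h
      · rw [max_eq_right (by linarith), abs_of_nonneg (by linarith)]; ring
      · rw [max_eq_left (by linarith), abs_of_nonpos (by linarith)]; ring
    simp_rw [h1]
    rw [intervalIntegral.integral_div, intervalIntegral.integral_add
      (by exact hii (hcc.continuousOn.sub hc₀).abs) (by exact hii (hc₀.sub hcc.continuousOn)),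
      intervalIntegral.integral_sub (hii hc₀) (hii hcc.continuousOn)]
    have : ε < ∫ l in (0 : ℝ)..Real.pi, |c l - c₀ l| := hfar
    linarith
  set a : ℕ → ℝ := fun i => Real.pi * (i : ℝ) / n with ha
  have ha0 : a 0 = 0 := by simp [ha]
  have han : a n = Real.pi := by simp only [ha]; field_simp
  have hamono : ∀ i, a i ≤ a (i + 1) := fun i => by
    simp only [ha]; gcongr; simp
  have hadiff : ∀ i, a (i + 1) - a i = Real.pi / n := fun i => by
    simp only [ha]; push_cast; field_simp; ring
  have hsub : ∀ i < n, Set.Icc (a i) (a (i + 1)) ⊆ Set.Icc 0 Real.pi := by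
    intro i hi x hx
    refine ⟨le_trans (by simp only [ha]; positivity) hx.1, hx.2.trans ?_⟩
    simp only [ha]
    rw [div_le_iff₀ hnr]
    gcongr
    exact_mod_cast hi
  have hsplit : ∀ {u : ℝ → ℝ}, ContinuousOn u (Set.Icc 0 Real.pi) →
      ∑ i : Fin n, ∫ l in a i..a ((i : ℕ) + 1), u l = ∫ l in (0 : ℝ)..Real.pi, u l := by
    intro u hu
    rw [Fin.sum_univ_eq_sum_range (fun i : ℕ => ∫ l in a i..a (i + 1), u l),
      intervalIntegral.sum_integral_adjacent_intervals, ha0, han]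
    intro i hi
    exact (hu.mono (by rw [Set.uIcc_of_le (hamono i)]; exact hsub i hi)).intervalIntegrable
  have hcell : ∀ i : Fin n, ∫ l in a i..a ((i : ℕ) + 1), g l ≤
      Real.pi / n * (g (rowFreq n i) + w + ∫ l in a i..a ((i : ℕ) + 1), |c' l|) := by
    intro i
    have hrow : rowFreq n i ∈ Set.Icc (a i) (a ((i : ℕ) + 1)) := rowFreq_mem_Icc i
    -- Within a cell, `c₀` moves by at most `w` and `c` by at most its own variation there; summed
    -- over cells the latter add up to `V`.
    have hosc : ∀ l ∈ Set.Icc (a i) (a ((i : ℕ) + 1)), g l ≤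
        g (rowFreq n i) + w + ∫ l in a i..a ((i : ℕ) + 1), |c' l| := by
      intro l hl
      have h1 : |c₀ l - c₀ (rowFreq n i)| ≤ w := by
        refine hw l (hsub i i.isLt hl) _ (rowFreq_mem i) ?_
        rw [← hadiff i, abs_le]
        constructor <;> linarith [hl.1, hl.2, hrow.1, hrow.2]
      have h2 : |c (rowFreq n i) - c l| ≤ ∫ l in a i..a ((i : ℕ) + 1), |c' l| := by
        rw [← intervalIntegral.integral_eq_sub_of_hasDerivAt (fun x _ => hc x)
          (hc'c.intervalIntegrable _ _)]
        have h0 := intervalIntegral.norm_integral_le_integral_norm_uIoc (f := c')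
          (a := l) (b := rowFreq n i) (μ := volume)
        rw [intervalIntegral.integral_of_le (hamono i)]
        refine h0.trans (setIntegral_mono_set ?_ (ae_of_all _ fun x => abs_nonneg _) ?_)
        · exact (hc'c.abs.integrableOn_Icc).mono_set Set.Ioc_subset_Icc_self
        · exact (Set.Ioc_subset_Ioc (le_min hl.1 hrow.1) (max_le hl.2 hrow.2)).eventuallyLE
      have h3 : g l - g (rowFreq n i) ≤
          |(c₀ l - c l) - (c₀ (rowFreq n i) - c (rowFreq n i))| := by
        refine (le_abs_self _).trans ?_
        exact abs_max_sub_max_le_abs _ _ _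
      have h4 : |(c₀ l - c l) - (c₀ (rowFreq n i) - c (rowFreq n i))| ≤
          |c₀ l - c₀ (rowFreq n i)| + |c (rowFreq n i) - c l| := by
        refine (le_of_eq ?_).trans (abs_add_le _ _)
        congr 1; ring
      linarith
    have h5 := intervalIntegral.integral_mono_on (hamono i)
      ((hgc.mono (by rw [Set.uIcc_of_le (hamono i)]; exact hsub i i.isLt)).intervalIntegrable)
      (intervalIntegrable_const (μ := volume)) hosc
    rw [intervalIntegral.integral_const, hadiff, smul_eq_mul] at h5
    exact h5
  set J := Finset.univ.filter fun i : Fin n =>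
      c (rowFreq n i) ≤ (1 - ε / (8 * Real.pi * B₀)) * c₀ (rowFreq n i) with hJ
  set κ := ε / (8 * Real.pi * B₀) with hκ
  have hκ0 : 0 < κ := by positivity
  -- On `J` the deficit is at most `B₀`; off `J` it is at most `κ c₀ ≤ κ B₀`.
  have hsumg : ∑ i : Fin n, g (rowFreq n i) ≤ J.card * B₀ + n * (κ * B₀) := by
    have hpt : ∀ i : Fin n, g (rowFreq n i) ≤ (if c (rowFreq n i) ≤ (1 - κ) * c₀ (rowFreq n i)
        then B₀ else 0) + κ * B₀ := by
      intro i
      have hm := rowFreq_mem i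
      have h1 := hc₀B _ hm
      have h2 := hcnn _ hm
      have h3 := hc₀0 _ hm
      have h4 : κ * c₀ (rowFreq n i) ≤ κ * B₀ := by gcongr
      have h5 : 0 ≤ κ * B₀ := by positivity
      simp only [hg]
      split_ifs with h
      · refine max_le ?_ ?_ <;> linarith
      · push Not at h
        refine max_le ?_ ?_ <;> linarith
    refine (Finset.sum_le_sum fun i _ => hpt i).trans (le_of_eq ?_)
    rw [Finset.sum_add_distrib, ← Finset.sum_filter, Finset.sum_const, Finset.sum_const]
    simp [hJ]
  have htot : ∫ l in (0 : ℝ)..Real.pi, g l ≤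
      Real.pi / n * (J.card * B₀ + n * (κ * B₀) + n * w + V) := by
    rw [← hsplit hgc]
    refine (Finset.sum_le_sum fun i _ => hcell i).trans ?_
    rw [← Finset.mul_sum, Finset.sum_add_distrib, Finset.sum_add_distrib,
      hsplit hc'c.abs.continuousOn, Finset.sum_const]
    simp only [Finset.card_univ, Fintype.card_fin, nsmul_eq_mul]
    gcongr
  have h6 : Real.pi / n * (J.card * B₀ + n * (κ * B₀) + n * w + V) =
      Real.pi * B₀ * (J.card / n) + Real.pi * B₀ * κ + Real.pi * w + Real.pi / n * V := by
    field_simp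
  -- Of the total `ε/2`, the small deficits, the modulus of `c₀` and the variation of `c` use at
  -- most `ε/8` each; the rest must come from `J`.
  have h7 : Real.pi * B₀ * κ = ε / 8 := by rw [hκ]; field_simp
  have h8 : Real.pi * B₀ * κ ≤ Real.pi * B₀ * (J.card / n) := by linarith
  have h9 : κ ≤ J.card / n := le_of_mul_le_mul_left h8 (by positivity)
  rwa [le_div_iff₀ hnr] at h9

end Riemann

/-! ### Sublevel patterns of a finite-dimensional space of functions -/

section SublevelPatterns

/-- A set shattered by the sublevel sets `{g ≤ h}`, `g ∈ V`, has at most `dim V` elements. -/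
lemma card_le_finrank_of_shatters {ι : Type*} [Fintype ι] [DecidableEq ι]
    (V : Submodule ℝ (ι → ℝ)) (h : ι → ℝ)
    {𝒥 : Finset (Finset ι)}
    (h𝒥 : ∀ J ∈ 𝒥, ∃ g ∈ V, J = Finset.univ.filter fun i => g i ≤ h i) {s : Finset ι}
    (hs : 𝒥.Shatters s) : s.card ≤ Module.finrank ℝ V := by
  classical
  by_contra! hlt
  let R : (ι → ℝ) →ₗ[ℝ] (s → ℝ) := LinearMap.funLeft ℝ ℝ Subtype.val
  -- If `s` had more than `dim V` points, restriction to `s` would map `V` to a proper subspace,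
  -- annihilated by some nonzero functional with coefficients `a`.
  have hW : V.map R < ⊤ := by
    refine lt_top_iff_ne_top.mpr fun htop => ?_
    have h1 : Module.finrank ℝ (V.map R) ≤ Module.finrank ℝ V := Submodule.finrank_map_le R V
    rw [htop, finrank_top, Module.finrank_fintype_fun_eq_card, Fintype.card_coe] at h1
    omega
  obtain ⟨f, hf0, hf⟩ := Submodule.exists_le_ker_of_lt_top _ hW
  set a : s → ℝ := fun i => f (Pi.single i 1) with ha
  have hfa : ∀ x : s → ℝ, f x = ∑ i, x i * a i := by
    intro x
    rw [LinearMap.pi_apply_eq_sum_univ f x]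
    refine Finset.sum_congr rfl fun i _ => ?_
    rw [smul_eq_mul, ha]
    congr 2
    funext j
    simp [Pi.single_apply, eq_comm]
  have hker : ∀ g ∈ V, ∑ i : s, g i * a i = 0 := by
    intro g hg
    have := hf (Submodule.mem_map_of_mem (f := R) hg)
    rw [LinearMap.mem_ker, hfa] at this
    exact this
  have hsep : ∀ t ⊆ s, ∃ g ∈ V, ∀ i : s, (g i ≤ h i ↔ (i : ι) ∈ t) := by
    intro t ht
    obtain ⟨J, hJ, hst⟩ := hs ht
    obtain ⟨g, hg, hJg⟩ := h𝒥 J hJ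
    refine ⟨g, hg, fun i => ?_⟩
    rw [← hst, Finset.mem_inter, hJg]
    simp [i.2]
  -- Shattering realizes the sign patterns of `a`: `g₁ ≤ h` exactly where `a ≤ 0`, and `g₂ ≤ h`
  -- exactly where `a ≥ 0`.
  obtain ⟨g₁, hg₁, h₁⟩ := hsep (s.filter fun i => ∃ hi : i ∈ s, a ⟨i, hi⟩ ≤ 0)
    (Finset.filter_subset _ _)
  obtain ⟨g₂, hg₂, h₂⟩ := hsep (s.filter fun i => ∃ hi : i ∈ s, 0 ≤ a ⟨i, hi⟩)
    (Finset.filter_subset _ _)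
  have h₁' : ∀ i : s, g₁ i ≤ h i ↔ a i ≤ 0 := fun i => by
    rw [h₁ i]; simp
  have h₂' : ∀ i : s, g₂ i ≤ h i ↔ 0 ≤ a i := fun i => by
    rw [h₂ i]; simp
  have hpos : ∀ i : s, 0 ≤ (g₁ i - h i) * a i := fun i => by
    by_cases hc : a i ≤ 0
    · exact mul_nonneg_of_nonpos_of_nonpos (by linarith [(h₁' i).mpr hc]) hc
    · push Not at hc
      refine mul_nonneg ?_ hc.le
      by_contra! hneg
      exact absurd ((h₁' i).mp (by linarith)) (by linarith)
  have hneg : ∀ i : s, (g₂ i - h i) * a i ≤ 0 := fun i => by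
    by_cases hc : 0 ≤ a i
    · exact mul_nonpos_of_nonpos_of_nonneg (by linarith [(h₂' i).mpr hc]) hc
    · push Not at hc
      refine mul_nonpos_of_nonneg_of_nonpos ?_ hc.le
      by_contra! hneg
      exact absurd ((h₂' i).mp (by linarith)) (by linarith)
  -- Both `g₁` and `g₂` are orthogonal to `a`, so the sum of the nonnegative `(g₁ - h) a` equals
  -- that of the nonpositive `(g₂ - h) a`, and every term is zero. Where `a ≠ 0` this gives `g₁ = h
  -- = g₂`, so that `a ≤ 0` and `a ≥ 0`, a contradiction.
  have hdiff : ∑ i : s, ((g₁ i - h i) * a i - (g₂ i - h i) * a i) = 0 := by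
    have : ∀ i : s, (g₁ i - h i) * a i - (g₂ i - h i) * a i = g₁ i * a i - g₂ i * a i := by
      intro i; ring
    simp_rw [this]
    rw [Finset.sum_sub_distrib, hker _ hg₁, hker _ hg₂, sub_zero]
  have hzero := (Finset.sum_eq_zero_iff_of_nonneg fun i _ => by
    linarith [hpos i, hneg i]).mp hdiff
  have ha0 : ∀ i, a i = 0 := by
    intro i
    have hz := hzero i (Finset.mem_univ i)
    have e1 : (g₁ i - h i) * a i = 0 := by linarith [hpos i, hneg i]
    have e2 : (g₂ i - h i) * a i = 0 := by linarith [hpos i, hneg i]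
    by_contra hne
    rcases mul_eq_zero.mp e1 with e1 | e1
    · rcases mul_eq_zero.mp e2 with e2 | e2
      · exact hne (le_antisymm ((h₁' i).mp (by linarith)) ((h₂' i).mp (by linarith)))
      · exact hne e2
    · exact hne e1
  apply hf0
  ext i
  simpa [ha] using ha0 i

lemma sum_choose_le_pow (n k d : ℕ) (hd : d ≤ k) :
    ∑ i ∈ Finset.Iic d, n.choose i ≤ (n + 1) ^ k := by
  calc _ ≤ ∑ i ∈ Finset.range (k + 1), n.choose i := by
        refine Finset.sum_le_sum_of_subset fun i hi => ?_
        simp at hi ⊢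
        omega
    _ ≤ ∑ i ∈ Finset.range (k + 1), n ^ i * 1 ^ (k - i) * k.choose i := by
        refine Finset.sum_le_sum fun i hi => ?_
        rw [one_pow, mul_one]
        calc n.choose i ≤ n ^ i := Nat.choose_le_pow n i
          _ ≤ _ := Nat.le_mul_of_pos_right _ (Nat.choose_pos (by simp at hi; omega))
    _ = _ := (add_pow n 1 k).symm

/-- The polynomials of degree less than `k` have at most `(n + 1) ^ k` sublevel patterns on `n`
points. -/
lemma exists_sublevel_patterns {n : ℕ} (k : ℕ) (x h : Fin n → ℝ) :
    ∃ 𝒥 : Finset (Finset (Fin n)), 𝒥.card ≤ (n + 1) ^ k ∧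
      ∀ q : Polynomial ℝ, q.degree < k →
        (Finset.univ.filter fun i => q.eval (x i) ≤ h i) ∈ 𝒥 := by
  classical
  let ev : Polynomial ℝ →ₗ[ℝ] (Fin n → ℝ) := LinearMap.pi fun i => Polynomial.leval (x i)
  let V : Submodule ℝ (Fin n → ℝ) := (Polynomial.degreeLT ℝ k).map ev
  have hV : Module.finrank ℝ V ≤ k := by
    have : Module.Finite ℝ (Polynomial.degreeLT ℝ k) :=
      Module.Finite.equiv (Polynomial.degreeLTEquiv ℝ k).symm
    refine (Submodule.finrank_map_le ev _).trans ?_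
    rw [(Polynomial.degreeLTEquiv ℝ k).finrank_eq]
    simp
  let 𝒥 : Finset (Finset (Fin n)) :=
    Finset.univ.filter fun J => ∃ g ∈ V, J = Finset.univ.filter fun i => g i ≤ h i
  have h𝒥 : ∀ J ∈ 𝒥, ∃ g ∈ V, J = Finset.univ.filter fun i => g i ≤ h i := fun J hJ =>
    (Finset.mem_filter.mp hJ).2
  refine ⟨𝒥, ?_, fun q hq => ?_⟩
  -- Sauer–Shelah: a family has at most as many members as it shatters sets, and shattered sets have
  -- at most `k` elements.
  · refine (Finset.card_le_card_shatterer 𝒥).trans (Finset.card_shatterer_le_sum_vcDim.trans ?_)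
    rw [Fintype.card_fin]
    refine sum_choose_le_pow n k _ (Finset.sup_le fun s hs => ?_)
    exact (card_le_finrank_of_shatters V h h𝒥 (Finset.mem_shatterer.mp hs)).trans hV
  · exact Finset.mem_filter.mpr ⟨Finset.mem_univ _, ev q,
      Submodule.mem_map_of_mem (Polynomial.mem_degreeLT.mpr hq), rfl⟩

end SublevelPatterns

/-! ### The Dirichlet process -/

section Dirichlet

lemma gammaMeasure_pos_of_isOpen {a : ℝ} (ha : 0 < a) {s : Set ℝ} (hs : IsOpen s)
    {x : ℝ} (hx : x ∈ s) (hx0 : 0 < x) : 0 < gammaMeasure a 1 s := by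
  rw [pos_iff_ne_zero]
  intro h0
  have hopen : IsOpen (s ∩ Set.Ioi 0) := hs.inter isOpen_Ioi
  have h1 : gammaMeasure a 1 (s ∩ Set.Ioi 0) = 0 := measure_mono_null Set.inter_subset_left h0
  rw [gammaMeasure, withDensity_apply _ hopen.measurableSet,
    setLIntegral_eq_zero_iff hopen.measurableSet
      (by exact (measurable_gammaPDFReal a 1).ennreal_ofReal)] at h1
  have h2 : volume (s ∩ Set.Ioi 0) = 0 := by
    refine measure_mono_null (t := {y | ¬ (y ∈ s ∩ Set.Ioi 0 → gammaPDF a 1 y = 0)}) ?_ h1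
    intro y hy
    simp only [Set.mem_ofPred_eq, Classical.not_imp]
    refine ⟨hy, ?_⟩
    rw [gammaPDF, ENNReal.ofReal_eq_zero, not_le]
    exact gammaPDFReal_pos ha one_pos hy.2
  exact (hopen.measure_pos volume ⟨x, hx, hx0⟩).ne' h2

lemma isProbabilityMeasure_gammaLaw {a : ℝ} (ha : 0 ≤ a) : IsProbabilityMeasure (gammaLaw a) := by
  unfold gammaLaw
  split_ifs with h
  · infer_instance
  · exact isProbabilityMeasure_gammaMeasure (lt_of_le_of_ne ha (Ne.symm h)) one_pos

lemma measurable_normalize (m : ℕ) :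
    Measurable fun (x : Fin m → ℝ) (i : Fin m) => x i / ∑ j, x j := by
  fun_prop

/-- Neighbourhoods of the relevant faces of the simplex have positive Dirichlet mass. -/
lemma dirichletLaw_pos {m : ℕ} {a w : Fin m → ℝ} (ha : ∀ i, 0 ≤ a i)
    (hw0 : ∀ i, a i = 0 → w i = 0) (hwpos : ∀ i, a i ≠ 0 → 0 < w i) (hw1 : ∑ i, w i = 1)
    {ξ : ℝ} (hξ : 0 < ξ) :
    0 < dirichletLaw a {y | ∀ i, |y i - w i| < ξ} := by
  have hprob : ∀ i, IsProbabilityMeasure (gammaLaw (a i)) :=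
    fun i => isProbabilityMeasure_gammaLaw (ha i)
  have hmeas : MeasurableSet {y : Fin m → ℝ | ∀ i, |y i - w i| < ξ} := by
    rw [Set.ofPred_forall]
    refine MeasurableSet.iInter fun i => ?_
    exact measurableSet_lt (by fun_prop) measurable_const
  rw [dirichletLaw, Measure.map_apply (measurable_normalize m) hmeas]
  -- Normalization is continuous at `w` and fixes it, since its coordinates sum to one. It thus
  -- suffices that small boxes around `w` have positive product mass; in a coordinate with parameter
  -- `0` the atom at `0` is the centre of the box.
  have hev : ∀ᶠ x in 𝓝 w, ∀ i, |x i / ∑ j, x j - w i| < ξ := by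
    rw [eventually_all]
    intro i
    have hcont : ContinuousAt (fun x : Fin m → ℝ => |x i / ∑ j, x j - w i|) w := by
      refine ContinuousAt.abs (ContinuousAt.sub (ContinuousAt.div ?_ ?_ ?_) continuousAt_const)
      · exact continuousAt_apply i w
      · exact (continuous_finsetSum _ fun j _ => continuous_apply j).continuousAt
      · rw [hw1]; exact one_ne_zero
    refine hcont.eventually_lt continuousAt_const ?_
    simpa [hw1] using hξ
  obtain ⟨ρ, hρ, hball⟩ := Metric.eventually_nhds_iff_ball.mp hev
  refine lt_of_lt_of_le ?_ (measure_mono (fun x hx => hball x hx))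
  rw [ball_pi _ hρ, Measure.pi_pi, pos_iff_ne_zero, Finset.prod_ne_zero_iff]
  intro i _
  by_cases hi : a i = 0
  · rw [gammaLaw, if_pos hi, hw0 i hi, Measure.dirac_apply' _ measurableSet_ball]
    simp [hρ]
  · rw [gammaLaw, if_neg hi]
    exact (gammaMeasure_pos_of_isOpen (lt_of_le_of_ne (ha i) (Ne.symm hi)) Metric.isOpen_ball
      (Metric.mem_ball_self hρ) (hwpos i hi)).ne'

variable {g₀ : ℝ → ℝ} {M : ℝ} {D : Measure (Measure ℝ)}

lemma baseMeasure_bounds {a A : ℝ} (hg : ∀ x ∈ Set.Ioo (0 : ℝ) 1, a ≤ g₀ x ∧ g₀ x ≤ A)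
    {s : Set ℝ} (hs : MeasurableSet s) :
    ENNReal.ofReal a * volume (s ∩ Set.Icc 0 1) ≤ baseMeasure g₀ s ∧
      baseMeasure g₀ s ≤ ENNReal.ofReal A * volume (s ∩ Set.Icc 0 1) := by
  have hae : ∀ᵐ x ∂((volume.restrict (Set.Icc (0 : ℝ) 1)).restrict s), x ∈ Set.Ioo (0 : ℝ) 1 := by
    refine ae_restrict_of_ae ?_
    rw [← restrict_Ioo_eq_restrict_Icc]
    exact ae_restrict_mem measurableSet_Ioo
  rw [baseMeasure, withDensity_apply _ hs]
  have hc : ∀ r : ℝ, ENNReal.ofReal r * volume (s ∩ Set.Icc 0 1) =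
      ∫⁻ _ in s, ENNReal.ofReal r ∂(volume.restrict (Set.Icc (0 : ℝ) 1)) := by
    intro r
    rw [setLIntegral_const, Measure.restrict_apply hs]
  rw [hc, hc]
  constructor <;> refine lintegral_mono_ae ?_ <;> filter_upwards [hae] with x hx
  · exact ENNReal.ofReal_le_ofReal (hg x hx).1
  · exact ENNReal.ofReal_le_ofReal (hg x hx).2

lemma toReal_base_pos {a A : ℝ} (ha : 0 < a)
    (hg : ∀ x ∈ Set.Ioo (0 : ℝ) 1, a ≤ g₀ x ∧ g₀ x ≤ A) (hM : 0 < M)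
    {s : Set ℝ} (hs : MeasurableSet s) (hpos : volume (s ∩ Set.Icc 0 1) ≠ 0) :
    0 < ((ENNReal.ofReal M • baseMeasure g₀) s).toReal := by
  obtain ⟨h1, h2⟩ := baseMeasure_bounds hg hs
  have hfin : volume (s ∩ Set.Icc (0 : ℝ) 1) ≠ ⊤ :=
    ((measure_mono Set.inter_subset_right).trans_lt (by simp : volume (Set.Icc (0 : ℝ) 1) < ⊤)).ne
  refine ENNReal.toReal_pos ?_ ?_
  · rw [Measure.smul_apply, smul_eq_mul]
    refine mul_ne_zero (by simpa using hM) ?_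
    intro h0
    rw [h0, nonpos_iff_eq_zero, mul_eq_zero] at h1
    rcases h1 with h1 | h1
    · simp at h1; linarith
    · exact hpos h1
  · rw [Measure.smul_apply, smul_eq_mul]
    exact ENNReal.mul_ne_top ENNReal.ofReal_ne_top
      (h2.trans_lt (ENNReal.mul_lt_top ENNReal.ofReal_lt_top hfin.lt_top)).ne

lemma measurable_eval_toReal {s : Set ℝ} (hs : MeasurableSet s) :
    Measurable fun G : Measure ℝ => (G s).toReal :=
  (Measure.measurable_coe hs).ennreal_toReal

/-- A Dirichlet process is almost surely a probability measure. -/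
lemma ae_univ_le_one {a A : ℝ} (ha : 0 < a)
    (hg : ∀ x ∈ Set.Ioo (0 : ℝ) 1, a ≤ g₀ x ∧ g₀ x ≤ A) (hM : 0 < M)
    (hD : IsDirichletProcess D (ENNReal.ofReal M • baseMeasure g₀)) :
    ∀ᵐ G ∂D, G Set.univ ≤ 1 := by
  have h := hD.2 1 (fun _ => Set.univ) (fun _ => MeasurableSet.univ)
    (fun i j hij => absurd (Subsingleton.elim i j) hij) (Set.iUnion_const _)
  set b : ℝ := ((ENNReal.ofReal M • baseMeasure g₀) Set.univ).toReal with hb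
  have hbpos : 0 < b := toReal_base_pos ha hg hM MeasurableSet.univ (by
    rw [Set.univ_inter, Real.volume_Icc]; simp)
  have hprob := isProbabilityMeasure_gammaLaw hbpos.le
  have hm : Measurable fun (G : Measure ℝ) (_ : Fin 1) => (G Set.univ).toReal :=
    measurable_pi_lambda _ fun _ => measurable_eval_toReal MeasurableSet.univ
  have hset : MeasurableSet {y : Fin 1 → ℝ | y 0 = 1} :=
    measurableSet_eq_fun (measurable_pi_apply 0) measurable_const
  have h1 : ∀ᵐ y ∂(dirichletLaw fun _ : Fin 1 => b), y 0 = 1 := by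
    rw [dirichletLaw, ae_map_iff (measurable_normalize 1).aemeasurable hset]
    have h2 : ∀ᵐ t ∂(gammaLaw b), t ≠ 0 := by
      rw [gammaLaw, if_neg hbpos.ne', gammaMeasure]
      refine (withDensity_absolutelyContinuous _ _).ae_le ?_
      exact Measure.ae_ne volume 0
    have h3 : ∀ᵐ x : Fin 1 → ℝ ∂(Measure.pi fun _ => gammaLaw b), x 0 ≠ 0 :=
      (Measure.quasiMeasurePreserving_eval (fun _ : Fin 1 => gammaLaw b) 0).ae h2
    filter_upwards [h3] with x hx
    simp [hx]
  rw [← h, ae_map_iff hm.aemeasurable hset] at h1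
  filter_upwards [h1] with G hG
  -- Infinite mass is excluded because `toReal` sends it to `0`, not `1`.
  have hne : G Set.univ ≠ ⊤ := by
    intro htop
    rw [htop] at hG
    simp at hG
  rw [← ENNReal.ofReal_toReal hne, hG, ENNReal.ofReal_one]

/-- The partition of the line into the cells `(i/(m+1), (i+1)/(m+1)]` and the rest. -/
def cellPartition (m : ℕ) : Fin (m + 2) → Set ℝ :=
  Fin.cons (Set.Ioc 0 1)ᶜ fun i : Fin (m + 1) =>
    Set.Ioc (((i : ℕ) : ℝ) / ((m + 1 : ℕ) : ℝ)) ((((i : ℕ) : ℝ) + 1) / ((m + 1 : ℕ) : ℝ))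

lemma cell_subset (m : ℕ) (i : Fin (m + 1)) :
    Set.Ioc (((i : ℕ) : ℝ) / ((m + 1 : ℕ) : ℝ)) ((((i : ℕ) : ℝ) + 1) / ((m + 1 : ℕ) : ℝ)) ⊆
      Set.Ioc 0 1 := by
  have hm : (0 : ℝ) < ((m + 1 : ℕ) : ℝ) := by positivity
  refine Set.Ioc_subset_Ioc (by positivity) ?_
  rw [div_le_one hm]
  exact_mod_cast i.isLt

lemma cellPartition_disjoint (m : ℕ) :
    Pairwise (Function.onFun Disjoint (cellPartition m)) := by
  have hm : (0 : ℝ) < ((m + 1 : ℕ) : ℝ) := by positivity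
  have h0 : ∀ i : Fin (m + 1), Disjoint (cellPartition m 0) (cellPartition m i.succ) := by
    intro i
    simp only [cellPartition, Fin.cons_zero, Fin.cons_succ]
    exact Set.disjoint_left.mpr fun x hx hx' => hx (cell_subset m i hx')
  intro i j hij
  simp only [Function.onFun]
  induction i using Fin.cases with
  | zero =>
    induction j using Fin.cases with
    | zero => exact absurd rfl hij
    | succ j => exact h0 j
  | succ i =>
    induction j using Fin.cases with
    | zero => exact (h0 i).symm
    | succ j =>
      simp only [cellPartition, Fin.cons_succ]
      rw [Set.disjoint_left]
      rintro x ⟨h1, h2⟩ ⟨h3, h4⟩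
      rw [div_lt_iff₀ hm] at h1 h3
      rw [le_div_iff₀ hm] at h2 h4
      have ha : ((i : ℕ) : ℝ) < ((j : ℕ) : ℝ) + 1 := by linarith
      have hb : ((j : ℕ) : ℝ) < ((i : ℕ) : ℝ) + 1 := by linarith
      have ha' : (i : ℕ) < (j : ℕ) + 1 := by exact_mod_cast ha
      have hb' : (j : ℕ) < (i : ℕ) + 1 := by exact_mod_cast hb
      exact hij (by rw [Fin.succ_inj]; exact Fin.ext (by omega))

lemma iUnion_cellPartition (m : ℕ) : (⋃ i, cellPartition m i) = Set.univ := by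
  have hm : (0 : ℝ) < ((m + 1 : ℕ) : ℝ) := by positivity
  refine Set.eq_univ_of_forall fun x => ?_
  rw [Set.mem_iUnion]
  by_cases hx : x ∈ Set.Ioc (0 : ℝ) 1
  · set t := x * ((m + 1 : ℕ) : ℝ) with ht
    have ht0 : 0 < t := mul_pos hx.1 hm
    have ht1 : t ≤ ((m + 1 : ℕ) : ℝ) := mul_le_of_le_one_left hm.le hx.2
    have hc0 : 0 < ⌈t⌉₊ := Nat.ceil_pos.mpr ht0
    have hc1 : ⌈t⌉₊ ≤ m + 1 := Nat.ceil_le.mpr ht1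
    refine ⟨Fin.succ ⟨⌈t⌉₊ - 1, by omega⟩, ?_⟩
    simp only [cellPartition, Fin.cons_succ]
    have hcast : ((⌈t⌉₊ - 1 : ℕ) : ℝ) = (⌈t⌉₊ : ℝ) - 1 := by
      rw [Nat.cast_sub (by omega)]; simp
    rw [hcast]
    constructor
    · rw [div_lt_iff₀ hm]
      linarith [Nat.ceil_lt_add_one ht0.le]
    · rw [le_div_iff₀ hm]
      linarith [Nat.le_ceil t]
  · exact ⟨0, by simpa [cellPartition] using hx⟩

lemma measurableSet_cellPartition (m : ℕ) (i : Fin (m + 2)) :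
    MeasurableSet (cellPartition m i) := by
  induction i using Fin.cases with
  | zero => exact measurableSet_Ioc.compl
  | succ i => exact measurableSet_Ioc

lemma measurable_cellMass (m i : ℕ) : Measurable fun G : Measure ℝ => cellMass m G i :=
  measurable_eval_toReal measurableSet_Ioc

/-- The cell masses of the Dirichlet process are close to any given positive weights with positive
probability. -/
lemma cellMass_near_pos {a A : ℝ} (ha : 0 < a)
    (hg : ∀ x ∈ Set.Ioo (0 : ℝ) 1, a ≤ g₀ x ∧ g₀ x ≤ A) (hM : 0 < M)
    (hD : IsDirichletProcess D (ENNReal.ofReal M • baseMeasure g₀)) (m : ℕ)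
    {w : Fin (m + 1) → ℝ} (hw : ∀ i, 0 < w i) (hw1 : ∑ i, w i = 1) {ξ : ℝ} (hξ : 0 < ξ) :
    0 < D {G | ∀ i : Fin (m + 1), |cellMass m G i - w i| < ξ} := by
  have h := hD.2 (m + 2) (cellPartition m) (measurableSet_cellPartition m)
    (cellPartition_disjoint m) (iUnion_cellPartition m)
  have hm : (0 : ℝ) < ((m + 1 : ℕ) : ℝ) := by positivity
  set b : Fin (m + 2) → ℝ := fun i =>
    ((ENNReal.ofReal M • baseMeasure g₀) (cellPartition m i)).toReal with hb
  -- The base measure does not charge the complement of `(0,1]`, so this cell has Dirichlet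
  -- parameter `0` and must receive target weight `0`.
  have hb0 : b 0 = 0 := by
    simp only [hb, cellPartition, Fin.cons_zero, Measure.smul_apply, smul_eq_mul]
    have h1 := (baseMeasure_bounds hg (measurableSet_Ioc (a := (0 : ℝ)) (b := 1)).compl).2
    have h2 : (Set.Ioc (0 : ℝ) 1)ᶜ ∩ Set.Icc 0 1 ⊆ {0} := by
      rintro x ⟨h3, h4⟩
      by_contra hx
      exact h3 ⟨lt_of_le_of_ne h4.1 (fun h => hx h.symm), h4.2⟩
    rw [measure_mono_null h2 (by simp), mul_zero, nonpos_iff_eq_zero] at h1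
    simp [h1]
  have hbs : ∀ i : Fin (m + 1), 0 < b i.succ := by
    intro i
    refine toReal_base_pos ha hg hM (measurableSet_cellPartition m _) ?_
    simp only [cellPartition, Fin.cons_succ]
    rw [Set.inter_eq_left.mpr ((cell_subset m i).trans Set.Ioc_subset_Icc_self),
      Real.volume_Ioc]
    simp only [ne_eq, ENNReal.ofReal_eq_zero, not_le, sub_pos]
    gcongr
    linarith
  have hpos := dirichletLaw_pos (a := b) (w := Fin.cons 0 w) (ξ := ξ)
    (fun i => ENNReal.toReal_nonneg)
    (fun i => Fin.cases (fun _ => rfl) (fun i hi => absurd hi (hbs i).ne') i)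
    (fun i => Fin.cases (fun hi => absurd hb0 hi) (fun i _ => by simpa using hw i) i)
    (by rw [Fin.sum_univ_succ]; simpa using hw1) hξ
  rw [← h, Measure.map_apply (measurable_pi_lambda _ fun i =>
    measurable_eval_toReal (measurableSet_cellPartition m i))] at hpos
  · refine hpos.trans_le (measure_mono fun G hG i => ?_)
    have := hG i.succ
    simpa [cellPartition, cellMass] using this
  · rw [Set.ofPred_forall]
    refine MeasurableSet.iInter fun i => ?_
    exact measurableSet_lt (by fun_prop) measurable_const

end Dirichlet

/-! ### Mass of the prior -/

section PriorMass

open scoped unitInterval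

lemma sum_fin_bernstein_eval (m : ℕ) (x : ℝ) :
    ∑ i : Fin (m + 1), (bernsteinPolynomial ℝ m i).eval x = 1 := by
  have := congrArg (Polynomial.eval x) (bernsteinPolynomial.sum ℝ m)
  rw [Polynomial.eval_finsetSum, Polynomial.eval_one] at this
  rw [Fin.sum_univ_eq_sum_range (fun i : ℕ => (bernsteinPolynomial ℝ m i).eval x)]
  exact this

/-- Every positive continuous function is a uniform limit of Bernstein mixtures whose weights are
its normalized cell integrals. -/
lemma exists_weights {h : ℝ → ℝ} (hc : ContinuousOn h (Set.Icc 0 1))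
    (hpos : ∀ x ∈ Set.Icc (0 : ℝ) 1, 0 < h x) {ρ : ℝ} (hρ : 0 < ρ) :
    ∃ (m : ℕ) (w : Fin (m + 1) → ℝ), (∀ i, 0 < w i) ∧ ∑ i, w i = 1 ∧
      ∀ x ∈ Set.Icc (0 : ℝ) 1, |(∫ y in (0 : ℝ)..1, h y) *
        ∑ i : Fin (m + 1), w i * (m + 1) * (bernsteinPolynomial ℝ m i).eval x - h x| ≤ ρ := by
  set τ := ∫ y in (0 : ℝ)..1, h y with hτ
  have hτpos : 0 < τ := by
    refine intervalIntegral.intervalIntegral_pos_of_pos_on ?_ (fun x hx => hpos x ⟨hx.1.le, hx.2.le⟩)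
      zero_lt_one
    exact ContinuousOn.intervalIntegrable (by rwa [Set.uIcc_of_le zero_le_one])
  obtain ⟨δ, hδ, hmod⟩ := Metric.uniformContinuousOn_iff.mp
    (isCompact_Icc.uniformContinuousOn_of_continuous hc) (ρ / 2) (by positivity)
  let f : C(I, ℝ) := ⟨fun x => h x, hc.domRestrict⟩
  have hB := Metric.tendsto_nhds.mp (bernsteinApproximation_uniform f) (ρ / 2) (by positivity)
  have hN : ∀ᶠ m : ℕ in atTop, 1 / ((m : ℝ) + 1) < δ :=
    tendsto_one_div_add_atTop_nhds_zero_nat.eventually (gt_mem_nhds hδ)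
  obtain ⟨m, hBm, hNm, hm1⟩ := (hB.and (hN.and (eventually_ge_atTop 1))).exists
  have hm : (0 : ℝ) < (m : ℝ) + 1 := by positivity
  have hm0 : (0 : ℝ) < (m : ℝ) := by exact_mod_cast hm1
  set a : ℕ → ℝ := fun i => (i : ℝ) / (m + 1) with ha
  have hamono : ∀ i, a i < a (i + 1) := fun i => by
    simp only [ha]; gcongr; simp
  have hsub : ∀ i < m + 1, Set.Icc (a i) (a (i + 1)) ⊆ Set.Icc 0 1 := by
    intro i hi x hx
    refine ⟨le_trans (by simp only [ha]; positivity) hx.1, hx.2.trans ?_⟩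
    simp only [ha]
    rw [div_le_one hm]
    exact_mod_cast hi
  have hii : ∀ i < m + 1, IntervalIntegrable h volume (a i) (a (i + 1)) := fun i hi =>
    (hc.mono (by rw [Set.uIcc_of_le (hamono i).le]; exact hsub i hi)).intervalIntegrable
  refine ⟨m, fun i => (∫ y in a i..a ((i : ℕ) + 1), h y) / τ, fun i => ?_, ?_, fun x hx => ?_⟩
  · refine div_pos ?_ hτpos
    exact intervalIntegral.intervalIntegral_pos_of_pos_on (hii i i.isLt)
      (fun x hx => hpos x (hsub i i.isLt ⟨hx.1.le, hx.2.le⟩)) (hamono i)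
  · rw [← Finset.sum_div, Fin.sum_univ_eq_sum_range (fun i : ℕ => ∫ y in a i..a (i + 1), h y),
      intervalIntegral.sum_integral_adjacent_intervals hii]
    have h0 : a 0 = 0 := by simp [ha]
    have h1 : a (m + 1) = 1 := by simp only [ha]; push_cast; field_simp
    rw [h0, h1, div_self hτpos.ne']
  · have happ := ContinuousMap.dist_lt_iff (by positivity) |>.mp hBm ⟨x, hx⟩
    rw [bernsteinApproximation.apply, Real.dist_eq] at happ
    have hbern : ∀ i : ℕ, bernstein m i ⟨x, hx⟩ = (bernsteinPolynomial ℝ m i).eval x := by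
      intro i
      rw [bernstein_apply]
      simp [bernsteinPolynomial]
    simp only [hbern, smul_eq_mul] at happ
    have hdiff : |τ * ∑ i : Fin (m + 1), (∫ y in a i..a ((i : ℕ) + 1), h y) / τ * (m + 1) *
          (bernsteinPolynomial ℝ m i).eval x -
        ∑ i : Fin (m + 1), (bernsteinPolynomial ℝ m i).eval x * f (bernstein.z i)| ≤ ρ / 2 := by
      rw [Finset.mul_sum, ← Finset.sum_sub_distrib]
      calc _ ≤ ∑ i : Fin (m + 1), (bernsteinPolynomial ℝ m i).eval x * (ρ / 2) := by
            refine (Finset.abs_sum_le_sum_abs _ _).trans (Finset.sum_le_sum fun i _ => ?_)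
            have hb := bernstein_eval_nonneg m i hx
            have e : τ * ((∫ y in a i..a ((i : ℕ) + 1), h y) / τ * (m + 1) *
                (bernsteinPolynomial ℝ m i).eval x) -
                (bernsteinPolynomial ℝ m i).eval x * f (bernstein.z i) =
                (bernsteinPolynomial ℝ m i).eval x * (m + 1) *
                  ∫ y in a i..a ((i : ℕ) + 1), (h y - h ((i : ℕ) / (m : ℝ))) := by
              rw [intervalIntegral.integral_sub (hii i i.isLt) intervalIntegrable_const,
                intervalIntegral.integral_const]
              have : a ((i : ℕ) + 1) - a i = 1 / (m + 1) := by
                simp only [ha]; push_cast; ring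
              rw [this, show f (bernstein.z i) = h ((i : ℕ) / (m : ℝ)) from rfl, smul_eq_mul]
              field_simp
            -- The sampling node `i/m` of the Bernstein operator lies in the `i`-th of the `m + 1`
            -- cells, so replacing `h (i/m)` by the cell average costs at most the modulus of
            -- continuity at scale `1/(m+1)`.
            have hzi : ((i : ℕ) : ℝ) / (m : ℝ) ∈ Set.Icc (a i) (a ((i : ℕ) + 1)) := by
              have hi : ((i : ℕ) : ℝ) ≤ m := by exact_mod_cast Nat.lt_succ_iff.mp i.isLt
              simp only [ha]
              constructor
              · gcongr; linarith
              · rw [div_le_div_iff₀ hm0 hm]; push_cast; nlinarith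
            have hint : |∫ y in a i..a ((i : ℕ) + 1), (h y - h ((i : ℕ) / (m : ℝ)))| ≤
                ρ / 2 * (1 / (m + 1)) := by
              have := intervalIntegral.norm_integral_le_of_norm_le_const (a := a i)
                (b := a ((i : ℕ) + 1)) (f := fun y => h y - h ((i : ℕ) / (m : ℝ)))
                (C := ρ / 2) (fun y hy => by
                  rw [Set.uIoc_of_le (hamono i).le] at hy
                  have hd : dist y ((i : ℕ) / (m : ℝ)) < δ := by
                    have : a ((i : ℕ) + 1) - a i = 1 / (m + 1) := by
                      simp only [ha]; push_cast; ring
                    refine lt_of_le_of_lt ?_ hNm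
                    rw [Real.dist_eq, ← this, abs_le]
                    constructor <;> linarith [hy.1, hy.2, hzi.1, hzi.2]
                  exact (hmod y (hsub i i.isLt ⟨hy.1.le, hy.2⟩) _ (hsub i i.isLt hzi) hd).le)
              have h2 : a ((i : ℕ) + 1) - a i = 1 / (m + 1) := by
                simp only [ha]; push_cast; ring
              rwa [h2, abs_of_pos (by positivity)] at this
            rw [e, abs_mul, abs_of_nonneg (by positivity)]
            calc _ ≤ (bernsteinPolynomial ℝ m i).eval x * (m + 1) * (ρ / 2 * (1 / (m + 1))) := by
                  gcongr
              _ = _ := by field_simp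
        _ = ρ / 2 := by rw [← Finset.sum_mul, sum_fin_bernstein_eval, one_mul]
    have hfx : f ⟨x, hx⟩ = h x := rfl
    rw [hfx] at happ
    have := abs_sub_le (τ * ∑ i : Fin (m + 1), (∫ y in a i..a ((i : ℕ) + 1), h y) / τ * (m + 1) *
          (bernsteinPolynomial ℝ m i).eval x)
        (∑ i : Fin (m + 1), (bernsteinPolynomial ℝ m i).eval x * f (bernstein.z i)) (h x)
    linarith

lemma correctionFun_succ (τ : ℝ) (m : ℕ) (G : Measure ℝ) (l : ℝ) :
    correctionFun τ (m + 1, G) l = τ * (bernsteinPoly m G).eval (l / Real.pi) := by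
  rw [correctionFun, bernsteinDensity_eq]

variable {g₀ : ℝ → ℝ} {M : ℝ} {D : Measure (Measure ℝ)} {p : PMF ℕ}

/-- The prior charges every uniform neighbourhood of a positive continuous function of the correct
mass. -/
lemma exists_prior_neighbourhood {a A : ℝ} (ha : 0 < a)
    (hg : ∀ x ∈ Set.Ioo (0 : ℝ) 1, a ≤ g₀ x ∧ g₀ x ≤ A) (hM : 0 < M)
    (hD : IsDirichletProcess D (ENNReal.ofReal M • baseMeasure g₀))
    (hp : ∀ k : ℕ, 1 ≤ k → 0 < p k) {c₀ : ℝ → ℝ}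
    (hc₀ : ContinuousOn c₀ (Set.Icc 0 Real.pi)) (hpos : ∀ l ∈ Set.Icc 0 Real.pi, 0 < c₀ l)
    {τ : ℝ} (hτ : τ = ∫ x in (0 : ℝ)..1, c₀ (Real.pi * x)) {ρ : ℝ} (hρ : 0 < ρ) :
    ∃ U : Set (ℕ × Measure ℝ), MeasurableSet U ∧ 0 < prior p D U ∧
      ∀ θ ∈ U, ∀ l ∈ Set.Icc 0 Real.pi, |correctionFun τ θ l - c₀ l| ≤ ρ := by
  have hpi := Real.pi_pos
  have := hD.1
  have hmap : ∀ x ∈ Set.Icc (0 : ℝ) 1, Real.pi * x ∈ Set.Icc 0 Real.pi := fun x hx =>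
    ⟨mul_nonneg hpi.le hx.1, mul_le_of_le_one_right hpi.le hx.2⟩
  obtain ⟨m, w, hw, hw1, happ⟩ := exists_weights (h := fun x => c₀ (Real.pi * x))
    (hc₀.comp (by fun_prop) hmap) (fun x hx => hpos _ (hmap x hx)) (half_pos hρ)
  rw [← hτ] at happ
  have hm : (0 : ℝ) < (m : ℝ) + 1 := by positivity
  -- Chosen so that weight errors `ξ` change the mixture by at most `|τ| ξ (m+1) ≤ ρ/2`; the `+ 1`
  -- covers `τ = 0`.
  set ξ := ρ / (2 * (|τ| + 1) * (m + 1)) with hξ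
  have hξ0 : 0 < ξ := by positivity
  set S : Set (Measure ℝ) := {G | ∀ i : Fin (m + 1), |cellMass m G i - w i| < ξ} with hS
  have hSm : MeasurableSet S := by
    rw [hS, Set.ofPred_forall]
    refine MeasurableSet.iInter fun i => measurableSet_lt ?_ measurable_const
    exact ((measurable_cellMass m i).sub_const _).abs
  refine ⟨{m + 1} ×ˢ S, (measurableSet_singleton _).prod hSm, ?_, ?_⟩
  · rw [prior, Measure.prod_prod, PMF.toMeasure_apply_singleton _ _ (measurableSet_singleton _)]
    exact ENNReal.mul_pos (hp _ (by omega)).ne' (cellMass_near_pos ha hg hM hD m hw hw1 hξ0).ne'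
  · rintro ⟨k, G⟩ ⟨hk, hG⟩ l hl
    simp only [Set.mem_singleton_iff] at hk
    subst hk
    set x := l / Real.pi with hx
    have hxI : x ∈ Set.Icc (0 : ℝ) 1 := ⟨div_nonneg hl.1 hpi.le, (div_le_one hpi).mpr hl.2⟩
    have hlx : Real.pi * x = l := by rw [hx]; field_simp
    have h1 := happ x hxI
    simp only [hlx] at h1
    rw [correctionFun_succ, bernsteinPoly_eval, ← hx,
      ← Fin.sum_univ_eq_sum_range
        (fun i : ℕ => cellMass m G i * (m + 1) * (bernsteinPolynomial ℝ m i).eval x)]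
    have h2 : |τ * ∑ i : Fin (m + 1), cellMass m G i * (m + 1) *
          (bernsteinPolynomial ℝ m i).eval x - τ * ∑ i : Fin (m + 1), w i * (m + 1) *
          (bernsteinPolynomial ℝ m i).eval x| ≤ ρ / 2 := by
      rw [← mul_sub, ← Finset.sum_sub_distrib, abs_mul]
      calc _ ≤ |τ| * ∑ i : Fin (m + 1), (ξ * (m + 1)) * (bernsteinPolynomial ℝ m i).eval x := by
            gcongr
            refine (Finset.abs_sum_le_sum_abs _ _).trans (Finset.sum_le_sum fun i _ => ?_)
            have hb := bernstein_eval_nonneg m i hxI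
            rw [← sub_mul, ← sub_mul, abs_mul, abs_mul, abs_of_pos hm, abs_of_nonneg hb]
            gcongr
            exact (hG i).le
        _ = |τ| * (ξ * (m + 1)) := by rw [← Finset.mul_sum, sum_fin_bernstein_eval, mul_one]
        _ ≤ (|τ| + 1) * (ξ * (m + 1)) := by gcongr; linarith
        _ = ρ / 2 := by rw [hξ]; field_simp
    have h3 := abs_sub_le (τ * ∑ i : Fin (m + 1), cellMass m G i * (m + 1) *
          (bernsteinPolynomial ℝ m i).eval x) (τ * ∑ i : Fin (m + 1), w i * (m + 1) *
          (bernsteinPolynomial ℝ m i).eval x) (c₀ l)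
    linarith

/-- Tail bound for the prior of the degree. -/
lemma exists_tail_bound {B b : ℝ} (hB : 0 < B) (hb : 0 < b)
    (hp : ∀ k : ℕ, 1 ≤ k → p k ≤ ENNReal.ofReal (B * Real.exp (-b * k * Real.log k))) :
    ∃ C : ℝ, 0 < C ∧ ∀ r : ℕ, 1 ≤ r → p.toMeasure {j | r ≤ j} ≤
      ENNReal.ofReal (C * Real.exp (-(b / 2) * (r * Real.log r))) := by
  set q := Real.exp (-(b / 2)) with hq
  have hq0 : 0 < q := Real.exp_pos _
  have hq1 : q < 1 := by rw [hq, Real.exp_lt_one_iff]; linarith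
  have hgeo : Summable fun j : ℕ => q ^ j := summable_geometric_of_lt_one hq0.le hq1
  have hS : 0 < ∑' j : ℕ, q ^ j := hgeo.tsum_pos (fun j => by positivity) 0 (by simp)
  refine ⟨B * Real.exp (b / 2) * ∑' j : ℕ, q ^ j, by positivity, fun r hr => ?_⟩
  rw [PMF.toMeasure_apply_eq_tsum]
  set E := Real.exp (-(b / 2) * (r * Real.log r)) with hE
  -- Half of the exponent `b j log j` is kept as `r log r` by monotonicity; the other half is at
  -- least `(b/2)(j - 1)` and yields a convergent geometric series.
  have hterm : ∀ j : ℕ, Set.indicator {j | r ≤ j} (⇑p) j ≤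
      ENNReal.ofReal (B * Real.exp (b / 2) * E * q ^ j) := by
    intro j
    by_cases hj : r ≤ j
    · rw [Set.indicator_of_mem (by exact hj)]
      refine (hp j (hr.trans hj)).trans (ENNReal.ofReal_le_ofReal ?_)
      rw [mul_assoc B, mul_assoc B]
      refine mul_le_mul_of_nonneg_left ?_ hB.le
      rw [hE, hq, ← Real.exp_nat_mul, ← Real.exp_add, ← Real.exp_add, Real.exp_le_exp]
      have hjr : (r : ℝ) ≤ j := by exact_mod_cast hj
      have hr1 : (1 : ℝ) ≤ r := by exact_mod_cast hr
      have hlr : 0 ≤ Real.log r := Real.log_nonneg hr1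
      have hj0 : (0 : ℝ) < j := by linarith
      have h1 : (r : ℝ) * Real.log r ≤ j * Real.log j := by gcongr
      have h2 : (j : ℝ) - 1 ≤ j * Real.log j := by
        have := Real.one_sub_inv_le_log_of_pos hj0
        have := mul_le_mul_of_nonneg_left this hj0.le
        rw [mul_sub, mul_inv_cancel₀ hj0.ne', mul_one] at this
        exact this
      nlinarith
    · rw [Set.indicator_of_notMem (by exact hj)]
      exact zero_le
  refine (ENNReal.tsum_le_tsum hterm).trans (le_of_eq ?_)
  rw [← ENNReal.ofReal_tsum_of_nonneg (fun j => by positivity) (hgeo.mul_left _), tsum_mul_left]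
  congr 1
  ring

end PriorMass

/-! ### The corrected likelihood as a Gaussian density -/

section Covariance

variable {n : ℕ}

/-- The symmetric matrix `F_nᵀ diag(s) F_n`. -/
noncomputable def fourierConj (n : ℕ) (s : Fin n → ℝ) : Matrix (Fin n) (Fin n) ℝ :=
  (fourierMatrix n)ᵀ * Matrix.diagonal s * fourierMatrix n

lemma fourierConj_transpose (s : Fin n → ℝ) : (fourierConj n s)ᵀ = fourierConj n s := by
  simp [fourierConj, Matrix.transpose_mul, Matrix.mul_assoc]

lemma fourierConj_mul (s t : Fin n → ℝ) :
    fourierConj n s * fourierConj n t = fourierConj n fun i => s i * t i := by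
  simp only [fourierConj]
  calc _ = (fourierMatrix n)ᵀ * Matrix.diagonal s * (fourierMatrix n * (fourierMatrix n)ᵀ) *
        Matrix.diagonal t * fourierMatrix n := by simp only [Matrix.mul_assoc]
    _ = _ := by
      rw [fourierMatrix_mul_transpose, Matrix.mul_one, Matrix.mul_assoc _ (Matrix.diagonal s),
        Matrix.diagonal_mul_diagonal]

lemma fourierConj_one : fourierConj n (fun _ => 1) = 1 := by
  simp [fourierConj, Matrix.diagonal_one, transpose_mul_fourierMatrix]

lemma det_fourierConj (s : Fin n → ℝ) : (fourierConj n s).det = ∏ i, s i := by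
  have h : (fourierMatrix n)ᵀ.det * (fourierMatrix n).det = 1 := by
    rw [← Matrix.det_mul, transpose_mul_fourierMatrix, Matrix.det_one]
  rw [fourierConj, Matrix.det_mul, Matrix.det_mul, Matrix.det_diagonal, mul_right_comm, h,
    one_mul]

lemma dotProduct_fourierConj (s z : Fin n → ℝ) :
    z ⬝ᵥ (fourierConj n s *ᵥ z) = ∑ i, s i * (fourierMatrix n *ᵥ z) i ^ 2 := by
  rw [fourierConj, ← Matrix.mulVec_mulVec, ← Matrix.mulVec_mulVec, Matrix.dotProduct_mulVec,
    Matrix.vecMul_transpose, dotProduct]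
  refine Finset.sum_congr rfl fun i _ => ?_
  rw [Matrix.mulVec_diagonal]
  ring

lemma sq_fourierConj_mulVec (s z : Fin n → ℝ) :
    (fourierConj n s *ᵥ z) ⬝ᵥ (fourierConj n s *ᵥ z) =
      ∑ i, s i ^ 2 * (fourierMatrix n *ᵥ z) i ^ 2 := by
  rw [Matrix.dotProduct_mulVec, ← Matrix.mulVec_transpose, fourierConj_transpose,
    Matrix.mulVec_mulVec, fourierConj_mul, dotProduct_comm, dotProduct_fourierConj]
  simp only [sq]

lemma fourierConj_posSemidef {s : Fin n → ℝ} (hs : ∀ i, 0 ≤ s i) :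
    (fourierConj n s).PosSemidef := by
  refine Matrix.PosSemidef.of_dotProduct_mulVec_nonneg ?_ fun z => ?_
  · simpa [Matrix.IsHermitian] using fourierConj_transpose s
  · rw [star_trivial, dotProduct_fourierConj]
    exact Finset.sum_nonneg fun i _ => mul_nonneg (hs i) (sq_nonneg _)

/-- The covariance matrix `C^{1/2} Σ C^{1/2}`, in Fourier coordinates, of the corrected model. -/
noncomputable def correctedCov (A : Matrix (Fin n) (Fin n) ℝ) (C : Fin n → ℝ) :
    Matrix (Fin n) (Fin n) ℝ :=
  fourierConj n (fun i => Real.sqrt (C i)) * A * fourierConj n fun i => Real.sqrt (C i)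

lemma fourierConj_sqrt_mul_inv {C : Fin n → ℝ} (hC : ∀ i, 0 < C i) :
    fourierConj n (fun i => Real.sqrt (C i)) * fourierConj n (fun i => (Real.sqrt (C i))⁻¹) =
      1 := by
  rw [fourierConj_mul, ← fourierConj_one]
  congr 1
  funext i
  exact mul_inv_cancel₀ (Real.sqrt_pos.mpr (hC i)).ne'

lemma fourierConj_inv_mul_sqrt {C : Fin n → ℝ} (hC : ∀ i, 0 < C i) :
    fourierConj n (fun i => (Real.sqrt (C i))⁻¹) * fourierConj n (fun i => Real.sqrt (C i)) =
      1 :=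
  mul_eq_one_comm.mp (fourierConj_sqrt_mul_inv hC)

lemma correctedCov_inv {A : Matrix (Fin n) (Fin n) ℝ} (hA : A.PosDef) {C : Fin n → ℝ}
    (hC : ∀ i, 0 < C i) :
    (correctedCov A C)⁻¹ = fourierConj n (fun i => (Real.sqrt (C i))⁻¹) * A⁻¹ *
      fourierConj n fun i => (Real.sqrt (C i))⁻¹ := by
  refine Matrix.inv_eq_right_inv ?_
  rw [correctedCov]
  set U := fourierConj n fun i => Real.sqrt (C i)
  set T := fourierConj n fun i => (Real.sqrt (C i))⁻¹
  have hUT : U * T = 1 := fourierConj_sqrt_mul_inv hC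
  calc _ = U * A * (U * T) * A⁻¹ * T := by simp only [Matrix.mul_assoc]
    _ = 1 := by
      rw [hUT, Matrix.mul_one, Matrix.mul_assoc U, mul_inv_of_posDef hA, Matrix.mul_one, hUT]

lemma correctedCov_posDef {A : Matrix (Fin n) (Fin n) ℝ} (hA : A.PosDef) {C : Fin n → ℝ}
    (hC : ∀ i, 0 < C i) : (correctedCov A C).PosDef := by
  have := hA.conjTranspose_mul_mul_same (B := fourierConj n fun i => Real.sqrt (C i)) (by
    refine Function.LeftInverse.injective
      (g := fun v => fourierConj n (fun i => (Real.sqrt (C i))⁻¹) *ᵥ v) fun v => ?_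
    simp [Matrix.mulVec_mulVec, fourierConj_inv_mul_sqrt hC])
  simpa [correctedCov, fourierConj_transpose] using this

lemma dotProduct_correctedCov_inv {A : Matrix (Fin n) (Fin n) ℝ} (hA : A.PosDef) {C : Fin n → ℝ}
    (hC : ∀ i, 0 < C i) (z : Fin n → ℝ) :
    z ⬝ᵥ ((correctedCov A C)⁻¹ *ᵥ z) =
      (fourierConj n (fun i => (Real.sqrt (C i))⁻¹) *ᵥ z) ⬝ᵥ
        (A⁻¹ *ᵥ (fourierConj n (fun i => (Real.sqrt (C i))⁻¹) *ᵥ z)) := by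
  rw [correctedCov_inv hA hC, ← Matrix.mulVec_mulVec, ← Matrix.mulVec_mulVec,
    Matrix.dotProduct_mulVec, ← Matrix.mulVec_transpose, fourierConj_transpose]

lemma det_correctedCov (A : Matrix (Fin n) (Fin n) ℝ) {C : Fin n → ℝ}
    (hC : ∀ i, 0 ≤ C i) : (correctedCov A C).det = A.det * ∏ i, C i := by
  rw [correctedCov, Matrix.det_mul, Matrix.det_mul, det_fourierConj, mul_right_comm,
    ← Finset.prod_mul_distrib, mul_comm]
  congr 1
  exact Finset.prod_congr rfl fun i _ => Real.mul_self_sqrt (hC i)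

/-- The factor `det(C_n)^{-1/2}` is the Jacobian of `z ↦ Fᵀ C^{-1/2} F z`, so the corrected
likelihood is a genuine probability density in `z`. -/
lemma correctedLikelihood_eq_gaussianDensity {γp : ℤ → ℝ} {η : ℝ} {c : ℝ → ℝ}
    (hA : (autocovMatrix γp n).PosDef) (hC : ∀ i, 0 < correctionDiag γp η n c i)
    (z : Fin n → ℝ) :
    correctedLikelihood γp η n c z =
      gaussianDensity (correctedCov (autocovMatrix γp n) (correctionDiag γp η n c)) z := by
  have h1 : (fun i => correctionDiag γp η n c i ^ (-(1 / 2) : ℝ)) =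
      fun i => (Real.sqrt (correctionDiag γp η n c i))⁻¹ := by
    funext i
    rw [Real.rpow_neg (hC i).le, Real.sqrt_eq_rpow]
  have hprod : 0 < ∏ i, correctionDiag γp η n c i := Finset.prod_pos fun i _ => hC i
  have hdet := hA.det_pos
  rw [correctedLikelihood, gaussianDensity, gaussianDensity, dotProduct_correctedCov_inv hA hC,
    det_correctedCov _ fun i => (hC i).le, Matrix.det_diagonal, h1, Real.rpow_neg hprod.le,
    ← Real.sqrt_eq_rpow, ← mul_assoc ((2 * Real.pi) ^ n), Real.sqrt_mul (by positivity) (∏ i, _),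
    mul_inv, fourierConj]
  ring

/-- Default value: `Real.rpow` gives `0` for `0` to the power `-1/2`, so the determinant factor
vanishes. -/
lemma correctedLikelihood_eq_zero {γp : ℤ → ℝ} {η : ℝ} {c : ℝ → ℝ} {i : Fin n}
    (hi : correctionDiag γp η n c i = 0) (z : Fin n → ℝ) :
    correctedLikelihood γp η n c z = 0 := by
  rw [correctedLikelihood, Matrix.det_diagonal, Finset.prod_eq_zero (Finset.mem_univ i) hi,
    Real.zero_rpow (by norm_num), zero_mul]

/-- The covariance matrix in Fourier coordinates. -/
noncomputable def fourierCov (A : Matrix (Fin n) (Fin n) ℝ) : Matrix (Fin n) (Fin n) ℝ :=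
  fourierMatrix n * A * (fourierMatrix n)ᵀ

lemma trace_mul_fourierConj (A : Matrix (Fin n) (Fin n) ℝ) (b : Fin n → ℝ) :
    (A * fourierConj n b).trace = ∑ i, b i * fourierCov A i i := by
  rw [fourierConj, ← Matrix.mul_assoc, Matrix.trace_mul_comm, ← Matrix.mul_assoc,
    ← Matrix.mul_assoc]
  change (fourierCov A * Matrix.diagonal b).trace = _
  rw [Matrix.trace]
  refine Finset.sum_congr rfl fun i _ => ?_
  rw [Matrix.diag_apply, Matrix.mul_diagonal, mul_comm]

lemma fourierCov_fourierConj_mul_mul (A : Matrix (Fin n) (Fin n) ℝ) (s : Fin n → ℝ) :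
    fourierCov (fourierConj n s * A * fourierConj n s) =
      Matrix.diagonal s * fourierCov A * Matrix.diagonal s := by
  have h := fourierMatrix_mul_transpose n
  simp only [fourierCov, fourierConj]
  calc _ = (fourierMatrix n * (fourierMatrix n)ᵀ) * Matrix.diagonal s * fourierMatrix n * A *
        (fourierMatrix n)ᵀ * Matrix.diagonal s * (fourierMatrix n * (fourierMatrix n)ᵀ) := by
          simp only [Matrix.mul_assoc]
    _ = _ := by rw [h, Matrix.one_mul, Matrix.mul_one]; simp only [Matrix.mul_assoc]

lemma fourierCov_correctedCov_apply (A : Matrix (Fin n) (Fin n) ℝ) {C : Fin n → ℝ}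
    (hC : ∀ i, 0 ≤ C i) (i : Fin n) :
    fourierCov (correctedCov A C) i i = C i * fourierCov A i i := by
  rw [correctedCov, fourierCov_fourierConj_mul_mul, Matrix.mul_diagonal, Matrix.diagonal_mul,
    mul_right_comm, Real.mul_self_sqrt (hC i)]

lemma fourierCov_mul (A B : Matrix (Fin n) (Fin n) ℝ) :
    fourierCov (A * B) = fourierCov A * fourierCov B := by
  have h := transpose_mul_fourierMatrix n
  simp only [fourierCov]
  calc _ = fourierMatrix n * A * 1 * B * (fourierMatrix n)ᵀ := by
        rw [Matrix.mul_one]; simp only [Matrix.mul_assoc]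
    _ = _ := by rw [← h]; simp only [Matrix.mul_assoc]

lemma fourierCov_inv {A : Matrix (Fin n) (Fin n) ℝ} (hA : A.PosDef) :
    fourierCov A⁻¹ = (fourierCov A)⁻¹ := by
  refine (Matrix.inv_eq_right_inv ?_).symm
  rw [← fourierCov_mul, mul_inv_of_posDef hA, fourierCov, Matrix.mul_one,
    fourierMatrix_mul_transpose]

lemma trace_fourierCov (A : Matrix (Fin n) (Fin n) ℝ) : (fourierCov A).trace = A.trace := by
  rw [fourierCov, Matrix.trace_mul_comm, ← Matrix.mul_assoc, transpose_mul_fourierMatrix,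
    Matrix.one_mul]

lemma dotProduct_fourierCov (A : Matrix (Fin n) (Fin n) ℝ) (x : Fin n → ℝ) :
    x ⬝ᵥ (fourierCov A *ᵥ x) =
      ((fourierMatrix n)ᵀ *ᵥ x) ⬝ᵥ (A *ᵥ ((fourierMatrix n)ᵀ *ᵥ x)) := by
  rw [fourierCov, ← Matrix.mulVec_mulVec, ← Matrix.mulVec_mulVec, Matrix.dotProduct_mulVec,
    ← Matrix.mulVec_transpose]

lemma dotProduct_self_transpose_fourierMatrix (x : Fin n → ℝ) :
    ((fourierMatrix n)ᵀ *ᵥ x) ⬝ᵥ ((fourierMatrix n)ᵀ *ᵥ x) = x ⬝ᵥ x := by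
  rw [Matrix.dotProduct_mulVec, ← Matrix.mulVec_transpose, Matrix.mulVec_mulVec,
    Matrix.transpose_transpose, fourierMatrix_mul_transpose, Matrix.one_mulVec]

lemma dotProduct_self_fourierMatrix (x : Fin n → ℝ) :
    (fourierMatrix n *ᵥ x) ⬝ᵥ (fourierMatrix n *ᵥ x) = x ⬝ᵥ x := by
  rw [Matrix.dotProduct_mulVec, ← Matrix.mulVec_transpose, Matrix.mulVec_mulVec,
    transpose_mul_fourierMatrix, Matrix.one_mulVec]

lemma dotProduct_self_nonneg' (x : Fin n → ℝ) : 0 ≤ x ⬝ᵥ x :=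
  Finset.sum_nonneg fun _ _ => mul_self_nonneg _

lemma fourierCov_posDef {A : Matrix (Fin n) (Fin n) ℝ} (hA : A.PosDef) :
    (fourierCov A).PosDef := by
  have := hA.conjTranspose_mul_mul_same (B := (fourierMatrix n)ᵀ) (by
    refine Function.LeftInverse.injective (g := fun v => fourierMatrix n *ᵥ v) fun v => ?_
    simp [Matrix.mulVec_mulVec, fourierMatrix_mul_transpose])
  simpa [fourierCov] using this

/-- An upper bound `A ≤ Λ` gives `A⁻¹ ≥ Λ⁻¹`. -/
lemma dotProduct_self_le_of_quad_le {A : Matrix (Fin n) (Fin n) ℝ} (hA : A.PosDef) {Λ : ℝ}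
    (h : ∀ x : Fin n → ℝ, x ⬝ᵥ (A *ᵥ x) ≤ Λ * (x ⬝ᵥ x)) (x : Fin n → ℝ) :
    x ⬝ᵥ x ≤ Λ * (x ⬝ᵥ (A⁻¹ *ᵥ x)) := by
  have h1 := dotProduct_sq_le hA x x
  have h2 := quad_nonneg hA.inv.posSemidef x
  have h3 := dotProduct_self_nonneg' x
  have h4 := mul_le_mul_of_nonneg_right (h x) h2
  rcases h3.eq_or_lt with h5 | h5
  · have : x = 0 := by
      by_contra hx
      obtain ⟨i, hi⟩ := Function.ne_iff.mp hx
      have : 0 < x ⬝ᵥ x := Finset.sum_pos' (fun i _ => mul_self_nonneg _)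
        ⟨i, Finset.mem_univ _, mul_self_pos.mpr hi⟩
      linarith
    simp [this]
  · nlinarith

/-- A lower bound `α ≤ A` gives `‖A⁻¹ x‖ ≤ α⁻¹ ‖x‖`. -/
lemma inv_mulVec_sq_le {A : Matrix (Fin n) (Fin n) ℝ} (hA : A.PosDef) {α : ℝ} (hα : 0 < α)
    (h : ∀ x : Fin n → ℝ, α * (x ⬝ᵥ x) ≤ x ⬝ᵥ (A *ᵥ x)) (x : Fin n → ℝ) :
    (A⁻¹ *ᵥ x) ⬝ᵥ (A⁻¹ *ᵥ x) ≤ α⁻¹ ^ 2 * (x ⬝ᵥ x) := by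
  set y := A⁻¹ *ᵥ x with hy
  have h1 := h y
  have h2 : A *ᵥ y = x := by
    rw [hy, Matrix.mulVec_mulVec, mul_inv_of_posDef hA, Matrix.one_mulVec]
  rw [h2] at h1
  have h3 : (y ⬝ᵥ x) ^ 2 ≤ (y ⬝ᵥ y) * (x ⬝ᵥ x) := by
    simp only [dotProduct, ← sq]
    exact Finset.sum_mul_sq_le_sq_mul_sq _ _ _
  have h4 := dotProduct_self_nonneg' y
  have h5 := dotProduct_self_nonneg' x
  rcases h4.eq_or_lt with h6 | h6
  · rw [← h6]; positivity
  · have h7 : (α * (y ⬝ᵥ y)) ^ 2 ≤ (y ⬝ᵥ y) * (x ⬝ᵥ x) :=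
      (pow_le_pow_left₀ (by positivity) h1 2).trans h3
    have h8 : α ^ 2 * (y ⬝ᵥ y) ≤ x ⬝ᵥ x := by
      refine le_of_mul_le_mul_left ?_ h6
      nlinarith
    rw [inv_pow, inv_mul_eq_div, le_div_iff₀ (by positivity)]
    linarith

end Covariance

/-! ### Tests and Kullback–Leibler bounds -/

section Tests

variable {n : ℕ}

/-- A summable even autocovariance function whose spectral density is at least `β > 0`. -/
structure IsRegular (γ : ℤ → ℝ) (β : ℝ) : Prop where
  summable : Summable fun h => |γ h|
  summable_mul : Summable fun h : ℤ => |(h : ℝ)| * |γ h|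
  even : ∀ h, γ (-h) = γ h
  pos : 0 < β
  le : ∀ l ∈ Set.Icc (-Real.pi) Real.pi, β ≤ spectralDensity γ l

/-- The scaled spectral density at the Fourier frequencies. -/
noncomputable def specDiag (γ : ℤ → ℝ) (n : ℕ) (i : Fin n) : ℝ :=
  2 * Real.pi * spectralDensity γ (rowFreq n i)

/-- Upper bound for the covariance matrices. -/
noncomputable def covBound (γ : ℤ → ℝ) : ℝ := ∑' h, |γ h|

/-- Upper bound for `n` times the error of the diagonal approximation. -/
noncomputable def errBound (γ : ℤ → ℝ) : ℝ := 2 * ∑' h : ℤ, |(h : ℝ)| * |γ h|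

lemma errBound_nonneg (γ : ℤ → ℝ) : 0 ≤ errBound γ :=
  mul_nonneg zero_le_two (tsum_nonneg fun _ => by positivity)

lemma covBound_nonneg (γ : ℤ → ℝ) : 0 ≤ covBound γ := tsum_nonneg fun _ => abs_nonneg _

namespace IsRegular

variable {γ : ℤ → ℝ} {β : ℝ}

lemma le_spectralDensity (h : IsRegular γ β) {l : ℝ} (hl : l ∈ Set.Icc 0 Real.pi) :
    β ≤ spectralDensity γ l :=
  h.le l ⟨by linarith [hl.1, Real.pi_pos], hl.2⟩

lemma le_specDiag (h : IsRegular γ β) (i : Fin n) : 2 * Real.pi * β ≤ specDiag γ n i :=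
  mul_le_mul_of_nonneg_left (h.le_spectralDensity (rowFreq_mem i)) (by positivity)

lemma specDiag_pos (h : IsRegular γ β) (i : Fin n) : 0 < specDiag γ n i :=
  lt_of_lt_of_le (mul_pos (by positivity) h.pos) (h.le_specDiag i)

lemma posDef (h : IsRegular γ β) (n : ℕ) : (autocovMatrix γ n).PosDef :=
  autocovMatrix_posDef h.summable h.even h.pos h.le n

lemma abs_err_le (h : IsRegular γ β) (i j : Fin n) :
    |(fourierCov (autocovMatrix γ n) - Matrix.diagonal (specDiag γ n)) i j| ≤ errBound γ / n :=
  abs_fourier_autocov_sub_le h.summable h.summable_mul h.even i j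

lemma abs_fourierCov_diag_sub_le (h : IsRegular γ β) (i : Fin n) :
    |fourierCov (autocovMatrix γ n) i i - specDiag γ n i| ≤ errBound γ / n := by
  simpa using h.abs_err_le i i

lemma dotProduct_self_le (h : IsRegular γ β) (x : Fin n → ℝ) :
    x ⬝ᵥ x ≤ covBound γ * (x ⬝ᵥ ((autocovMatrix γ n)⁻¹ *ᵥ x)) :=
  dotProduct_self_le_of_quad_le (h.posDef n) (quad_autocov_le h.summable h.even) x

lemma le_quad_fourierCov (h : IsRegular γ β) (x : Fin n → ℝ) :
    2 * Real.pi * β * (x ⬝ᵥ x) ≤ x ⬝ᵥ (fourierCov (autocovMatrix γ n) *ᵥ x) := by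
  rw [dotProduct_fourierCov, ← dotProduct_self_transpose_fourierMatrix]
  exact le_quad_autocov h.summable h.even h.le _

end IsRegular

/-- Indicator weights of the test statistic `∑_{i ∈ J} (F z)_i² / v_i`. -/
noncomputable def testWeight (v : Fin n → ℝ) (J : Finset (Fin n)) (i : Fin n) : ℝ :=
  if i ∈ J then (v i)⁻¹ else 0

lemma testWeight_nonneg {v : Fin n → ℝ} (hv : ∀ i, 0 < v i) (J : Finset (Fin n)) (i : Fin n) :
    0 ≤ testWeight v J i := by
  unfold testWeight
  split_ifs
  · exact (inv_pos.mpr (hv i)).le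
  · exact le_rfl

/-- The test statistic `∑_{i ∈ J} (F z)_i² / v_i`. -/
noncomputable def testStat (v : Fin n → ℝ) (J : Finset (Fin n)) (z : Fin n → ℝ) : ℝ :=
  z ⬝ᵥ (fourierConj n (testWeight v J) *ᵥ z)

lemma measurable_testStat (v : Fin n → ℝ) (J : Finset (Fin n)) : Measurable (testStat v J) :=
  (continuous_quad _).measurable

/-- Under the true model the test statistic is rarely much smaller than `|J|`. -/
lemma testStat_lower_tail {γ : ℤ → ℝ} {β : ℝ} (h : IsRegular γ β) (J : Finset (Fin n))
    {e t : ℝ} (he : 0 < e) (ht : 0 ≤ t)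
    (hte : 2 * t * (covBound γ / (2 * Real.pi * β)) ≤ e / 4) :
    ∫⁻ z in {z | testStat (specDiag γ n) J z < (1 - e / 2) * J.card},
        ENNReal.ofReal (gaussianDensity (autocovMatrix γ n) z) ≤
      ENNReal.ofReal (Real.exp (-t * (e / 4 * J.card - errBound γ / (2 * Real.pi * β)))) := by
  have hβ' : 0 < 2 * Real.pi * β := mul_pos (by positivity) h.pos
  set v := specDiag γ n with hv
  have hvpos : ∀ i, 0 < v i := h.specDiag_pos
  set B := fourierConj n (testWeight v J) with hB
  have hBpsd : B.PosSemidef := fourierConj_posSemidef (testWeight_nonneg hvpos J)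
  -- The weights are at most `1 / (2πβ)` and the identity is at most `covBound γ` times the inverse
  -- covariance; the hypothesis on `t` then makes the relative tilt at most `e/4`.
  have hquad : ∀ z : Fin n → ℝ, 2 * t * (z ⬝ᵥ (B *ᵥ z)) ≤
      e / 4 * (z ⬝ᵥ ((autocovMatrix γ n)⁻¹ *ᵥ z)) := by
    intro z
    have h1 : z ⬝ᵥ (B *ᵥ z) ≤ (2 * Real.pi * β)⁻¹ * (z ⬝ᵥ z) := by
      rw [hB, dotProduct_fourierConj, ← dotProduct_self_fourierMatrix z, dotProduct,
        Finset.mul_sum]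
      refine Finset.sum_le_sum fun i _ => ?_
      rw [← sq]
      refine mul_le_mul_of_nonneg_right ?_ (sq_nonneg _)
      unfold testWeight
      split_ifs
      · exact inv_anti₀ hβ' (h.le_specDiag i)
      · positivity
    have h2 := h.dotProduct_self_le z
    have h3 := quad_nonneg (h.posDef n).inv.posSemidef z
    calc _ ≤ 2 * t * ((2 * Real.pi * β)⁻¹ *
          (covBound γ * (z ⬝ᵥ ((autocovMatrix γ n)⁻¹ *ᵥ z)))) := by
          refine mul_le_mul_of_nonneg_left (h1.trans ?_) (by positivity)
          exact mul_le_mul_of_nonneg_left h2 (inv_pos.mpr hβ').le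
      _ = 2 * t * (covBound γ / (2 * Real.pi * β)) *
          (z ⬝ᵥ ((autocovMatrix γ n)⁻¹ *ᵥ z)) := by ring
      _ ≤ _ := mul_le_mul_of_nonneg_right hte h3
  have hmgf := lintegral_gaussianDensity_mul_exp_neg_le (h.posDef n) hBpsd ht
    (by positivity) hquad
  set K := errBound γ / (2 * Real.pi * β) with hK
  have hK0 : 0 ≤ K := div_nonneg (errBound_nonneg γ) hβ'.le
  -- The mean of the statistic: each of the `|J|` terms is at least `1 - K/n`, so the total loss is
  -- at most `K`.
  have htr : (J.card : ℝ) - K ≤ (autocovMatrix γ n * B).trace := by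
    rw [hB, trace_mul_fourierConj]
    have hterm : ∀ i, (if i ∈ J then (1 - K / n : ℝ) else 0) ≤
        testWeight v J i * fourierCov (autocovMatrix γ n) i i := by
      intro i
      unfold testWeight
      split_ifs
      · have h1 := (abs_le.mp (h.abs_fourierCov_diag_sub_le i)).1
        have h2 := h.le_specDiag i
        have h3 : errBound γ / n ≤ K / n * v i := by
          rw [hK, div_mul_eq_mul_div]
          refine div_le_div_of_nonneg_right ?_ (Nat.cast_nonneg n)
          rw [div_mul_eq_mul_div, le_div_iff₀ hβ']
          exact mul_le_mul_of_nonneg_left h2 (errBound_nonneg γ)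
        rw [inv_mul_eq_div, le_div_iff₀ (hvpos i)]
        linarith
      · simp
    refine le_trans ?_ (Finset.sum_le_sum fun i _ => hterm i)
    rw [← Finset.sum_filter, Finset.sum_const, nsmul_eq_mul]
    have hcard : (Finset.univ.filter fun i => i ∈ J) = J := by ext; simp
    rw [hcard]
    have hJn : (J.card : ℝ) ≤ n := by
      exact_mod_cast (Finset.card_le_univ J).trans (by simp)
    have h4 : (J.card : ℝ) * (K / n) ≤ K := by
      rcases Nat.eq_zero_or_pos n with hn | hn
      · subst hn; simp [hK0]
      · have hn' : (0 : ℝ) < n := by exact_mod_cast hn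
        rw [mul_div_assoc', div_le_iff₀ hn', mul_comm]
        exact mul_le_mul_of_nonneg_left hJn hK0
    linarith
  have hcher : ∀ z, Set.indicator {z | testStat v J z < (1 - e / 2) * J.card}
      (fun z => ENNReal.ofReal (gaussianDensity (autocovMatrix γ n) z)) z ≤
      ENNReal.ofReal (Real.exp (t * ((1 - e / 2) * J.card))) *
        ENNReal.ofReal (gaussianDensity (autocovMatrix γ n) z *
          Real.exp (-t * (z ⬝ᵥ (B *ᵥ z)))) := by
    intro z
    by_cases hz : testStat v J z < (1 - e / 2) * J.card
    · rw [Set.indicator_of_mem (by exact hz), ← ENNReal.ofReal_mul (Real.exp_nonneg _)]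
      refine ENNReal.ofReal_le_ofReal ?_
      rw [mul_left_comm, ← Real.exp_add]
      refine le_mul_of_one_le_right (gaussianDensity_pos (h.posDef n) z).le
        (Real.one_le_exp ?_)
      have : z ⬝ᵥ (B *ᵥ z) ≤ (1 - e / 2) * J.card := le_of_lt hz
      nlinarith
    · rw [Set.indicator_of_notMem (by exact hz)]
      exact zero_le
  have hmeas : MeasurableSet {z | testStat v J z < (1 - e / 2) * J.card} :=
    measurableSet_lt (measurable_testStat v J) measurable_const
  rw [← lintegral_indicator hmeas]
  refine (lintegral_mono hcher).trans ?_
  rw [lintegral_const_mul]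
  · refine (mul_le_mul_right hmgf _).trans ?_
    rw [← ENNReal.ofReal_mul (Real.exp_nonneg _), ← Real.exp_add]
    refine ENNReal.ofReal_le_ofReal (Real.exp_le_exp.mpr ?_)
    -- From `(1 - e/4)(1 + e/4) ≤ 1`. Compared with the threshold `1 - e/2`, a margin of `(e/4) |J|`
    -- remains.
    have h5 : (1 - e / 4) * J.card - K ≤ (autocovMatrix γ n * B).trace / (1 + e / 4) := by
      rw [le_div_iff₀ (by positivity)]
      have h6 : 0 ≤ e * K := by positivity
      have h7 : 0 ≤ e ^ 2 * (J.card : ℝ) := by positivity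
      nlinarith
    have h6 := mul_le_mul_of_nonneg_left h5 ht
    linarith
  · exact ((measurable_gaussianDensity _).mul
      ((measurable_testStat v J).const_mul _).exp).ennreal_ofReal

/-- If the corrected model has small variances on `J`, then the test statistic is rarely close to
`|J|` under it. -/
lemma testStat_upper_tail {γ : ℤ → ℝ} {β : ℝ} (h : IsRegular γ β) (J : Finset (Fin n))
    {v C : Fin n → ℝ} (hv : ∀ i, 0 < v i) (hC : ∀ i, 0 < C i) {e t : ℝ} (he : 0 < e) (he1 : e < 1)
    (hCv : ∀ i ∈ J, C i * specDiag γ n i ≤ (1 - e) * v i) (ht : 0 ≤ t)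
    (hte : 2 * t * (covBound γ / (2 * Real.pi * β)) ≤ e / 4) :
    ∫⁻ z in {z | (1 - e / 2) * J.card ≤ testStat v J z},
        ENNReal.ofReal (gaussianDensity (correctedCov (autocovMatrix γ n) C) z) ≤
      ENNReal.ofReal (Real.exp (-t * (e / 4 * J.card - errBound γ / (2 * Real.pi * β)))) := by
  have hβ' : 0 < 2 * Real.pi * β := mul_pos (by positivity) h.pos
  have hS := correctedCov_posDef (h.posDef n) hC
  set S := correctedCov (autocovMatrix γ n) C with hSdef
  set B := fourierConj n (testWeight v J) with hB
  have hBpsd : B.PosSemidef := fourierConj_posSemidef (testWeight_nonneg hv J)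
  have hratio : ∀ i ∈ J, (v i)⁻¹ * C i * specDiag γ n i ≤ 1 - e := by
    intro i hi
    rw [mul_assoc, inv_mul_eq_div, div_le_iff₀ (hv i)]
    exact hCv i hi
  -- The weights vanish off `J`, and on `J` the hypothesis gives `2πβ C_i ≤ v_i`. Hence no bound on
  -- `C` away from `J` is needed.
  have hquad : ∀ z : Fin n → ℝ, 2 * t * (z ⬝ᵥ (B *ᵥ z)) ≤ e / 4 * (z ⬝ᵥ (S⁻¹ *ᵥ z)) := by
    intro z
    have h2 := h.dotProduct_self_le (fourierConj n (fun i => (Real.sqrt (C i))⁻¹) *ᵥ z)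
    rw [← dotProduct_correctedCov_inv (h.posDef n) hC, ← hSdef, sq_fourierConj_mulVec] at h2
    have h1 : z ⬝ᵥ (B *ᵥ z) ≤ (2 * Real.pi * β)⁻¹ *
        ∑ i, (Real.sqrt (C i))⁻¹ ^ 2 * (fourierMatrix n *ᵥ z) i ^ 2 := by
      rw [hB, dotProduct_fourierConj, Finset.mul_sum]
      refine Finset.sum_le_sum fun i _ => ?_
      rw [← mul_assoc]
      refine mul_le_mul_of_nonneg_right ?_ (sq_nonneg _)
      rw [inv_pow, Real.sq_sqrt (hC i).le]
      unfold testWeight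
      split_ifs with hi
      · rw [← mul_inv]
        refine inv_anti₀ (mul_pos hβ' (hC i)) ?_
        have h3 := hCv i hi
        have h4 := mul_le_mul_of_nonneg_right (h.le_specDiag i) (hC i).le
        nlinarith [hv i]
      · have := hC i
        positivity
    have h3 := quad_nonneg hS.inv.posSemidef z
    calc _ ≤ 2 * t * ((2 * Real.pi * β)⁻¹ * (covBound γ * (z ⬝ᵥ (S⁻¹ *ᵥ z)))) := by
          refine mul_le_mul_of_nonneg_left (h1.trans ?_) (by positivity)
          exact mul_le_mul_of_nonneg_left h2 (inv_pos.mpr hβ').le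
      _ = 2 * t * (covBound γ / (2 * Real.pi * β)) * (z ⬝ᵥ (S⁻¹ *ᵥ z)) := by ring
      _ ≤ _ := mul_le_mul_of_nonneg_right hte h3
  have hmgf := lintegral_gaussianDensity_mul_exp_pos_le hS hBpsd ht (by linarith) hquad
  set K := errBound γ / (2 * Real.pi * β) with hK
  have hK0 : 0 ≤ K := div_nonneg (errBound_nonneg γ) hβ'.le
  have htr : (S * B).trace ≤ (1 - e) * (J.card + K) := by
    rw [hB, trace_mul_fourierConj]
    have hterm : ∀ i, testWeight v J i * fourierCov S i i ≤
        (if i ∈ J then (1 - e) * (1 + K / n : ℝ) else 0) := by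
      intro i
      rw [hSdef, fourierCov_correctedCov_apply _ fun i => (hC i).le]
      unfold testWeight
      split_ifs with hi
      · have h1 := (abs_le.mp (h.abs_fourierCov_diag_sub_le i)).2
        have h2 := h.le_specDiag i
        have h3 : errBound γ / n ≤ K / n * specDiag γ n i := by
          rw [hK, div_mul_eq_mul_div]
          refine div_le_div_of_nonneg_right ?_ (Nat.cast_nonneg n)
          rw [div_mul_eq_mul_div, le_div_iff₀ hβ']
          exact mul_le_mul_of_nonneg_left h2 (errBound_nonneg γ)
        have h4 : 0 ≤ (v i)⁻¹ * C i := mul_nonneg (inv_pos.mpr (hv i)).le (hC i).le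
        calc _ = (v i)⁻¹ * C i * fourierCov (autocovMatrix γ n) i i := by ring
          _ ≤ (v i)⁻¹ * C i * ((1 + K / n) * specDiag γ n i) :=
              mul_le_mul_of_nonneg_left (by linarith) h4
          _ = (1 + K / n) * ((v i)⁻¹ * C i * specDiag γ n i) := by ring
          _ ≤ (1 + K / n) * (1 - e) :=
              mul_le_mul_of_nonneg_left (hratio i hi) (by positivity)
          _ = _ := by ring
      · simp
    refine (Finset.sum_le_sum fun i _ => hterm i).trans ?_
    rw [← Finset.sum_filter, Finset.sum_const, nsmul_eq_mul]
    have hcard : (Finset.univ.filter fun i => i ∈ J) = J := by ext; simp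
    rw [hcard]
    have hJn : (J.card : ℝ) ≤ n := by
      exact_mod_cast (Finset.card_le_univ J).trans (by simp)
    have h4 : (J.card : ℝ) * (K / n) ≤ K := by
      rcases Nat.eq_zero_or_pos n with hn | hn
      · subst hn; simp [hK0]
      · have hn' : (0 : ℝ) < n := by exact_mod_cast hn
        rw [mul_div_assoc', div_le_iff₀ hn', mul_comm]
        exact mul_le_mul_of_nonneg_left hJn hK0
    calc _ = (1 - e) * (J.card + J.card * (K / n)) := by ring
      _ ≤ _ := mul_le_mul_of_nonneg_left (by linarith) (by linarith)
  have hcher : ∀ z, Set.indicator {z | (1 - e / 2) * J.card ≤ testStat v J z}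
      (fun z => ENNReal.ofReal (gaussianDensity S z)) z ≤
      ENNReal.ofReal (Real.exp (-t * ((1 - e / 2) * J.card))) *
        ENNReal.ofReal (gaussianDensity S z * Real.exp (t * (z ⬝ᵥ (B *ᵥ z)))) := by
    intro z
    by_cases hz : (1 - e / 2) * J.card ≤ testStat v J z
    · rw [Set.indicator_of_mem (by exact hz), ← ENNReal.ofReal_mul (Real.exp_nonneg _)]
      refine ENNReal.ofReal_le_ofReal ?_
      rw [mul_left_comm, ← Real.exp_add]
      refine le_mul_of_one_le_right (gaussianDensity_pos hS z).le (Real.one_le_exp ?_)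
      have : (1 - e / 2) * J.card ≤ z ⬝ᵥ (B *ᵥ z) := hz
      nlinarith
    · rw [Set.indicator_of_notMem (by exact hz)]
      exact zero_le
  have hmeas : MeasurableSet {z | (1 - e / 2) * J.card ≤ testStat v J z} :=
    measurableSet_le measurable_const (measurable_testStat v J)
  rw [← lintegral_indicator hmeas]
  refine (lintegral_mono hcher).trans ?_
  rw [lintegral_const_mul]
  · refine (mul_le_mul_right hmgf _).trans ?_
    rw [← ENNReal.ofReal_mul (Real.exp_nonneg _), ← Real.exp_add]
    refine ENNReal.ofReal_le_ofReal (Real.exp_le_exp.mpr ?_)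
    -- From `1 - e ≤ (1 - 3e/4)(1 - e/4)`; the margin below the threshold `1 - e/2` is again `e/4`.
    have h5 : (S * B).trace / (1 - e / 4) ≤ (1 - 3 * e / 4) * J.card + K := by
      rw [div_le_iff₀ (by linarith)]
      have h6 : 0 ≤ e * K := by positivity
      have h7 : 0 ≤ e ^ 2 * (J.card : ℝ) := by positivity
      nlinarith
    have h6 := mul_le_mul_of_nonneg_left h5 ht
    linarith
  · exact ((measurable_gaussianDensity _).mul
      ((measurable_testStat v J).const_mul _).exp).ennreal_ofReal

end Tests

/-! ### Gaussian divergences and likelihood ratios -/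

section Divergence

variable {n : ℕ}

/-- Trace of `A⁻¹ D B D` for nearly diagonal `A`, `B` and diagonal `D` with `D² b ≤ (1 + ρ) a`. -/
lemma trace_inv_mul_le {A B : Matrix (Fin n) (Fin n) ℝ} (hA : A.PosDef) {a b s : Fin n → ℝ}
    {α ρ σ K L : ℝ} (hα : 0 < α) (hlow : ∀ x : Fin n → ℝ, α * (x ⬝ᵥ x) ≤ x ⬝ᵥ (A *ᵥ x))
    (hK : 0 ≤ K) (hEA : ∀ i j, |(A - Matrix.diagonal a) i j| ≤ K / n)
    (hL : 0 ≤ L) (hEB : ∀ i j, |(B - Matrix.diagonal b) i j| ≤ L / n)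
    (hρ : 0 ≤ ρ) (hs : ∀ i, s i ^ 2 * b i ≤ (1 + ρ) * a i) (hσ : ∀ i, s i ^ 2 ≤ σ) (hσ0 : 0 ≤ σ) :
    (A⁻¹ * (Matrix.diagonal s * B * Matrix.diagonal s)).trace ≤
      (1 + ρ) * (n + α⁻¹ * K * Real.sqrt n) + α⁻¹ * (σ * L) * Real.sqrt n := by
  have hinv := inv_mulVec_sq_le hA hα hlow
  have hαi : 0 ≤ α⁻¹ := (inv_pos.mpr hα).le
  set E := Matrix.diagonal s * (B - Matrix.diagonal b) * Matrix.diagonal s with hE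
  have h1 : Matrix.diagonal s * B * Matrix.diagonal s =
      Matrix.diagonal (fun i => s i ^ 2 * b i) + E := by
    rw [hE, Matrix.mul_sub, Matrix.sub_mul, Matrix.diagonal_mul_diagonal,
      Matrix.diagonal_mul_diagonal]
    have : (fun i => s i * b i * s i) = fun i => s i ^ 2 * b i := by funext i; ring
    rw [this]
    abel
  have h2 : (A⁻¹ * E).trace ≤ α⁻¹ * (σ * L) * Real.sqrt n := by
    have := abs_trace_mul_le (E := E) (K := σ * L) hαi (mul_nonneg hσ0 hL) hinv (by
      intro i j
      rw [hE, Matrix.mul_diagonal, Matrix.diagonal_mul, Fintype.card_fin]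
      have h3 : |s i * s j| ≤ σ := by
        rw [abs_le]
        constructor <;> nlinarith [hσ i, hσ j, sq_nonneg (s i - s j), sq_nonneg (s i + s j)]
      calc _ = |s i * s j| * |(B - Matrix.diagonal b) i j| := by rw [← abs_mul]; ring_nf
        _ ≤ σ * (L / n) := mul_le_mul h3 (hEB i j) (abs_nonneg _) hσ0
        _ = _ := by ring)
    rw [Fintype.card_fin] at this
    exact (le_abs_self _).trans this
  have h3 : (A⁻¹ * Matrix.diagonal fun i => s i ^ 2 * b i).trace ≤
      (1 + ρ) * (A⁻¹ * Matrix.diagonal a).trace := by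
    simp only [Matrix.trace, Matrix.diag_apply, Matrix.mul_diagonal]
    rw [Finset.mul_sum]
    refine Finset.sum_le_sum fun i _ => ?_
    have h4 : 0 ≤ A⁻¹ i i := hA.inv.posSemidef.diag_nonneg
    calc _ ≤ A⁻¹ i i * ((1 + ρ) * a i) := mul_le_mul_of_nonneg_left (hs i) h4
      _ = _ := by ring
  -- `tr (A⁻¹ diag a) = n - tr (A⁻¹ (A - diag a))`, and an error with entries of order `1/n`
  -- contributes only `O(√n)` to the trace.
  have h4 : (A⁻¹ * Matrix.diagonal a).trace ≤ n + α⁻¹ * K * Real.sqrt n := by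
    have h5 := abs_trace_mul_le (E := A - Matrix.diagonal a) (K := K) hαi hK hinv (by
      intro i j
      rw [Fintype.card_fin]
      exact hEA i j)
    rw [Fintype.card_fin, Matrix.mul_sub, Matrix.trace_sub, inv_mul_of_posDef hA,
      Matrix.trace_one, Fintype.card_fin] at h5
    linarith [(abs_le.mp h5).1]
  rw [h1, Matrix.mul_add, Matrix.trace_add]
  have h5 := mul_le_mul_of_nonneg_left h4 (by positivity : 0 ≤ 1 + ρ)
  linarith

lemma integral_quad {μ : Measure (Fin n → ℝ)} {S₀ : Matrix (Fin n) (Fin n) ℝ}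
    (hint : ∀ s t, Integrable (fun z : Fin n → ℝ => z s * z t) μ)
    (hmom : ∀ s t, ∫ z, z s * z t ∂μ = S₀ s t) (hsymm : S₀ᵀ = S₀)
    (M : Matrix (Fin n) (Fin n) ℝ) :
    Integrable (fun z : Fin n → ℝ => z ⬝ᵥ (M *ᵥ z)) μ ∧
      ∫ z, z ⬝ᵥ (M *ᵥ z) ∂μ = (M * S₀).trace := by
  have h : (fun z : Fin n → ℝ => z ⬝ᵥ (M *ᵥ z)) =
      fun z => ∑ s, ∑ t, M s t * (z s * z t) := by
    funext z
    simp only [dotProduct, Matrix.mulVec, Finset.mul_sum]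
    exact Finset.sum_congr rfl fun s _ => Finset.sum_congr rfl fun t _ => by ring
  have hi : ∀ s t, Integrable (fun z : Fin n → ℝ => M s t * (z s * z t)) μ := fun s t =>
    (hint s t).const_mul _
  rw [h]
  refine ⟨integrable_finsetSum _ fun s _ => integrable_finsetSum _ fun t _ => hi s t, ?_⟩
  rw [integral_finsetSum _ fun s _ => integrable_finsetSum _ fun t _ => hi s t]
  simp only [Matrix.trace, Matrix.diag_apply, Matrix.mul_apply]
  refine Finset.sum_congr rfl fun s _ => ?_
  rw [integral_finsetSum _ fun t _ => hi s t]
  refine Finset.sum_congr rfl fun t _ => ?_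
  rw [integral_const_mul, hmom]
  congr 1
  exact (congrFun (congrFun hsymm s) t).symm

/-- Log-likelihood ratio of centred Gaussian densities. -/
lemma log_gaussianDensity_sub {S₀ S : Matrix (Fin n) (Fin n) ℝ} (hS₀ : S₀.PosDef)
    (hS : S.PosDef) (z : Fin n → ℝ) :
    Real.log (gaussianDensity S₀ z) - Real.log (gaussianDensity S z) =
      (Real.log S.det - Real.log S₀.det) / 2 +
        (z ⬝ᵥ (S⁻¹ *ᵥ z) - z ⬝ᵥ (S₀⁻¹ *ᵥ z)) / 2 := by
  have key : ∀ {T : Matrix (Fin n) (Fin n) ℝ}, T.PosDef → Real.log (gaussianDensity T z) =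
      -(Real.log ((2 * Real.pi) ^ n) + Real.log T.det) / 2 - (z ⬝ᵥ (T⁻¹ *ᵥ z)) / 2 := by
    intro T hT
    have hd := hT.det_pos
    have h2 : (0 : ℝ) < (2 * Real.pi) ^ n := by positivity
    rw [gaussianDensity, Real.log_mul (by positivity) (Real.exp_ne_zero _), Real.log_inv,
      Real.log_sqrt (by positivity), Real.log_exp, Real.log_mul h2.ne' hd.ne']
    ring
  rw [key hS₀, key hS]
  ring

/-- The likelihood ratio is rarely much smaller than the symmetrized divergence suggests. -/
lemma measure_gaussianDensity_lt_le {μ : Measure (Fin n → ℝ)} [IsProbabilityMeasure μ]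
    {S₀ S : Matrix (Fin n) (Fin n) ℝ} (hS₀ : S₀.PosDef) (hS : S.PosDef)
    (hμ : μ = volume.withDensity fun z => ENNReal.ofReal (gaussianDensity S₀ z))
    (hint : ∀ s t, Integrable (fun z : Fin n → ℝ => z s * z t) μ)
    (hmom : ∀ s t, ∫ z, z s * z t ∂μ = S₀ s t) {x : ℝ} (hx : 0 < x) :
    μ {z | gaussianDensity S z < Real.exp (-x) * gaussianDensity S₀ z} ≤
      ENNReal.ofReal ((((S⁻¹ * S₀).trace - n + ((S₀⁻¹ * S).trace - n)) / 2 + 1) / x) := by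
  set Y : (Fin n → ℝ) → ℝ := fun z =>
    Real.log (gaussianDensity S₀ z) - Real.log (gaussianDensity S z) with hY
  have hp0 := gaussianDensity_pos hS₀
  have hp := gaussianDensity_pos hS
  have hexp : ∀ z, Real.exp (-Y z) = gaussianDensity S z / gaussianDensity S₀ z := by
    intro z
    rw [hY]
    simp only [neg_sub]
    rw [Real.exp_sub, Real.exp_log (hp z), Real.exp_log (hp0 z)]
  obtain ⟨hi1, he1⟩ := integral_quad hint hmom (transpose_eq_of_posDef hS₀) S⁻¹
  obtain ⟨hi0, he0⟩ := integral_quad hint hmom (transpose_eq_of_posDef hS₀) S₀⁻¹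
  have hYeq : Y = fun z => (Real.log S.det - Real.log S₀.det) / 2 +
        (z ⬝ᵥ (S⁻¹ *ᵥ z) - z ⬝ᵥ (S₀⁻¹ *ᵥ z)) / 2 := by
    funext z
    exact log_gaussianDensity_sub hS₀ hS z
  have hYi : Integrable Y μ := by
    rw [hYeq]
    exact (integrable_const _).add ((hi1.sub hi0).div_const 2)
  have hYint : ∫ z, Y z ∂μ ≤ ((S⁻¹ * S₀).trace - n + ((S₀⁻¹ * S).trace - n)) / 2 := by
    have hd : Integrable (fun z : Fin n → ℝ => z ⬝ᵥ (S⁻¹ *ᵥ z) - z ⬝ᵥ (S₀⁻¹ *ᵥ z)) μ := hi1.sub hi0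
    simp only [hYeq]
    rw [integral_add (integrable_const _) (hd.div_const 2), integral_const, integral_div,
      integral_sub hi1 hi0, he1, he0, inv_mul_of_posDef hS₀, Matrix.trace_one, Fintype.card_fin]
    -- The log-determinants are eliminated by bounding their difference by `tr (S₀⁻¹ S) - n`; this
    -- is what symmetrizes the divergence.
    have hdet := det_le_det_mul_exp hS₀ hS
    have hlog := Real.log_le_log hS.det_pos hdet
    rw [Real.log_mul hS₀.det_pos.ne' (Real.exp_ne_zero _), Real.log_exp, Fintype.card_fin] at hlog
    simp only [probReal_univ, one_smul]
    linarith
  have hEmeas : Measurable fun z => Real.exp (-Y z) := by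
    simp only [hexp]
    exact (measurable_gaussianDensity S).div (measurable_gaussianDensity S₀)
  have hEl : ∫⁻ z, ENNReal.ofReal (Real.exp (-Y z)) ∂μ = 1 := by
    rw [hμ, lintegral_withDensity_eq_lintegral_mul _
      (measurable_gaussianDensity S₀).ennreal_ofReal hEmeas.ennreal_ofReal]
    rw [← lintegral_gaussianDensity hS]
    refine lintegral_congr fun z => ?_
    rw [Pi.mul_apply, ← ENNReal.ofReal_mul (hp0 z).le, hexp, mul_div_cancel₀ _ (hp0 z).ne']
  -- Adding `exp (-Y)`, which has mean `1`, to the log-ratio `Y` makes it nonnegative, so Markov's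
  -- inequality applies with no second-moment estimate of `Y`.
  have hnn : ∀ z, 0 ≤ Y z + Real.exp (-Y z) := fun z => by
    have := Real.add_one_le_exp (-Y z)
    linarith
  have hEi : Integrable (fun z => Real.exp (-Y z)) μ := by
    refine ⟨hEmeas.aestronglyMeasurable, ?_⟩
    rw [hasFiniteIntegral_iff_ofReal (Eventually.of_forall fun z => Real.exp_nonneg _), hEl]
    exact ENNReal.one_lt_top
  have hEint : ∫ z, Real.exp (-Y z) ∂μ = 1 := by
    rw [integral_eq_lintegral_of_nonneg_ae (Eventually.of_forall fun z => Real.exp_nonneg _)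
      hEmeas.aestronglyMeasurable, hEl, ENNReal.toReal_one]
  have hsub : {z | gaussianDensity S z < Real.exp (-x) * gaussianDensity S₀ z} ⊆
      {z | x ≤ Y z + Real.exp (-Y z)} := by
    intro z hz
    have hz' : gaussianDensity S z < Real.exp (-x) * gaussianDensity S₀ z := hz
    have h1 : Real.exp (-Y z) < Real.exp (-x) := by
      rw [hexp, div_lt_iff₀ (hp0 z)]
      exact hz'
    have h2 := Real.exp_lt_exp.mp h1
    have h3 := Real.exp_nonneg (-Y z)
    change x ≤ _
    linarith
  have hmk := mul_meas_ge_le_integral_of_nonneg (Eventually.of_forall hnn) (hYi.add hEi) x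
  have hle : ∫ z, (Y z + Real.exp (-Y z)) ∂μ ≤
      ((S⁻¹ * S₀).trace - n + ((S₀⁻¹ * S).trace - n)) / 2 + 1 := by
    rw [integral_add hYi hEi, hEint]
    linarith
  refine (measure_mono hsub).trans ?_
  rw [← ENNReal.ofReal_toReal (measure_ne_top μ _)]
  refine ENNReal.ofReal_le_ofReal ?_
  rw [le_div_iff₀ hx, mul_comm]
  exact hmk.trans hle

end Divergence

/-! ### A general consistency theorem -/

section Consistency

variable {Θ : Type*} [MeasurableSpace Θ] {Pr : Measure Θ} [IsProbabilityMeasure Pr]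

/-- The finite-sample bound. Three events are removed: most of `U` has small likelihood, the test
rejects, or the numerator is large although the test accepts. Measurability of `A` and `A'` is not
required; the numerator over `A` is only compared with the one over `A'`. -/
lemma measure_posterior_gt_le {X : Type*} [MeasurableSpace X] {ν : Measure X} [SFinite ν]
    {p₀ : X → ℝ≥0∞} {L : Θ → X → ℝ≥0∞} (hp₀ : Measurable p₀)
    (hL : Measurable (Function.uncurry L)) {A A' U : Set Θ} {R : Set X} (hU : MeasurableSet U)
    (hU0 : Pr U ≠ 0) (hR : MeasurableSet R) (hA : A ≤ᵐ[Pr] A') {a κ δ : ℝ≥0∞} (ha : a ≠ 0)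
    (ha' : a ≠ ⊤) (hδ : δ ≠ 0) (hδ' : δ ≠ ⊤)
    (hκ : ∀ θ ∈ U, ν.withDensity p₀ {z | L θ z < a * p₀ z} ≤ κ) :
    ν.withDensity p₀ {z | δ < (∫⁻ θ, L θ z ∂Pr)⁻¹ * ∫⁻ θ in A, L θ z ∂Pr} ≤
      2 * κ + ν.withDensity p₀ R +
        (δ * (Pr U / 2) * a)⁻¹ * ∫⁻ z in Rᶜ, ∫⁻ θ in A', L θ z ∂Pr ∂ν := by
  set μ := ν.withDensity p₀ with hμ
  set u := Pr U with hu
  have hu' : u ≠ ⊤ := measure_ne_top _ _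
  have hu2 : u / 2 ≠ 0 := (ENNReal.half_pos hU0).ne'
  have hu2' : u / 2 ≠ ⊤ := (ENNReal.half_lt_self hU0 hu').ne_top |> fun h => by
    simpa using h
  set S : Set (Θ × X) := {q | q.1 ∈ U ∧ L q.1 q.2 < a * p₀ q.2} with hSdef
  have hS : MeasurableSet S :=
    (measurable_fst hU).inter (measurableSet_lt hL ((hp₀.comp measurable_snd).const_mul a))
  -- `G z` is the prior mass of the `θ` in `U` with too small a likelihood at `z`. By Fubini its
  -- mean is at most `κ u`, and Markov's inequality at level `u/2` gives probability at most `2κ`.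
  set G : X → ℝ≥0∞ := fun z => Pr ((fun θ => (θ, z)) ⁻¹' S) with hG
  have hGm : Measurable G := measurable_measure_prodMk_right hS
  have hGint : ∫⁻ z, G z ∂μ ≤ κ * u := by
    rw [hG, ← Measure.prod_apply_symm hS, Measure.prod_apply hS]
    calc _ ≤ ∫⁻ θ, U.indicator (fun _ => κ) θ ∂Pr := by
          refine lintegral_mono fun θ => ?_
          by_cases hθ : θ ∈ U
          · rw [Set.indicator_of_mem hθ]
            exact (measure_mono fun z hz => hz.2).trans (hκ θ hθ)
          · rw [Set.indicator_of_notMem hθ]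
            have : Prod.mk θ ⁻¹' S = ∅ := by
              ext z
              simp [hSdef, hθ]
            simp [this]
      _ = κ * u := by rw [lintegral_indicator_const hU]
  have hbad : μ {z | u / 2 ≤ G z} ≤ 2 * κ := by
    have h1 := (mul_meas_ge_le_lintegral hGm (u / 2) (μ := μ)).trans hGint
    have h2 : κ * u = u / 2 * (2 * κ) := by
      rw [← mul_assoc, ENNReal.div_mul_cancel two_ne_zero ENNReal.ofNat_ne_top, mul_comm]
    rw [h2] at h1
    exact (ENNReal.mul_le_mul_iff_right hu2 hu2').mp h1
  set N : X → ℝ≥0∞ := fun z => ∫⁻ θ in A', L θ z ∂Pr with hN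
  have hNm : Measurable N := hL.lintegral_prod_left'
  set q := δ * (u / 2) * a with hq
  have hq0 : q ≠ 0 := mul_ne_zero (mul_ne_zero hδ hu2) ha
  have hq' : q ≠ ⊤ := ENNReal.mul_ne_top (ENNReal.mul_ne_top hδ' hu2') ha'
  set W : Set X := {z | z ∈ Rᶜ ∧ q * p₀ z ≤ N z} with hW
  have hWm : MeasurableSet W := hR.compl.inter (measurableSet_le (hp₀.const_mul q) hNm)
  -- If `G z < u/2`, at least half of `U` contributes `a p₀` to the denominator, so posterior mass
  -- above `δ` forces the numerator to exceed `q p₀`.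
  have hsub : {z | δ < (∫⁻ θ, L θ z ∂Pr)⁻¹ * ∫⁻ θ in A, L θ z ∂Pr} ⊆
      ({z | u / 2 ≤ G z} ∪ R) ∪ W := by
    intro z hz
    by_contra hcon
    simp only [Set.mem_union, not_or] at hcon
    obtain ⟨⟨hz1, hz2⟩, hz3⟩ := hcon
    have hGz : G z < u / 2 := not_le.mp hz1
    refine hz3 ⟨hz2, ?_⟩
    have hLz : Measurable fun θ => L θ z := hL.of_uncurry_right
    set V : Set Θ := {θ | θ ∈ U ∧ a * p₀ z ≤ L θ z} with hV
    have hVm : MeasurableSet V := hU.inter (measurableSet_le measurable_const hLz)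
    have hVmass : u / 2 ≤ Pr V := by
      by_contra hlt
      have h1 : u ≤ G z + Pr V := by
        refine (measure_mono fun θ hθ => ?_).trans (measure_union_le _ _)
        rcases lt_or_ge (L θ z) (a * p₀ z) with h | h
        · exact Or.inl ⟨hθ, h⟩
        · exact Or.inr ⟨hθ, h⟩
      have h2 : G z + Pr V < u / 2 + u / 2 := ENNReal.add_lt_add hGz (not_le.mp hlt)
      rw [ENNReal.add_halves] at h2
      exact absurd (h1.trans_lt h2) (lt_irrefl _)
    have hden : a * p₀ z * (u / 2) ≤ ∫⁻ θ, L θ z ∂Pr :=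
      calc _ ≤ a * p₀ z * Pr V := mul_le_mul_right hVmass _
        _ = ∫⁻ _ in V, a * p₀ z ∂Pr := by rw [setLIntegral_const]
        _ ≤ ∫⁻ θ in V, L θ z ∂Pr := setLIntegral_mono hLz fun θ hθ => hθ.2
        _ ≤ _ := setLIntegral_le_lintegral _ _
    have hz' : δ ≤ (∫⁻ θ in A, L θ z ∂Pr) / ∫⁻ θ, L θ z ∂Pr := by
      rw [ENNReal.div_eq_inv_mul]
      exact le_of_lt hz
    have hnum : ∫⁻ θ in A, L θ z ∂Pr ≤ N z := lintegral_mono' (Measure.restrict_mono' hA le_rfl) le_rfl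
    calc q * p₀ z = δ * (a * p₀ z * (u / 2)) := by rw [hq]; ring
      _ ≤ δ * ∫⁻ θ, L θ z ∂Pr := mul_le_mul_right hden _
      _ ≤ _ := (ENNReal.mul_le_of_le_div hz').trans hnum
  have hWμ : μ W ≤ q⁻¹ * ∫⁻ z in Rᶜ, N z ∂ν := by
    rw [hμ, withDensity_apply _ hWm]
    calc _ ≤ ∫⁻ z in W, q⁻¹ * N z ∂ν := by
          refine setLIntegral_mono (hNm.const_mul _) fun z hz => ?_
          rw [← ENNReal.div_eq_inv_mul, ENNReal.le_div_iff_mul_le (Or.inl hq0) (Or.inl hq'),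
            mul_comm]
          exact hz.2
      _ ≤ ∫⁻ z in Rᶜ, q⁻¹ * N z ∂ν := lintegral_mono_set fun z hz => hz.1
      _ = _ := lintegral_const_mul _ hNm
  calc _ ≤ μ (({z | u / 2 ≤ G z} ∪ R) ∪ W) := measure_mono hsub
    _ ≤ μ {z | u / 2 ≤ G z} + μ R + μ W :=
        (measure_union_le _ _).trans (add_le_add (measure_union_le _ _) le_rfl)
    _ ≤ _ := add_le_add (add_le_add hbad le_rfl) hWμ

/-- Posterior consistency: enough prior mass near the truth, and exponentially powerful tests
against the complement of a neighbourhood. -/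
lemma tendsto_posterior_zero {p₀ : ∀ n : ℕ, (Fin n → ℝ) → ℝ≥0∞}
    {L : ∀ n : ℕ, Θ → (Fin n → ℝ) → ℝ≥0∞} (hp₀ : ∀ n, Measurable (p₀ n))
    (hL : ∀ n, Measurable (Function.uncurry (L n))) {A : Set Θ}
    (hU : ∀ δ : ℝ, 0 < δ → ∀ κ : ℝ, 0 < κ → ∃ U : Set Θ, MeasurableSet U ∧ 0 < Pr U ∧
      ∀ᶠ n : ℕ in atTop, ∀ θ ∈ U, volume.withDensity (p₀ n)
        {z | L n θ z < ENNReal.ofReal (Real.exp (-(δ * n))) * p₀ n z} ≤ ENNReal.ofReal κ)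
    {b K : ℝ} (hb : 0 < b)
    (hR : ∀ᶠ n : ℕ in atTop, ∃ R : Set (Fin n → ℝ), ∃ A' : Set Θ, MeasurableSet R ∧ A ≤ᵐ[Pr] A' ∧
      volume.withDensity (p₀ n) R ≤ ENNReal.ofReal (K * Real.exp (-(b * n))) ∧
      ∫⁻ z in Rᶜ, ∫⁻ θ in A', L n θ z ∂Pr ≤ ENNReal.ofReal (K * Real.exp (-(b * n))))
    {δ : ℝ} (hδ : 0 < δ) :
    Tendsto (fun n : ℕ => volume.withDensity (p₀ n) {z | ENNReal.ofReal δ <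
      (∫⁻ θ, L n θ z ∂Pr)⁻¹ * ∫⁻ θ in A, L n θ z ∂Pr}) atTop (𝓝 0) := by
  rw [ENNReal.tendsto_nhds_zero]
  intro x hx
  obtain ⟨y, hy0, hyx⟩ := ENNReal.lt_iff_exists_nnreal_btwn.mp hx
  have hy : 0 < (y : ℝ) := by exact_mod_cast hy0
  have hy' : ENNReal.ofReal (y : ℝ) = y := ENNReal.ofReal_coe_nnreal
  -- With likelihood loss `exp(-bn/2)` in the denominator, the test bound `exp(-bn)` still leaves
  -- `exp(-bn/2)`. The level `y/4` is counted twice, and a third `y/4` absorbs the vanishing terms.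
  obtain ⟨U, hUm, hU0, hUn⟩ := hU (b / 2) (by positivity) (y / 4) (by positivity)
  have hexp : ∀ c : ℝ, 0 < c → Tendsto (fun n : ℕ => Real.exp (-(c * n))) atTop (𝓝 0) := by
    intro c hc
    exact Real.tendsto_exp_neg_atTop_nhds_zero.comp
      (tendsto_natCast_atTop_atTop.const_mul_atTop hc)
  have hδ0 : ENNReal.ofReal δ ≠ 0 := by simpa using hδ
  set q := ENNReal.ofReal δ * (Pr U / 2) with hq
  have hq0 : q ≠ 0 := mul_ne_zero hδ0 (ENNReal.half_pos hU0.ne').ne'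
  have hlim : Tendsto (fun n : ℕ => ENNReal.ofReal (K * Real.exp (-(b * n))) +
      q⁻¹ * ENNReal.ofReal (K * Real.exp (-(b / 2 * n)))) atTop (𝓝 0) := by
    have h1 : ∀ c : ℝ, 0 < c →
        Tendsto (fun n : ℕ => ENNReal.ofReal (K * Real.exp (-(c * n)))) atTop (𝓝 0) := by
      intro c hc
      have := ENNReal.tendsto_ofReal ((hexp c hc).const_mul K)
      simpa using this
    have h2 := ENNReal.Tendsto.const_mul (a := q⁻¹) (h1 (b / 2) (by positivity))
      (Or.inr (ENNReal.inv_ne_top.mpr hq0))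
    simpa using (h1 b hb).add h2
  have hsmall : (0 : ℝ≥0∞) < ENNReal.ofReal (y / 4) := by simpa using hy
  filter_upwards [hUn, hR, (ENNReal.tendsto_nhds_zero.mp hlim) _ hsmall] with n h1 h2 h3
  obtain ⟨R, A', hRm, hAA', hR1, hR2⟩ := h2
  have ha : ENNReal.ofReal (Real.exp (-(b / 2 * n))) ≠ 0 := by
    simpa using Real.exp_pos _
  refine (measure_posterior_gt_le (hp₀ n) (hL n) hUm hU0.ne' hRm hAA' ha ENNReal.ofReal_ne_top hδ0
    ENNReal.ofReal_ne_top h1).trans ?_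
  rw [← hq]
  have h4 : (q * ENNReal.ofReal (Real.exp (-(b / 2 * n))))⁻¹ *
      ∫⁻ z in Rᶜ, ∫⁻ θ in A', L n θ z ∂Pr ≤
      q⁻¹ * ENNReal.ofReal (K * Real.exp (-(b / 2 * n))) := by
    rw [ENNReal.mul_inv (Or.inl hq0) (Or.inr ha), mul_assoc,
      ← ENNReal.ofReal_inv_of_pos (Real.exp_pos _)]
    refine mul_le_mul_right ((mul_le_mul_right hR2 _).trans ?_) _
    rw [← ENNReal.ofReal_mul (by positivity), ← Real.exp_neg, mul_left_comm, ← Real.exp_add]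
    refine le_of_eq ?_
    congr 3
    ring
  calc _ ≤ 2 * ENNReal.ofReal (y / 4) + ENNReal.ofReal (K * Real.exp (-(b * n))) +
        q⁻¹ * ENNReal.ofReal (K * Real.exp (-(b / 2 * n))) :=
        add_le_add (add_le_add le_rfl hR1) h4
    _ ≤ 2 * ENNReal.ofReal (y / 4) + ENNReal.ofReal (y / 4) := by
        rw [add_assoc]
        exact add_le_add le_rfl h3
    _ = ENNReal.ofReal (2 * (y / 4) + y / 4) := by
        rw [ENNReal.ofReal_add (by positivity) (by positivity),
          ENNReal.ofReal_mul zero_le_two, ENNReal.ofReal_ofNat]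
    _ ≤ ENNReal.ofReal y := ENNReal.ofReal_le_ofReal (by linarith)
    _ ≤ x := by rw [hy']; exact hyx.le

end Consistency

/-! ### The corrected likelihood under the prior -/

section Likelihood

variable {γ₀ γp : ℤ → ℝ} {β₀ βp η : ℝ} {n : ℕ}

lemma trueCorrection_pos (h₀ : IsRegular γ₀ β₀) (hp : IsRegular γp βp) {l : ℝ}
    (hl : l ∈ Set.Icc 0 Real.pi) : 0 < trueCorrection γ₀ γp η l :=
  div_pos (h₀.pos.trans_le (h₀.le_spectralDensity hl))
    (Real.rpow_pos_of_pos (hp.pos.trans_le (hp.le_spectralDensity hl)) _)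

lemma continuousOn_trueCorrection (h₀ : IsRegular γ₀ β₀) (hp : IsRegular γp βp) :
    ContinuousOn (trueCorrection γ₀ γp η) (Set.Icc 0 Real.pi) := by
  have hne : ∀ l ∈ Set.Icc 0 Real.pi, 0 < spectralDensity γp l := fun l hl =>
    hp.pos.trans_le (hp.le_spectralDensity hl)
  refine (continuous_spectralDensity h₀.summable).continuousOn.div
    ((continuous_spectralDensity hp.summable).continuousOn.rpow_const
      fun l hl => Or.inl (hne l hl).ne') fun l hl => ?_
  exact (Real.rpow_pos_of_pos (hne l hl) _).ne'

/-- The factor that links correction functions and variances in Fourier coordinates. -/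
noncomputable def linkFactor (γp : ℤ → ℝ) (η : ℝ) (n : ℕ) (i : Fin n) : ℝ :=
  2 * Real.pi * spectralDensity γp (rowFreq n i) ^ η

lemma linkFactor_pos (hp : IsRegular γp βp) (i : Fin n) : 0 < linkFactor γp η n i :=
  mul_pos (by positivity)
    (Real.rpow_pos_of_pos (hp.pos.trans_le (hp.le_spectralDensity (rowFreq_mem i))) _)

/-- The power `η - 1` in `C_n` and the power `1` from the working covariance combine to `f_param^η`;
at `c = c_{0,η}` the product is `2π f₀`, by `trueCorrection_mul_linkFactor`. -/
lemma correctionDiag_mul_specDiag (hp : IsRegular γp βp) (c : ℝ → ℝ) (i : Fin n) :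
    correctionDiag γp η n c i * specDiag γp n i = c (rowFreq n i) * linkFactor γp η n i := by
  have h := hp.pos.trans_le (hp.le_spectralDensity (rowFreq_mem i))
  rw [correctionDiag, specDiag, linkFactor, Real.rpow_sub_one h.ne']
  field_simp

lemma trueCorrection_mul_linkFactor (hp : IsRegular γp βp) (i : Fin n) :
    trueCorrection γ₀ γp η (rowFreq n i) * linkFactor γp η n i = specDiag γ₀ n i := by
  have h := Real.rpow_pos_of_pos (hp.pos.trans_le (hp.le_spectralDensity (rowFreq_mem i))) η
  rw [trueCorrection, specDiag, linkFactor]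
  field_simp

lemma specDiag_le_covBound (h₀ : IsRegular γ₀ β₀) (i : Fin n) : specDiag γ₀ n i ≤ covBound γ₀ :=
  spectralDensity_le h₀.summable _

lemma trace_correctedCov_inv_mul {A B : Matrix (Fin n) (Fin n) ℝ} (hA : A.PosDef) {C : Fin n → ℝ}
    (hC : ∀ i, 0 < C i) :
    ((correctedCov A C)⁻¹ * B).trace = ((fourierCov A)⁻¹ *
      (Matrix.diagonal (fun i => (Real.sqrt (C i))⁻¹) * fourierCov B *
        Matrix.diagonal fun i => (Real.sqrt (C i))⁻¹)).trace := by
  rw [correctedCov_inv hA hC, ← fourierCov_fourierConj_mul_mul, ← fourierCov_inv hA,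
    ← fourierCov_mul, trace_fourierCov]
  set T := fourierConj n fun i => (Real.sqrt (C i))⁻¹
  rw [Matrix.mul_assoc, Matrix.mul_assoc, Matrix.trace_mul_comm]
  simp only [Matrix.mul_assoc]

lemma trace_inv_mul_correctedCov {A B : Matrix (Fin n) (Fin n) ℝ} (hB : B.PosDef)
    (C : Fin n → ℝ) :
    (B⁻¹ * correctedCov A C).trace = ((fourierCov B)⁻¹ *
      (Matrix.diagonal (fun i => Real.sqrt (C i)) * fourierCov A *
        Matrix.diagonal fun i => Real.sqrt (C i))).trace := by
  rw [← fourierCov_fourierConj_mul_mul, ← fourierCov_inv hB, ← fourierCov_mul, trace_fourierCov,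
    correctedCov]

/-- The symmetrized divergence from the true model is small for correction functions near the true
one. -/
lemma exists_divergence_bound (h₀ : IsRegular γ₀ β₀) (hp : IsRegular γp βp) :
    ∃ K : ℝ, ∀ (n : ℕ) (C : Fin n → ℝ) (ρ : ℝ), 0 ≤ ρ → ρ ≤ 1 / 2 → (∀ i, 0 < C i) →
      (∀ i, (1 - ρ) * specDiag γ₀ n i ≤ C i * specDiag γp n i) →
      (∀ i, C i * specDiag γp n i ≤ (1 + ρ) * specDiag γ₀ n i) →
      ((correctedCov (autocovMatrix γp n) C)⁻¹ * autocovMatrix γ₀ n).trace - n +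
        (((autocovMatrix γ₀ n)⁻¹ * correctedCov (autocovMatrix γp n) C).trace - n) ≤
        4 * ρ * n + K * Real.sqrt n := by
  set αp := 2 * Real.pi * βp with hαp
  set α₀ := 2 * Real.pi * β₀ with hα₀
  have hαp0 : 0 < αp := mul_pos (by positivity) hp.pos
  have hα₀0 : 0 < α₀ := mul_pos (by positivity) h₀.pos
  set Ep := errBound γp with hEp
  set E₀ := errBound γ₀ with hE₀
  have hEp0 : 0 ≤ Ep := errBound_nonneg γp
  have hE₀0 : 0 ≤ E₀ := errBound_nonneg γ₀
  -- `σ₁` bounds `1 / C_i` and `σ₂` bounds `C_i`; both follow from the two-sided comparison of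
  -- variances with `ρ ≤ 1/2`.
  set σ₁ := 2 * covBound γp / α₀ with hσ₁
  set σ₂ := 2 * covBound γ₀ / αp with hσ₂
  have hσ₁0 : 0 ≤ σ₁ := div_nonneg (mul_nonneg zero_le_two (covBound_nonneg _)) hα₀0.le
  have hσ₂0 : 0 ≤ σ₂ := div_nonneg (mul_nonneg zero_le_two (covBound_nonneg _)) hαp0.le
  refine ⟨2 * (αp⁻¹ * Ep) + αp⁻¹ * (σ₁ * E₀) + (2 * (α₀⁻¹ * E₀) + α₀⁻¹ * (σ₂ * Ep)), ?_⟩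
  intro n C ρ hρ hρ2 hC hlo hup
  -- `1/(1 - ρ) ≤ 1 + 2ρ` for `ρ ≤ 1/2`, so `2ρ` serves in both directions and the two traces
  -- together give `4ρn`.
  have h1 := trace_inv_mul_le (fourierCov_posDef (hp.posDef n)) (a := specDiag γp n)
    (B := fourierCov (autocovMatrix γ₀ n)) (b := specDiag γ₀ n)
    (s := fun i => (Real.sqrt (C i))⁻¹) (ρ := 2 * ρ) (σ := σ₁) hαp0 hp.le_quad_fourierCov hEp0
    hp.abs_err_le hE₀0 h₀.abs_err_le (by linarith) (fun i => by
      rw [inv_pow, Real.sq_sqrt (hC i).le, inv_mul_eq_div, div_le_iff₀ (hC i)]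
      have h2 := hlo i
      have h3 := h₀.specDiag_pos i
      nlinarith [mul_nonneg (by nlinarith : (0 : ℝ) ≤ (1 + 2 * ρ) * (1 - ρ) - 1) h3.le]) (fun i => by
      rw [inv_pow, Real.sq_sqrt (hC i).le, hσ₁, inv_le_iff_one_le_mul₀ (hC i), div_mul_eq_mul_div,
        le_div_iff₀ hα₀0]
      have h2 := hlo i
      have h3 := h₀.le_specDiag i
      have h4 := mul_le_mul_of_nonneg_left (specDiag_le_covBound hp i) (hC i).le
      nlinarith) hσ₁0
  have h2 := trace_inv_mul_le (fourierCov_posDef (h₀.posDef n)) (a := specDiag γ₀ n)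
    (B := fourierCov (autocovMatrix γp n)) (b := specDiag γp n)
    (s := fun i => Real.sqrt (C i)) (ρ := 2 * ρ) (σ := σ₂) hα₀0 h₀.le_quad_fourierCov hE₀0
    h₀.abs_err_le hEp0 hp.abs_err_le (by linarith) (fun i => by
      rw [Real.sq_sqrt (hC i).le]
      have h3 := h₀.specDiag_pos i
      nlinarith [hup i]) (fun i => by
      rw [Real.sq_sqrt (hC i).le, hσ₂, le_div_iff₀ hαp0]
      have h3 := hup i
      have h4 := mul_le_mul_of_nonneg_left (hp.le_specDiag i) (hC i).le
      have h5 := specDiag_le_covBound h₀ i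
      have h6 := h₀.specDiag_pos i
      nlinarith) hσ₂0
  rw [trace_correctedCov_inv_mul (hp.posDef n) hC, trace_inv_mul_correctedCov (h₀.posDef n) C]
  have hsq := Real.sqrt_nonneg n
  have h3 : 2 * ρ * (αp⁻¹ * Ep * Real.sqrt n) ≤ 1 * (αp⁻¹ * Ep * Real.sqrt n) :=
    mul_le_mul_of_nonneg_right (by linarith) (by positivity)
  have h4 : 2 * ρ * (α₀⁻¹ * E₀ * Real.sqrt n) ≤ 1 * (α₀⁻¹ * E₀ * Real.sqrt n) :=
    mul_le_mul_of_nonneg_right (by linarith) (by positivity)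
  linarith

lemma measurable_correctionFun (τ l : ℝ) :
    Measurable fun θ : ℕ × Measure ℝ => correctionFun τ θ l := by
  refine measurable_from_prod_countable_right fun k => ?_
  simp only [correctionFun, bernsteinDensity]
  refine Measurable.const_mul ?_ _
  exact Finset.measurable_fun_sum _ fun j _ => (measurable_eval_toReal measurableSet_Ioc).mul_const _

lemma measurable_correctedLikelihood (γp : ℤ → ℝ) (η τ : ℝ) (n : ℕ) :
    Measurable fun q : (ℕ × Measure ℝ) × (Fin n → ℝ) =>
      correctedLikelihood γp η n (correctionFun τ q.1) q.2 := by
  have hC : ∀ i : Fin n, Measurable fun q : (ℕ × Measure ℝ) × (Fin n → ℝ) =>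
      correctionDiag γp η n (correctionFun τ q.1) i := fun i =>
    ((measurable_correctionFun τ _).comp measurable_fst).mul_const _
  simp only [correctedLikelihood]
  refine Measurable.mul ?_ ?_
  · simp only [Matrix.det_diagonal]
    exact (Finset.measurable_fun_prod _ fun i _ => hC i).pow_const _
  · refine (measurable_gaussianDensity _).comp (measurable_pi_lambda _ fun i => ?_)
    simp only [Matrix.mulVec, dotProduct]
    refine Finset.measurable_fun_sum _ fun j _ => Measurable.mul ?_
      ((measurable_pi_apply j).comp measurable_snd)
    have hentry : ∀ d : Fin n → ℝ, ((fourierMatrix n)ᵀ * Matrix.diagonal d * fourierMatrix n) i j =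
        ∑ k, (fourierMatrix n)ᵀ i k * d k * fourierMatrix n k j := fun d => by
      rw [Matrix.mul_apply]
      simp only [Matrix.mul_diagonal]
    simp only [hentry]
    refine Finset.measurable_fun_sum _ fun k _ => Measurable.mul_const ?_ _
    exact ((hC k).pow_const _).const_mul _

lemma correctionFun_nonneg {τ : ℝ} (hτ : 0 ≤ τ) (θ : ℕ × Measure ℝ) {l : ℝ}
    (hl : l ∈ Set.Icc 0 Real.pi) : 0 ≤ correctionFun τ θ l := by
  obtain ⟨k, G⟩ := θ
  cases k with
  | zero => simp [correctionFun, bernsteinDensity]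
  | succ m =>
    rw [correctionFun_succ]
    exact mul_nonneg hτ (bernsteinPoly_eval_nonneg m G
      ⟨div_nonneg hl.1 Real.pi_pos.le, (div_le_one Real.pi_pos).mpr hl.2⟩)

lemma correctionDiag_nonneg (hp : IsRegular γp βp) {c : ℝ → ℝ}
    (hc : ∀ l ∈ Set.Icc 0 Real.pi, 0 ≤ c l) (i : Fin n) : 0 ≤ correctionDiag γp η n c i :=
  mul_nonneg (hc _ (rowFreq_mem i))
    (Real.rpow_nonneg (hp.pos.le.trans (hp.le_spectralDensity (rowFreq_mem i))) _)

/-- A corrected likelihood either vanishes or is a centred Gaussian density. -/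
lemma correctedLikelihood_eq_zero_or (hp : IsRegular γp βp) {c : ℝ → ℝ}
    (hc : ∀ l ∈ Set.Icc 0 Real.pi, 0 ≤ c l) :
    (∀ z : Fin n → ℝ, correctedLikelihood γp η n c z = 0) ∨
      ((∀ i, 0 < correctionDiag γp η n c i) ∧ ∀ z : Fin n → ℝ, correctedLikelihood γp η n c z =
        gaussianDensity (correctedCov (autocovMatrix γp n) (correctionDiag γp η n c)) z) := by
  by_cases h : ∀ i, 0 < correctionDiag γp η n c i
  · exact Or.inr ⟨h, correctedLikelihood_eq_gaussianDensity (hp.posDef n) h⟩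
  · push Not at h
    obtain ⟨i, hi⟩ := h
    exact Or.inl (correctedLikelihood_eq_zero (le_antisymm hi (correctionDiag_nonneg hp hc i)))

lemma lintegral_correctedLikelihood_le_one (hp : IsRegular γp βp) {c : ℝ → ℝ}
    (hc : ∀ l ∈ Set.Icc 0 Real.pi, 0 ≤ c l) :
    ∫⁻ z : Fin n → ℝ, ENNReal.ofReal (correctedLikelihood γp η n c z) ≤ 1 := by
  rcases correctedLikelihood_eq_zero_or (η := η) (n := n) hp hc with h | ⟨hC, h⟩
  · simp [h]
  · simp only [h]
    exact (lintegral_gaussianDensity (correctedCov_posDef (hp.posDef n) hC)).le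

end Likelihood

/-! ### A sieve of polynomial orders of size `n / log n` -/

section Sieve

/-- The largest polynomial order in the sieve. -/
noncomputable def sieveOrder (K : ℝ) (n : ℕ) : ℕ := ⌊K * n / Real.log (n + 1)⌋₊

lemma log_cast_add_one_pos {n : ℕ} (hn : 1 ≤ n) : 0 < Real.log ((n : ℝ) + 1) :=
  Real.log_pos (by have : (1 : ℝ) ≤ n := by exact_mod_cast hn
                   linarith)

lemma sieveOrder_le {K : ℝ} (hK : 0 ≤ K) {n : ℕ} (hn : 1 ≤ n) :
    (sieveOrder K n : ℝ) ≤ K * n / Real.log (n + 1) :=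
  Nat.floor_le (div_nonneg (by positivity) (log_cast_add_one_pos hn).le)

/-- The left side bounds the number of sublevel patterns on the sieve, and hence the number of tests
in the union bound. -/
lemma pow_sieveOrder_le {K : ℝ} (hK : 0 ≤ K) {n : ℕ} (hn : 1 ≤ n) :
    ((n : ℝ) + 1) ^ sieveOrder K n ≤ Real.exp (K * n) := by
  have hl := log_cast_add_one_pos hn
  have h := sieveOrder_le hK hn
  rw [le_div_iff₀ hl] at h
  rw [← Real.exp_log (by positivity : (0 : ℝ) < (n : ℝ) + 1), ← Real.exp_nat_mul,
    Real.exp_le_exp]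
  exact h

/-- The first order `r` beyond the sieve is at least `√(n+1)`, so `log r` is at least half of `log
(n+1)` and cancels the logarithm in the sieve. The prior tail beyond the sieve is thus exponentially
small in `n`. -/
lemma eventually_le_sieveOrder_mul_log {K : ℝ} (hK : 0 < K) : ∀ᶠ n : ℕ in atTop,
    K / 2 * n ≤ ((sieveOrder K n + 1 : ℕ) : ℝ) * Real.log ((sieveOrder K n + 1 : ℕ) : ℝ) := by
  have hlo := (isLittleO_log_rpow_atTop (r := 1 / 2) (by norm_num)).bound (half_pos hK)
  have hcast : Tendsto (fun n : ℕ => (n : ℝ) + 1) atTop atTop :=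
    tendsto_natCast_atTop_atTop.atTop_add tendsto_const_nhds
  filter_upwards [hcast.eventually hlo, eventually_ge_atTop 1] with n h1 hn
  have hl := log_cast_add_one_pos hn
  have hn1 : (1 : ℝ) ≤ n := by exact_mod_cast hn
  set x : ℝ := (n : ℝ) + 1 with hx
  have hx0 : 0 < x := by positivity
  rw [← Real.sqrt_eq_rpow, Real.norm_of_nonneg hl.le, Real.norm_of_nonneg (Real.sqrt_nonneg _)]
    at h1
  have hs := Real.sqrt_pos.mpr hx0
  have hss := Real.mul_self_sqrt hx0.le
  set r : ℝ := ((sieveOrder K n + 1 : ℕ) : ℝ) with hr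
  have hr1 : K * n / Real.log x ≤ r := by
    rw [hr]
    push_cast
    exact (Nat.lt_floor_add_one _).le
  have hr2 : Real.sqrt x ≤ r := by
    refine le_trans ?_ hr1
    rw [le_div_iff₀ hl]
    have := mul_le_mul_of_nonneg_left h1 hs.le
    nlinarith
  have hlog : Real.log x / 2 ≤ Real.log r := by
    rw [← Real.log_sqrt hx0.le]
    exact Real.log_le_log hs hr2
  calc K / 2 * n = K * n / Real.log x * (Real.log x / 2) := by field_simp
    _ ≤ r * Real.log r := mul_le_mul hr1 hlog (by positivity) (by positivity)

lemma eventually_sieveOrder_le {K : ℝ} (hK : 0 < K) {y : ℝ} (hy : 0 < y) :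
    ∀ᶠ n : ℕ in atTop, (sieveOrder K n : ℝ) ≤ y * n := by
  have hcast : Tendsto (fun n : ℕ => (n : ℝ) + 1) atTop atTop :=
    tendsto_natCast_atTop_atTop.atTop_add tendsto_const_nhds
  filter_upwards [(Real.tendsto_log_atTop.comp hcast).eventually_ge_atTop (K / y),
    eventually_ge_atTop 1] with n h1 hn
  refine (sieveOrder_le hK.le hn).trans ?_
  have hl := log_cast_add_one_pos hn
  rw [div_le_iff₀ hl]
  have h2 : K ≤ Real.log ((n : ℝ) + 1) * y := (div_le_iff₀ hy).mp h1
  have h3 := mul_le_mul_of_nonneg_right h2 (Nat.cast_nonneg n : (0 : ℝ) ≤ n)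
  linarith

end Sieve

/-! ### Prior mass and tests -/

section PriorMass

variable {γ₀ γp : ℤ → ℝ} {β₀ βp η τ : ℝ} {g₀ : ℝ → ℝ} {M : ℝ} {D : Measure (Measure ℝ)} {p : PMF ℕ}

lemma eventually_sqrt_le (K : ℝ) {y : ℝ} (hy : 0 < y) :
    ∀ᶠ n : ℕ in atTop, K * Real.sqrt n + 1 ≤ y * n := by
  have h : Tendsto (fun n : ℕ => Real.sqrt n) atTop atTop :=
    Real.tendsto_sqrt_atTop.comp tendsto_natCast_atTop_atTop
  filter_upwards [h.eventually_ge_atTop ((|K| + 1) / y), h.eventually_ge_atTop 1] with n h1 h2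
  rw [div_le_iff₀ hy] at h1
  have h3 := Real.mul_self_sqrt (Nat.cast_nonneg n : (0 : ℝ) ≤ n)
  have h4 := mul_le_mul_of_nonneg_right (le_abs_self K) (Real.sqrt_nonneg n)
  have h5 := mul_le_mul_of_nonneg_right h1 (Real.sqrt_nonneg n)
  calc K * Real.sqrt n + 1 ≤ (|K| + 1) * Real.sqrt n := by linarith
    _ ≤ Real.sqrt n * y * Real.sqrt n := h5
    _ = y * (Real.sqrt n * Real.sqrt n) := by ring
    _ = y * n := by rw [h3]

/-- Near the true correction function, the corrected likelihood is rarely much smaller than the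
true one. -/
lemma exists_good_likelihood_ratio (h₀ : IsRegular γ₀ β₀) (hp : IsRegular γp βp)
    (hprob : ∀ n, IsProbabilityMeasure ((volume : Measure (Fin n → ℝ)).withDensity fun z =>
      ENNReal.ofReal (gaussianDensity (autocovMatrix γ₀ n) z)))
    (hint : ∀ n s t, Integrable (fun z : Fin n → ℝ => z s * z t) (volume.withDensity fun z =>
      ENNReal.ofReal (gaussianDensity (autocovMatrix γ₀ n) z)))
    (hmom : ∀ n s t, ∫ z : Fin n → ℝ, z s * z t ∂(volume.withDensity fun z =>
      ENNReal.ofReal (gaussianDensity (autocovMatrix γ₀ n) z)) = autocovMatrix γ₀ n s t)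
    {a A : ℝ} (ha : 0 < a) (hg : ∀ x ∈ Set.Ioo (0 : ℝ) 1, a ≤ g₀ x ∧ g₀ x ≤ A) (hM : 0 < M)
    (hD : IsDirichletProcess D (ENNReal.ofReal M • baseMeasure g₀))
    (hpk : ∀ k : ℕ, 1 ≤ k → 0 < p k)
    (hτ : τ = ∫ x in (0 : ℝ)..1, trueCorrection γ₀ γp η (Real.pi * x))
    {δ κ : ℝ} (hδ : 0 < δ) (hκ : 0 < κ) :
    ∃ U : Set (ℕ × Measure ℝ), MeasurableSet U ∧ 0 < prior p D U ∧
      ∀ᶠ n : ℕ in atTop, ∀ θ ∈ U, (volume : Measure (Fin n → ℝ)).withDensity (fun z =>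
        ENNReal.ofReal (gaussianDensity (autocovMatrix γ₀ n) z))
        {z | ENNReal.ofReal (correctedLikelihood γp η n (correctionFun τ θ) z) <
          ENNReal.ofReal (Real.exp (-(δ * n))) *
            ENNReal.ofReal (gaussianDensity (autocovMatrix γ₀ n) z)} ≤ ENNReal.ofReal κ := by
  have hcont := continuousOn_trueCorrection (η := η) h₀ hp
  have hpos : ∀ l ∈ Set.Icc 0 Real.pi, 0 < trueCorrection γ₀ γp η l := fun l hl =>
    trueCorrection_pos h₀ hp hl
  obtain ⟨l₀, hl₀, hmin⟩ := isCompact_Icc.exists_isMinOn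
    (Set.nonempty_Icc.mpr Real.pi_pos.le) hcont
  set m := trueCorrection γ₀ γp η l₀ with hm
  have hm0 : 0 < m := hpos l₀ hl₀
  -- Half the divergence is `2ρn + (K/2)√n`; with this `ρ`, and with the `√n` term plus `1` at most
  -- `δκn/2`, Markov's inequality at `x = δn` gives `κ`.
  set ρ := min (1 / 2) (δ * κ / 4) with hρ
  have hρ0 : 0 < ρ := lt_min (by norm_num) (by positivity)
  have hρ1 : ρ ≤ 1 / 2 := min_le_left _ _
  have hρ2 : ρ ≤ δ * κ / 4 := min_le_right _ _
  -- A uniform radius of `ρ` times the minimum of `c₀` gives relative error at most `ρ`.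
  obtain ⟨U, hUm, hU0, hU⟩ := exists_prior_neighbourhood ha hg hM hD hpk hcont hpos hτ
    (mul_pos hρ0 hm0)
  obtain ⟨K, hK⟩ := exists_divergence_bound h₀ hp
  refine ⟨U, hUm, hU0, ?_⟩
  filter_upwards [eventually_sqrt_le (K / 2) (by positivity : 0 < δ * κ / 2),
    eventually_ge_atTop 1] with n hn hn1 θ hθ
  have hnpos : (0 : ℝ) < n := by exact_mod_cast hn1
  have hprob' := hprob n
  have hclose : ∀ i : Fin n, |correctionFun τ θ (rowFreq n i) -
      trueCorrection γ₀ γp η (rowFreq n i)| ≤ ρ * trueCorrection γ₀ γp η (rowFreq n i) :=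
    fun i => (hU θ hθ _ (rowFreq_mem i)).trans
      (mul_le_mul_of_nonneg_left (hmin (rowFreq_mem i)) hρ0.le)
  have hlo : ∀ i, (1 - ρ) * specDiag γ₀ n i ≤
      correctionDiag γp η n (correctionFun τ θ) i * specDiag γp n i := fun i => by
    rw [correctionDiag_mul_specDiag hp, ← trueCorrection_mul_linkFactor (η := η) hp, ← mul_assoc]
    refine mul_le_mul_of_nonneg_right ?_ (linkFactor_pos hp i).le
    linarith [(abs_le.mp (hclose i)).1]
  have hup : ∀ i, correctionDiag γp η n (correctionFun τ θ) i * specDiag γp n i ≤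
      (1 + ρ) * specDiag γ₀ n i := fun i => by
    rw [correctionDiag_mul_specDiag hp, ← trueCorrection_mul_linkFactor (η := η) hp, ← mul_assoc]
    refine mul_le_mul_of_nonneg_right ?_ (linkFactor_pos hp i).le
    linarith [(abs_le.mp (hclose i)).2]
  have hC : ∀ i, 0 < correctionDiag γp η n (correctionFun τ θ) i := fun i => by
    have h1 := mul_pos (by linarith : 0 < 1 - ρ) (h₀.specDiag_pos i)
    exact pos_of_mul_pos_left (h1.trans_le (hlo i)) (hp.specDiag_pos i).le
  have hS := correctedCov_posDef (hp.posDef n) hC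
  have hdiv := hK n _ ρ hρ0.le hρ1 hC hlo hup
  have hmk := measure_gaussianDensity_lt_le (h₀.posDef n) hS rfl (hint n) (hmom n)
    (mul_pos hδ hnpos)
  refine (measure_mono fun z hz => ?_).trans (hmk.trans (ENNReal.ofReal_le_ofReal ?_))
  · have hz' : ENNReal.ofReal (correctedLikelihood γp η n (correctionFun τ θ) z) <
      ENNReal.ofReal (Real.exp (-(δ * n))) *
        ENNReal.ofReal (gaussianDensity (autocovMatrix γ₀ n) z) := hz
    rw [← ENNReal.ofReal_mul (Real.exp_nonneg _),
      correctedLikelihood_eq_gaussianDensity (hp.posDef n) hC] at hz'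
    exact (ENNReal.ofReal_lt_ofReal_iff_of_nonneg (gaussianDensity_pos hS z).le).mp hz'
  · rw [div_le_iff₀ (mul_pos hδ hnpos)]
    have h1 := mul_le_mul_of_nonneg_right hρ2 hnpos.le
    linarith

end PriorMass

/-! ### Far correction functions are small at many Fourier frequencies -/

section Separation

variable {τ : ℝ}

lemma degree_bernsteinPoly_lt (m : ℕ) (G : Measure ℝ) (τ : ℝ) :
    (Polynomial.C τ * bernsteinPoly m G).degree < ((m + 1 : ℕ) : WithBot ℕ) := by
  have h : bernsteinPoly m G ∈ Polynomial.degreeLT ℝ (m + 1) := by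
    refine Submodule.sum_mem _ fun i hi => ?_
    rw [← Polynomial.smul_eq_C_mul]
    refine Submodule.smul_mem _ _ (Polynomial.mem_degreeLT.mpr ?_)
    refine Polynomial.degree_le_natDegree.trans_lt (Nat.cast_lt.mpr ?_)
    have hi' : i ≤ m := Nat.lt_succ_iff.mp (Finset.mem_range.mp hi)
    have h1 : (1 - Polynomial.X : Polynomial ℝ).natDegree ≤ 1 := by compute_degree
    have h2 : (bernsteinPolynomial ℝ m i).natDegree ≤ (0 + i * 1) + (m - i) * 1 := by
      rw [bernsteinPolynomial]
      refine Polynomial.natDegree_mul_le_of_le (Polynomial.natDegree_mul_le_of_le ?_ ?_) ?_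
      · rw [Polynomial.natDegree_natCast]
      · exact Polynomial.natDegree_pow_le_of_le _ Polynomial.natDegree_X_le
      · exact Polynomial.natDegree_pow_le_of_le _ h1
    omega
  rw [← Polynomial.smul_eq_C_mul]
  exact Polynomial.mem_degreeLT.mp (Submodule.smul_mem _ _ h)

/-- A correction function far from the true one is small on many Fourier frequencies. -/
lemma card_far_ge {n m : ℕ} (hn : n ≠ 0) {G : Measure ℝ} (hG : G Set.univ ≤ 1) {c₀ : ℝ → ℝ}
    {ε B₀ w : ℝ} (hε : 0 < ε) (hB₀ : 0 < B₀) (hc₀ : ContinuousOn c₀ (Set.Icc 0 Real.pi))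
    (hc₀B : ∀ l ∈ Set.Icc 0 Real.pi, c₀ l ≤ B₀) (hc₀0 : ∀ l ∈ Set.Icc 0 Real.pi, 0 ≤ c₀ l)
    (hτ0 : 0 ≤ τ) (hτ : τ = ∫ x in (0 : ℝ)..1, c₀ (Real.pi * x))
    (hfar : ε < l1Dist (correctionFun τ (m + 1, G)) c₀)
    (hw : ∀ x ∈ Set.Icc 0 Real.pi, ∀ y ∈ Set.Icc 0 Real.pi, |x - y| ≤ Real.pi / n →
      |c₀ x - c₀ y| ≤ w) (hw' : Real.pi * w ≤ ε / 8)
    (hV' : Real.pi / n * (τ * (2 * (m + 1))) ≤ ε / 8) :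
    ε / (8 * Real.pi * B₀) * n ≤ ((Finset.univ.filter fun i : Fin n =>
      correctionFun τ (m + 1, G) (rowFreq n i) ≤
        (1 - ε / (8 * Real.pi * B₀)) * c₀ (rowFreq n i)).card : ℝ) := by
  have hpi := Real.pi_pos
  have hfun : correctionFun τ (m + 1, G) =
      fun l => τ * (bernsteinPoly m G).eval (l / Real.pi) :=
    funext fun l => correctionFun_succ τ m G l
  refine card_below_ge hn hε hB₀ hc₀ hc₀B hc₀0
    (c' := fun l => τ * ((bernsteinPoly m G).derivative.eval (l / Real.pi) * (1 / Real.pi)))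
    (fun l => ?_) ?_ (fun l hl => correctionFun_nonneg hτ0 _ hl) ?_ hfar hw hw'
    (V := τ * (2 * (m + 1))) ?_ hV'
  · rw [hfun]
    refine HasDerivAt.const_mul τ ?_
    exact ((bernsteinPoly m G).hasDerivAt (l / Real.pi)).comp l
      ((hasDerivAt_id l).div_const Real.pi)
  · have := (bernsteinPoly m G).derivative.continuous
    fun_prop
  -- This is where the known value of `τ` enters: `∫ c₀ = πτ`, while `∫ c` is `πτ` times the total
  -- cell mass of `G`, which is at most one.
  · have h1 : ∫ l in (0 : ℝ)..Real.pi, c₀ l = Real.pi * τ := by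
      rw [hτ, intervalIntegral.integral_comp_mul_left c₀ hpi.ne', mul_zero, mul_one,
        smul_eq_mul, mul_inv_cancel_left₀ hpi.ne']
    rw [h1, hfun, intervalIntegral.integral_const_mul,
      intervalIntegral.integral_comp_div (fun x => (bernsteinPoly m G).eval x) hpi.ne', zero_div,
      div_self hpi.ne', smul_eq_mul, integral_bernsteinPoly]
    have := mul_le_mul_of_nonneg_left (sum_cellMass_le_one m hG) (mul_nonneg hτ0 hpi.le)
    linarith
  · have h2 : ∀ l, |τ * ((bernsteinPoly m G).derivative.eval (l / Real.pi) * (1 / Real.pi))| =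
        τ * (1 / Real.pi) * |(bernsteinPoly m G).derivative.eval (l / Real.pi)| := fun l => by
      rw [abs_mul, abs_mul, abs_of_nonneg hτ0, abs_of_pos (by positivity : 0 < 1 / Real.pi)]
      ring
    simp only [h2]
    rw [intervalIntegral.integral_const_mul,
      intervalIntegral.integral_comp_div
        (fun x => |(bernsteinPoly m G).derivative.eval x|) hpi.ne', zero_div,
      div_self hpi.ne', smul_eq_mul]
    have := mul_le_mul_of_nonneg_left (integral_abs_derivative_bernsteinPoly_le m hG) hτ0
    calc _ = τ * ∫ x in (0 : ℝ)..1, |(bernsteinPoly m G).derivative.eval x| := by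
          field_simp
      _ ≤ _ := this

lemma eventually_modulus_le {c₀ : ℝ → ℝ} (hc₀ : ContinuousOn c₀ (Set.Icc 0 Real.pi)) {w : ℝ}
    (hw : 0 < w) : ∀ᶠ n : ℕ in atTop, ∀ x ∈ Set.Icc 0 Real.pi, ∀ y ∈ Set.Icc 0 Real.pi,
      |x - y| ≤ Real.pi / n → |c₀ x - c₀ y| ≤ w := by
  have hu := isCompact_Icc.uniformContinuousOn_of_continuous hc₀
  obtain ⟨d, hd, h⟩ := Metric.uniformContinuousOn_iff.mp hu w hw
  have hlim : Tendsto (fun n : ℕ => Real.pi / (n : ℝ)) atTop (𝓝 0) :=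
    tendsto_const_div_atTop_nhds_zero_nat Real.pi
  filter_upwards [hlim.eventually_lt_const hd] with n hn x hx y hy hxy
  exact (h x hx y hy (hxy.trans_lt hn)).le

end Separation

/-! ### Combined tests over all sublevel patterns -/

section SieveTests

variable {γ₀ γp : ℤ → ℝ} {β₀ βp η τ : ℝ} {g₀ : ℝ → ℝ} {M : ℝ} {D : Measure (Measure ℝ)} {p : PMF ℕ}

/-- Level at which both tails of the test statistics are controlled. -/
lemma exists_level (hC₀ : 0 < β₀) (hCp : 0 < βp) {e : ℝ} (he : 0 < e) :
    ∃ t : ℝ, 0 < t ∧ 2 * t * (covBound γ₀ / (2 * Real.pi * β₀)) ≤ e / 4 ∧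
      2 * t * (covBound γp / (2 * Real.pi * βp)) ≤ e / 4 := by
  have hq₀ : 0 ≤ covBound γ₀ / (2 * Real.pi * β₀) :=
    div_nonneg (covBound_nonneg _) (by positivity)
  have hqp : 0 ≤ covBound γp / (2 * Real.pi * βp) :=
    div_nonneg (covBound_nonneg _) (by positivity)
  set q₀ := covBound γ₀ / (2 * Real.pi * β₀)
  set qp := covBound γp / (2 * Real.pi * βp)
  have hQ : 0 < q₀ + qp + 1 := by positivity
  have ht : 0 < e / (8 * (q₀ + qp + 1)) := by positivity
  have hid : 2 * (e / (8 * (q₀ + qp + 1))) * (q₀ + qp + 1) = e / 4 := by field_simp; norm_num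
  refine ⟨e / (8 * (q₀ + qp + 1)), ht, ?_, ?_⟩
  · rw [← hid]
    exact mul_le_mul_of_nonneg_left (by linarith) (by positivity)
  · rw [← hid]
    exact mul_le_mul_of_nonneg_left (by linarith) (by positivity)

/-- The rejection region of the combined test. -/
def rejectRegion {n : ℕ} (v : Fin n → ℝ) (e : ℝ) (𝒥 : Finset (Finset (Fin n))) :
    Set (Fin n → ℝ) :=
  ⋃ J ∈ 𝒥.filter fun J => e * n ≤ (J.card : ℝ), {z | testStat v J z < (1 - e / 2) * J.card}

lemma measurableSet_rejectRegion {n : ℕ} (v : Fin n → ℝ) (e : ℝ) (𝒥 : Finset (Finset (Fin n))) :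
    MeasurableSet (rejectRegion v e 𝒥) :=
  Finset.measurableSet_biUnion _ fun J _ =>
    measurableSet_lt (measurable_testStat v J) measurable_const

lemma exp_tail_le {t e E j n : ℝ} (ht : 0 ≤ t) (he : 0 ≤ e) (hj : e * n ≤ j) :
    Real.exp (-t * (e / 4 * j - E)) ≤ Real.exp (t * E) * Real.exp (-(t * e ^ 2 / 4 * n)) := by
  rw [← Real.exp_add, Real.exp_le_exp]
  have h1 := mul_le_mul_of_nonneg_left hj (mul_nonneg ht he)
  linarith

/-- Union bound: at most `exp(kn)` patterns, each with error of order `exp(-t e² n / 4)`. -/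
lemma withDensity_rejectRegion_le (h₀ : IsRegular γ₀ β₀) {n : ℕ} {e t : ℝ} (he : 0 < e)
    (ht : 0 ≤ t) (hte : 2 * t * (covBound γ₀ / (2 * Real.pi * β₀)) ≤ e / 4)
    (𝒥 : Finset (Finset (Fin n))) {k : ℝ} (hk : (𝒥.card : ℝ) ≤ Real.exp (k * n)) :
    volume.withDensity (fun z => ENNReal.ofReal (gaussianDensity (autocovMatrix γ₀ n) z))
      (rejectRegion (specDiag γ₀ n) e 𝒥) ≤
      ENNReal.ofReal (Real.exp (t * (errBound γ₀ / (2 * Real.pi * β₀))) *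
        Real.exp (-((t * e ^ 2 / 4 - k) * n))) := by
  set E := errBound γ₀ / (2 * Real.pi * β₀) with hE
  set y := Real.exp (t * E) * Real.exp (-(t * e ^ 2 / 4 * n)) with hy
  have hy0 : 0 ≤ y := by positivity
  refine (measure_biUnion_finset_le _ _).trans ?_
  have hterm : ∀ J ∈ 𝒥.filter fun J => e * n ≤ (J.card : ℝ),
      volume.withDensity (fun z => ENNReal.ofReal (gaussianDensity (autocovMatrix γ₀ n) z))
        {z | testStat (specDiag γ₀ n) J z < (1 - e / 2) * J.card} ≤ ENNReal.ofReal y := by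
    intro J hJ
    rw [withDensity_apply _ (measurableSet_lt (measurable_testStat _ J) measurable_const)]
    exact (testStat_lower_tail h₀ J he ht hte).trans (ENNReal.ofReal_le_ofReal
      (exp_tail_le ht he.le (Finset.mem_filter.mp hJ).2))
  refine (Finset.sum_le_sum hterm).trans ?_
  rw [Finset.sum_const, nsmul_eq_mul, ← ENNReal.ofReal_natCast, ← ENNReal.ofReal_mul (by positivity)]
  refine ENNReal.ofReal_le_ofReal ?_
  have h1 : ((𝒥.filter fun J => e * n ≤ (J.card : ℝ)).card : ℝ) ≤ 𝒥.card := by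
    exact_mod_cast Finset.card_filter_le _ _
  calc _ ≤ Real.exp (k * n) * y := mul_le_mul_of_nonneg_right (h1.trans hk) hy0
    _ = Real.exp (t * E) * (Real.exp (k * n) * Real.exp (-(t * e ^ 2 / 4 * n))) := by
        rw [hy]; ring
    _ = _ := by
        rw [← Real.exp_add]
        congr 2
        ring

/-- The Fourier frequencies at which `c` is much smaller than `c₀`. -/
noncomputable def lowSet (n : ℕ) (e : ℝ) (c₀ c : ℝ → ℝ) : Finset (Fin n) :=
  Finset.univ.filter fun i => c (rowFreq n i) ≤ (1 - e) * c₀ (rowFreq n i)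

/-- Acceptance by the combined test means acceptance by the test for the low set of `c` itself, and
there the variances of the corrected model are too small by a factor `1 - e` up to the
diagonalization error. -/
lemma setLIntegral_compl_rejectRegion_le (h₀ : IsRegular γ₀ β₀) (hp : IsRegular γp βp) {n : ℕ}
    {e t : ℝ} (he : 0 < e) (he1 : e < 1) (ht : 0 ≤ t)
    (hte : 2 * t * (covBound γp / (2 * Real.pi * βp)) ≤ e / 4)
    {𝒥 : Finset (Finset (Fin n))} {c : ℝ → ℝ} (hc : ∀ l ∈ Set.Icc 0 Real.pi, 0 ≤ c l)
    (hJ : lowSet n e (trueCorrection γ₀ γp η) c ∈ 𝒥)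
    (hcard : e * n ≤ ((lowSet n e (trueCorrection γ₀ γp η) c).card : ℝ)) :
    ∫⁻ z in (rejectRegion (specDiag γ₀ n) e 𝒥)ᶜ,
        ENNReal.ofReal (correctedLikelihood γp η n c z) ≤
      ENNReal.ofReal (Real.exp (t * (errBound γp / (2 * Real.pi * βp))) *
        Real.exp (-(t * e ^ 2 / 4 * n))) := by
  set J := lowSet n e (trueCorrection γ₀ γp η) c with hJdef
  rcases correctedLikelihood_eq_zero_or (η := η) (n := n) hp hc with h | ⟨hC, h⟩
  · simp [h]
  · simp only [h]
    have hsub : (rejectRegion (specDiag γ₀ n) e 𝒥)ᶜ ⊆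
        {z | (1 - e / 2) * J.card ≤ testStat (specDiag γ₀ n) J z} := by
      intro z hz
      by_contra hcon
      rw [Set.mem_ofPred_eq, not_le] at hcon
      refine hz (Set.mem_biUnion (Finset.mem_filter.mpr ⟨hJ, hcard⟩) ?_)
      exact hcon
    refine (lintegral_mono_set hsub).trans ?_
    refine (testStat_upper_tail hp J h₀.specDiag_pos hC he he1 ?_ ht hte).trans
      (ENNReal.ofReal_le_ofReal (exp_tail_le ht he.le hcard))
    intro i hi
    rw [correctionDiag_mul_specDiag hp, ← trueCorrection_mul_linkFactor (η := η) hp, ← mul_assoc]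
    exact mul_le_mul_of_nonneg_right (Finset.mem_filter.mp hi).2 (linkFactor_pos hp i).le

/-- Exponentially powerful tests against correction functions that are far from the true one. -/
lemma exists_tests (h₀ : IsRegular γ₀ β₀) (hp : IsRegular γp βp)
    {a A : ℝ} (ha : 0 < a) (hg : ∀ x ∈ Set.Ioo (0 : ℝ) 1, a ≤ g₀ x ∧ g₀ x ≤ A) (hM : 0 < M)
    (hD : IsDirichletProcess D (ENNReal.ofReal M • baseMeasure g₀)) (hp0 : p 0 = 0)
    {B b : ℝ} (hB : 0 < B) (hb : 0 < b)
    (hpk : ∀ k : ℕ, 1 ≤ k → p k ≤ ENNReal.ofReal (B * Real.exp (-b * k * Real.log k)))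
    (hτ : τ = ∫ x in (0 : ℝ)..1, trueCorrection γ₀ γp η (Real.pi * x)) {ε : ℝ} (hε : 0 < ε) :
    ∃ r K : ℝ, 0 < r ∧ ∀ᶠ n : ℕ in atTop, ∃ R : Set (Fin n → ℝ), ∃ A' : Set (ℕ × Measure ℝ),
      MeasurableSet R ∧
      {θ | ε < l1Dist (correctionFun τ θ) (trueCorrection γ₀ γp η)} ≤ᵐ[prior p D] A' ∧
      volume.withDensity (fun z => ENNReal.ofReal (gaussianDensity (autocovMatrix γ₀ n) z)) R ≤
        ENNReal.ofReal (K * Real.exp (-(r * n))) ∧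
      ∫⁻ z in Rᶜ, ∫⁻ θ in A',
        ENNReal.ofReal (correctedLikelihood γp η n (correctionFun τ θ) z) ∂prior p D ≤
        ENNReal.ofReal (K * Real.exp (-(r * n))) := by
  have hpi := Real.pi_pos
  have := hD.1
  have hprior : IsProbabilityMeasure (prior p D) := by unfold prior; infer_instance
  have hcont := continuousOn_trueCorrection (η := η) h₀ hp
  set c₀ := trueCorrection γ₀ γp η with hc₀
  have hpos : ∀ l ∈ Set.Icc 0 Real.pi, 0 < c₀ l := fun l hl => trueCorrection_pos h₀ hp hl
  obtain ⟨l₁, hl₁, hmax⟩ := isCompact_Icc.exists_isMaxOn (Set.nonempty_Icc.mpr hpi.le) hcont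
  have hτ0 : 0 ≤ τ := by
    rw [hτ]
    refine intervalIntegral.integral_nonneg zero_le_one fun x hx => (hpos _ ?_).le
    exact ⟨mul_nonneg hpi.le hx.1, mul_le_of_le_one_right hpi.le hx.2⟩
  -- Adding `ε` to the maximum ensures `e < 1`.
  set B₀ := c₀ l₁ + ε with hB₀
  have hB₀0 : 0 < B₀ := add_pos (hpos l₁ hl₁) hε
  have hc₀B : ∀ l ∈ Set.Icc 0 Real.pi, c₀ l ≤ B₀ := fun l hl =>
    (hmax hl).trans (by rw [hB₀]; linarith)
  set e := ε / (8 * Real.pi * B₀) with he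
  have he0 : 0 < e := by positivity
  have he1 : e < 1 := by
    rw [he, div_lt_one (by positivity)]
    have h1 := hpos l₁ hl₁
    nlinarith [Real.pi_gt_three]
  obtain ⟨t, ht, ht₀, htp⟩ := exists_level (γ₀ := γ₀) (γp := γp) h₀.pos hp.pos he0
  -- Half of the exponent `t e² / 4` of a single test, so that counting the patterns leaves the
  -- other half.
  set k := t * e ^ 2 / 8 with hk
  have hk0 : 0 < k := by positivity
  obtain ⟨C, hC, htail⟩ := exists_tail_bound hB hb hpk
  set E₀ := Real.exp (t * (errBound γ₀ / (2 * Real.pi * β₀))) with hE₀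
  set Ep := Real.exp (t * (errBound γp / (2 * Real.pi * βp))) with hEp
  have hE₀0 : 0 < E₀ := Real.exp_pos _
  have hEp0 : 0 < Ep := Real.exp_pos _
  set r := min k (b / 2 * (k / 2)) with hr
  have hr0 : 0 < r := lt_min hk0 (by positivity)
  refine ⟨r, E₀ + Ep + C, hr0, ?_⟩
  -- The two constants match the error budgets `ε/8` for the modulus of `c₀` and for the total
  -- variation `2τ(m+1)` of `c`; `τ + 1` avoids a division by zero.
  have hmod := eventually_modulus_le hcont (w := ε / (8 * Real.pi)) (by positivity)
  have hvar := eventually_sieveOrder_le hk0 (y := ε / (16 * Real.pi * (τ + 1))) (by positivity)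
  filter_upwards [hmod, hvar, eventually_le_sieveOrder_mul_log hk0, eventually_ge_atTop 1]
    with n hw hvn hlog hn
  have hnpos : (0 : ℝ) < n := by exact_mod_cast hn
  set kn := sieveOrder k n with hkn
  obtain ⟨𝒥, h𝒥card, h𝒥⟩ := exists_sublevel_patterns kn (fun i : Fin n => rowFreq n i / Real.pi)
    fun i => (1 - e) * c₀ (rowFreq n i)
  have hexp : ∀ s : ℝ, r ≤ s → Real.exp (-(s * n)) ≤ Real.exp (-(r * n)) := fun s hs =>
    Real.exp_le_exp.mpr (neg_le_neg (mul_le_mul_of_nonneg_right hs hnpos.le))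
  -- `A₁` lies off the sieve and is controlled by the prior tail alone. `A₂` records just what the
  -- tests need: a pattern in the list with many frequencies.
  set A₁ : Set (ℕ × Measure ℝ) := {j | kn + 1 ≤ j} ×ˢ Set.univ with hA₁
  set A₂ : Set (ℕ × Measure ℝ) := {θ | lowSet n e c₀ (correctionFun τ θ) ∈ 𝒥 ∧
    e * n ≤ ((lowSet n e c₀ (correctionFun τ θ)).card : ℝ)} with hA₂
  refine ⟨rejectRegion (specDiag γ₀ n) e 𝒥, A₁ ∪ A₂, measurableSet_rejectRegion _ _ _, ?_, ?_, ?_⟩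
  -- Containment holds only almost surely, since total mass at most one for `G` and `k ≠ 0` are
  -- almost sure properties of the prior.
  · have hae₁ : ∀ᵐ θ ∂prior p D, θ.2 Set.univ ≤ 1 :=
      Measure.quasiMeasurePreserving_snd.ae (ae_univ_le_one ha hg hM hD)
    have hae₂ : ∀ᵐ θ ∂prior p D, θ.1 ≠ 0 := by
      refine Measure.quasiMeasurePreserving_fst.ae (p := fun j => j ≠ 0) ?_
      rw [ae_iff]
      have : {j : ℕ | ¬ j ≠ 0} = {0} := by ext; simp
      rw [this, PMF.toMeasure_apply_singleton _ _ (measurableSet_singleton _), hp0]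
    filter_upwards [hae₁, hae₂] with θ h1 h2 hfar
    obtain ⟨j, G⟩ := θ
    obtain ⟨m, rfl⟩ := Nat.exists_eq_succ_of_ne_zero h2
    by_cases hj : kn + 1 ≤ m + 1
    · exact Or.inl ⟨hj, Set.mem_univ _⟩
    refine Or.inr ⟨?_, ?_⟩
    · have hmem := h𝒥 (Polynomial.C τ * bernsteinPoly m G)
        ((degree_bernsteinPoly_lt m G τ).trans_le (Nat.cast_le.mpr (by omega)))
      have heq : lowSet n e c₀ (correctionFun τ (m + 1, G)) = Finset.univ.filter fun i =>
          (Polynomial.C τ * bernsteinPoly m G).eval (rowFreq n i / Real.pi) ≤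
            (1 - e) * c₀ (rowFreq n i) := by
        simp only [lowSet, correctionFun_succ, Polynomial.eval_mul, Polynomial.eval_C]
      exact heq ▸ hmem
    · refine card_far_ge (by omega) h1 hε hB₀0 hcont hc₀B (fun l hl => (hpos l hl).le) hτ0 hτ hfar
        hw (le_of_eq (by field_simp)) ?_
      have hmk : ((m : ℝ) + 1) ≤ kn := by exact_mod_cast (by omega : m + 1 ≤ kn)
      have h3 := hmk.trans hvn
      rw [div_mul_eq_mul_div, div_le_iff₀ hnpos]
      calc Real.pi * (τ * (2 * (m + 1))) ≤
            Real.pi * ((τ + 1) * (2 * (ε / (16 * Real.pi * (τ + 1)) * n))) := by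
            gcongr
            linarith
        _ = ε / 8 * n := by field_simp; norm_num
  · refine (withDensity_rejectRegion_le h₀ he0 ht.le ht₀ 𝒥 (k := k) ?_).trans
      (ENNReal.ofReal_le_ofReal ?_)
    · refine le_trans ?_ (pow_sieveOrder_le hk0.le hn)
      exact_mod_cast h𝒥card
    · have h1 : r ≤ t * e ^ 2 / 4 - k := by
        refine (min_le_left _ _).trans ?_
        rw [hk]; linarith
      exact mul_le_mul (by linarith) (hexp _ h1) (Real.exp_nonneg _) (by positivity)
  · have hLm : Measurable fun q : (Fin n → ℝ) × (ℕ × Measure ℝ) =>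
        ENNReal.ofReal (correctedLikelihood γp η n (correctionFun τ q.2) q.1) :=
      ((measurable_correctedLikelihood γp η τ n).comp measurable_swap).ennreal_ofReal
    -- Integrating over the data first leaves, for each `θ`, the type II error on `A₂` and a mass of
    -- at most one on `A₁`.
    rw [lintegral_lintegral_swap (by exact hLm.aemeasurable)]
    refine (lintegral_union_le _ _ _).trans ?_
    have h1 : ∫⁻ θ in A₁, (∫⁻ z in (rejectRegion (specDiag γ₀ n) e 𝒥)ᶜ,
        ENNReal.ofReal (correctedLikelihood γp η n (correctionFun τ θ) z)) ∂prior p D ≤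
        ENNReal.ofReal (C * Real.exp (-(r * n))) := by
      calc _ ≤ ∫⁻ _ in A₁, 1 ∂prior p D := by
            refine setLIntegral_mono measurable_const fun θ _ => ?_
            exact (setLIntegral_le_lintegral _ _).trans (lintegral_correctedLikelihood_le_one hp
              fun l hl => correctionFun_nonneg hτ0 θ hl)
        _ = p.toMeasure {j | kn + 1 ≤ j} := by
            rw [setLIntegral_one, hA₁, prior, Measure.prod_prod, measure_univ, mul_one]
        _ ≤ _ := htail (kn + 1) (by omega)
        _ ≤ _ := by
            refine ENNReal.ofReal_le_ofReal (mul_le_mul_of_nonneg_left ?_ hC.le)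
            refine le_trans (Real.exp_le_exp.mpr ?_) (hexp _ (min_le_right _ _))
            have := mul_le_mul_of_nonneg_left hlog (half_pos hb).le
            linarith
    have h2 : ∫⁻ θ in A₂, (∫⁻ z in (rejectRegion (specDiag γ₀ n) e 𝒥)ᶜ,
        ENNReal.ofReal (correctedLikelihood γp η n (correctionFun τ θ) z)) ∂prior p D ≤
        ENNReal.ofReal (Ep * Real.exp (-(r * n))) := by
      calc _ ≤ ∫⁻ _ in A₂, ENNReal.ofReal (Ep * Real.exp (-(r * n))) ∂prior p D := by
            refine setLIntegral_mono measurable_const fun θ hθ => ?_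
            refine (setLIntegral_compl_rejectRegion_le h₀ hp he0 he1 ht.le htp
              (fun l hl => correctionFun_nonneg hτ0 θ hl) hθ.1 hθ.2).trans
              (ENNReal.ofReal_le_ofReal ?_)
            refine mul_le_mul_of_nonneg_left (hexp _ ?_) hEp0.le
            refine (min_le_left _ _).trans ?_
            rw [hk]
            have : 0 ≤ t * e ^ 2 := by positivity
            linarith
        _ ≤ _ := by
            rw [setLIntegral_const]
            exact mul_le_of_le_one_right' prob_le_one
    refine (add_le_add h1 h2).trans ?_
    rw [← ENNReal.ofReal_add (by positivity) (by positivity)]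
    refine ENNReal.ofReal_le_ofReal ?_
    have := mul_pos hE₀0 (Real.exp_pos (-(r * n)))
    linarith

end SieveTests

/-! ### The law of the observed Gaussian series -/

section Data

variable {Ω : Type*} [MeasurableSpace Ω] {P : Measure Ω} {Z : ℕ → Ω → ℝ}
  {γ : ℤ → ℝ} {β : ℝ}

/-- Symmetry of the covariance, read off at the time pairs `(0, m)` and `(m, 0)`. -/
lemma IsStationaryGaussian.even (hZ : IsStationaryGaussian Z P γ) (h : ℤ) : γ (-h) = γ h := by
  have key : ∀ m : ℕ, γ (-(m : ℤ)) = γ m := fun m => by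
    have h1 := hZ.autocov 0 m
    have h2 := hZ.autocov m 0
    rw [covariance_comm] at h1
    rw [h1] at h2
    simpa using h2
  rcases Int.eq_nat_or_neg h with ⟨m, rfl | rfl⟩
  · exact key m
  · rw [neg_neg, key m]

lemma IsStationaryGaussian.hasGaussianLaw (hZ : IsStationaryGaussian Z P γ) (n : ℕ) :
    HasGaussianLaw (fun ω (i : Fin n) => Z ((i : ℕ) + 1) ω) P := by
  let I : Finset ℕ := Finset.range (n + 1)
  have hmem : ∀ i : Fin n, (i : ℕ) + 1 ∈ I := fun i => by
    rw [Finset.mem_range]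
    omega
  let T : (I → ℝ) →L[ℝ] (Fin n → ℝ) :=
    ContinuousLinearMap.pi fun i => ContinuousLinearMap.proj ⟨(i : ℕ) + 1, hmem i⟩
  exact (hZ.gaussian.hasGaussianLaw I).map_fun T

lemma IsStationaryGaussian.map_eq [IsProbabilityMeasure P] (hZ : IsStationaryGaussian Z P γ) (h : IsRegular γ β) (n : ℕ) :
    P.map (fun ω (i : Fin n) => Z ((i : ℕ) + 1) ω) =
      volume.withDensity fun z => ENNReal.ofReal (gaussianDensity (autocovMatrix γ n) z) := by
  refine map_eq_withDensity_gaussianDensity (X := fun i : Fin n => Z ((i : ℕ) + 1))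
    (hZ.hasGaussianLaw n) (fun i => hZ.mean_zero _) (h.posDef n) fun i j => ?_
  rw [hZ.autocov, autocovMatrix, Matrix.of_apply]
  congr 1
  push_cast
  ring

lemma IsStationaryGaussian.memLp (hZ : IsStationaryGaussian Z P γ) (t : ℕ) : MemLp (Z t) 2 P := by
  let T : (({t} : Finset ℕ) → ℝ) →L[ℝ] ℝ :=
    ContinuousLinearMap.proj ⟨t, Finset.mem_singleton_self t⟩
  exact ((hZ.gaussian.hasGaussianLaw {t}).map_fun T).memLp_two

lemma IsStationaryGaussian.integral_mul (hZ : IsStationaryGaussian Z P γ) (s t : ℕ) :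
    ∫ ω, Z s ω * Z t ω ∂P = γ ((s : ℤ) - t) := by
  rw [← hZ.autocov, covariance, hZ.mean_zero, hZ.mean_zero]
  simp

end Data

end CorrectedLikelihood

/-! ### Assembly of the consistency theorem -/

theorem mainTheorem1 {Ω : Type*} [MeasurableSpace Ω] (P : Measure Ω) [IsProbabilityMeasure P]
    -- damping parameter
    (η : ℝ) (hη : η ∈ Set.Icc (0 : ℝ) 1)
    -- Gaussian working model
    (γp : ℤ → ℝ) (hγp : CorrectedLikelihood.IsAutocovariance γp)
    (hγp_sum : ∃ α : ℝ, 1 < α ∧ Summable fun h : ℤ => |(h : ℝ)| ^ α * |γp h|)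
    (hfp : ∃ β : ℝ, 0 < β ∧ ∀ l ∈ Set.Icc (-Real.pi) Real.pi,
      β ≤ CorrectedLikelihood.spectralDensity γp l)
    -- observed time series
    (Z : ℕ → Ω → ℝ) (γ₀ : ℤ → ℝ) (hZ : CorrectedLikelihood.IsStationaryGaussian Z P γ₀)
    (hγ₀_sum : ∃ α : ℝ, 1 < α ∧ Summable fun h : ℤ => |(h : ℝ)| ^ α * |γ₀ h|)
    (hf₀ : ∃ β : ℝ, 0 < β ∧ ∀ l ∈ Set.Icc (-Real.pi) Real.pi,
      β ≤ CorrectedLikelihood.spectralDensity γ₀ l)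
    -- (P1): prior of k, a law on 1, 2, …
    (p : PMF ℕ) (hp_zero : p 0 = 0)
    (hp : ∃ B b : ℝ, 0 < B ∧ 0 < b ∧ ∀ k : ℕ, 1 ≤ k →
      0 < p k ∧ p k ≤ ENNReal.ofReal (B * Real.exp (-b * k * Real.log k)))
    -- (P2): prior of G, a Dirichlet process with base measure M G₀
    (g₀ : ℝ → ℝ) (hg₀_cont : ContinuousOn g₀ (Set.Ioo 0 1))
    (hg₀_bdd : ∃ a A : ℝ, 0 < a ∧ ∀ x ∈ Set.Ioo (0 : ℝ) 1, a ≤ g₀ x ∧ g₀ x ≤ A)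
    (hg₀_int : ∫ x in (0 : ℝ)..1, g₀ x = 1)
    (M : ℝ) (hM : 0 < M) (D : Measure (Measure ℝ))
    (hD : CorrectedLikelihood.IsDirichletProcess D
      (ENNReal.ofReal M • CorrectedLikelihood.baseMeasure g₀))
    -- (P3): τ is fixed at its true value
    (τ : ℝ)
    (hτ : τ = ∫ x in (0 : ℝ)..1, CorrectedLikelihood.trueCorrection γ₀ γp η (Real.pi * x))
    (ε : ℝ) (hε : 0 < ε) :
    ∀ δ : ℝ, 0 < δ →
      Tendsto
        (fun n : ℕ => P {ω | ENNReal.ofReal δ <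
          CorrectedLikelihood.pseudoPosterior γp η τ (CorrectedLikelihood.prior p D) n
            (fun i : Fin n => Z ((i : ℕ) + 1) ω)
            {θ | ε < CorrectedLikelihood.l1Dist (CorrectedLikelihood.correctionFun τ θ)
              (CorrectedLikelihood.trueCorrection γ₀ γp η)}})
        atTop (𝓝 0) := by
  obtain ⟨αp, hαp, hsp⟩ := hγp_sum
  obtain ⟨α₀, hα₀, hs₀⟩ := hγ₀_sum
  obtain ⟨βp, hβp, hlp⟩ := hfp
  obtain ⟨β₀, hβ₀, hl₀⟩ := hf₀
  obtain ⟨B, b, hB, hb, hpk⟩ := hp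
  obtain ⟨a, A, ha, hg⟩ := hg₀_bdd
  obtain ⟨hsp1, hsp2⟩ := CorrectedLikelihood.summable_abs_of_moment hαp hsp
  obtain ⟨hs₀1, hs₀2⟩ := CorrectedLikelihood.summable_abs_of_moment hα₀ hs₀
  have hRp : CorrectedLikelihood.IsRegular γp βp := ⟨hsp1, hsp2, hγp.1, hβp, hlp⟩
  have hR₀ : CorrectedLikelihood.IsRegular γ₀ β₀ := ⟨hs₀1, hs₀2, hZ.even, hβ₀, hl₀⟩
  have hDprob := hD.1
  have hprior : IsProbabilityMeasure (CorrectedLikelihood.prior p D) := by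
    unfold CorrectedLikelihood.prior
    infer_instance
  have hlaw := fun n => hZ.map_eq hR₀ n
  have haem : ∀ n : ℕ, AEMeasurable (fun ω (i : Fin n) => Z ((i : ℕ) + 1) ω) P := fun n =>
    (hZ.hasGaussianLaw n).aemeasurable
  have hprod : ∀ (n : ℕ) (s t : Fin n), Measurable fun z : Fin n → ℝ => z s * z t := fun n s t =>
    (measurable_pi_apply s).mul (measurable_pi_apply t)
  obtain ⟨r, K, hr, htests⟩ := CorrectedLikelihood.exists_tests hR₀ hRp ha hg hM hD hp_zero hB hb
    (fun k hk => (hpk k hk).2) hτ hε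
  intro δ hδ
  have hmain := CorrectedLikelihood.tendsto_posterior_zero (Pr := CorrectedLikelihood.prior p D)
    (p₀ := fun n z => ENNReal.ofReal
      (CorrectedLikelihood.gaussianDensity (CorrectedLikelihood.autocovMatrix γ₀ n) z))
    (L := fun n θ z => ENNReal.ofReal (CorrectedLikelihood.correctedLikelihood γp η n
      (CorrectedLikelihood.correctionFun τ θ) z))
    (fun n => (CorrectedLikelihood.measurable_gaussianDensity _).ennreal_ofReal)
    (fun n => (CorrectedLikelihood.measurable_correctedLikelihood γp η τ n).ennreal_ofReal)
    (fun δ hδ κ hκ => CorrectedLikelihood.exists_good_likelihood_ratio hR₀ hRp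
      (fun n => by
        rw [← hlaw n]
        exact Measure.isProbabilityMeasure_map (haem n))
      (fun n s t => by
        rw [← hlaw n, integrable_map_measure (hprod n s t).aestronglyMeasurable (haem n)]
        exact (hZ.memLp _).integrable_mul (hZ.memLp _))
      (fun n s t => by
        rw [← hlaw n, integral_map (haem n) (hprod n s t).aestronglyMeasurable, hZ.integral_mul,
          CorrectedLikelihood.autocovMatrix, Matrix.of_apply]
        congr 1
        push_cast
        ring)
      ha hg hM hD (fun k hk => (hpk k hk).1) hτ hδ hκ)
    hr htests hδ
  refine tendsto_of_tendsto_of_tendsto_of_le_of_le tendsto_const_nhds hmain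
    (fun _ => zero_le) fun n => ?_
  -- `Measure.le_map_apply` holds for arbitrary sets, as does `withDensity_apply'` below, so
  -- measurability of the far set and of the posterior event is not needed.
  refine le_trans ?_ ((Measure.le_map_apply (haem n) _).trans_eq (by rw [hlaw n]))
  refine measure_mono fun ω hω => ?_
  have hω' : ENNReal.ofReal δ < CorrectedLikelihood.pseudoPosterior γp η τ
      (CorrectedLikelihood.prior p D) n (fun i : Fin n => Z ((i : ℕ) + 1) ω)
      {θ | ε < CorrectedLikelihood.l1Dist (CorrectedLikelihood.correctionFun τ θ)
        (CorrectedLikelihood.trueCorrection γ₀ γp η)} := hω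
  rw [CorrectedLikelihood.pseudoPosterior, Measure.smul_apply, withDensity_apply',
    smul_eq_mul] at hω'
  exact hω'
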